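/- Let $\mathbb{T}=\mathbb{R}/2\pi\mathbb{Z}$ and let $L^2_0(\mathbb{T}^2)=\{\omega\in L^2(\mathbb{T}^2;\mathbb{C}) : \int_0^{2\pi}\omega(x,y)\,dx=0 \text{ for a.e. } y\in\mathbb{T}\}$. Let $A=\Delta$ with domain $D(A)=W^{2,2}(\mathbb{T}^2)\cap L^2_0(\mathbb{T}^2)$, let $\hat\Lambda\omega=-i\,\partial_x\big(\sin y\,(I+A^{-1})\omega\big)$ with domain $\{\omega\in L^2_0(\mathbb{T}^2) : \partial_x(\sin y\,\omega)\in L^2_0(\mathbb{T}^2)\}$, and for $\alpha\in\mathbb{R}$ let $$L_\alpha=A-i\alpha\hat\Lambda=\Delta-\alpha\,\partial_x\big(\sin y\,(I+\Delta^{-1})\,\cdot\,\big),\qquad D(L_\alpha)=D(A).$$ For $l\in\mathbb{Z}$ let $(\mathcal{P}_l\omega)(x,y)=\frac{1}{2\pi}\int_0^{2\pi}\omega(s,y)e^{-ils}\,ds\;e^{ilx}$, let $Y=\{\omega\in L^2_0(\mathbb{T}^2) : \int_0^{2\pi}(\mathcal{P}_l\omega)(x,y)\,dy=0 \text{ for all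 } x\in\mathbb{T} \text{ and } |l|=1\}$, and let $\mathbb{Q}$ be the orthogonal projection of $L^2_0(\mathbb{T}^2)$ onto $Y$. Then there are constants $C,c,\alpha_0>0$ such that the following holds for all $\alpha\in\mathbb{R}$ with $|\alpha|\ge\alpha_0$. The operator $L_\alpha$ generates a strongly continuous semigroup $\{e^{tL_\alpha}\}_{t\ge0}$ on $L^2_0(\mathbb{T}^2)$, and for all $l\in\mathbb{Z}\setminus\{0\}$ and $f\in L^2_0(\mathbb{T}^2)$, with $\|\cdot\|=\|\cdot\|_{L^2(\mathbb{T}^2)}$, $$\|\mathbb{Q}\mathcal{P}_le^{tL_\alpha}f\|\le 2e^{-\frac12(2l^2-1)t}\,\|\mathbb{Q}\mathcal{P}_lf\|,\qquad t>0,$$ $$\|\mathbb{Q}\mathcal{P}_le^{tL_\alpha}f\|\le Ce^{-c|\alpha l|^{1/2}t}\,\|\mathbb{Q}\mathcal{P}_lf\|,\qquad t\ge|\alpha l|^{-1/2},$$ and, if $|l|=1$, $$\|(I-\mathbb{Q})\mathcal{P}_le^{tL_\alpha}f\|\le C|\alpha|^{1/3}\,\big|\log|\alpha|\big|\,e^{-t/2}\,\|\mathbb{Q}\mathcal{P}_lf\|+e^{-t}\,\|(I-\mathbb{Q})\mathcal{P}_lf\|,\qquad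 t>0.$$ -/

import Mathlib

noncomputable section

open MeasureTheory Filter Topology
open scoped InnerProductSpace

namespace Kolmogorov

/-- The circle `𝕋 = ℝ / 2πℤ`, with Lebesgue measure of total mass `2π`. -/
abbrev Circ : Type := AddCircle (2 * Real.pi)

instance instFactTwoPiPos : Fact (0 < 2 * Real.pi) := ⟨Real.two_pi_pos⟩

/-- The torus `𝕋²`; points are written `(x, y)`. -/
abbrev Torus : Type := Circ × Circ

/-- The complex Hilbert space `L²(𝕋²)`. -/
abbrev L2 : Type := Lp ℂ 2 (volume : Measure Torus)

/-- The function `sin y` on `𝕋`. -/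
def sinCirc : Circ → ℝ := Real.sin_periodic.lift

theorem norm_fourier (l : ℤ) (x : Circ) : ‖(fourier l x : ℂ)‖ = 1 := by
  rw [fourier_apply]
  exact Circle.norm_coe _

theorem L2.integrable (ω : L2) : Integrable (ω : Torus → ℂ) :=
  (Lp.memLp ω).integrable (by norm_num)

theorem L2.ae_integrable_slice (ω : L2) :
    ∀ᵐ y : Circ, Integrable (fun x : Circ => (ω : Torus → ℂ) (x, y)) :=
  (L2.integrable ω).prod_left_ae

theorem ae_slice {p : Torus → Prop} (h : ∀ᵐ z : Torus, p z) :
    ∀ᵐ y : Circ, ∀ᵐ x : Circ, p (x, y) := by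
  have h' : ∀ᵐ z : Circ × Circ, p z.swap :=
    (Measure.measurePreserving_swap (μ := (volume : Measure Circ))
      (ν := (volume : Measure Circ))).quasiMeasurePreserving.ae h
  exact Measure.ae_ae_of_ae_prod h'

/-- The space `L²₀(𝕋²)` of all `ω ∈ L²(𝕋²)` with `∫ ω(x, y) dx = 0` for almost every `y`. -/
def L20 : Submodule ℂ L2 where
  carrier := {ω | ∀ᵐ y : Circ, ∫ x : Circ, (ω : Torus → ℂ) (x, y) = 0}
  zero_mem' := by
    have h := ae_slice (Lp.coeFn_zero ℂ 2 (volume : Measure Torus))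
    filter_upwards [h] with y hy
    rw [integral_congr_ae hy]
    simp
  add_mem' := by
    intro f g hf hg
    have h := ae_slice (Lp.coeFn_add f g)
    filter_upwards [h, hf, hg, L2.ae_integrable_slice f, L2.ae_integrable_slice g]
      with y hy hfy hgy hfi hgi
    rw [integral_congr_ae hy]
    simp only [Pi.add_apply]
    rw [integral_add hfi hgi, hfy, hgy, add_zero]
  smul_mem' := by
    intro a f hf
    have h := ae_slice (Lp.coeFn_smul a f)
    change ∀ᵐ y : Circ, _
    filter_upwards [h, hf] with y hy hfy
    rw [integral_congr_ae hy]
    simp only [Pi.smul_apply]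
    rw [integral_smul, hfy, smul_zero]

/-! ### Weak derivatives and Sobolev functions -/

/-- Smooth functions on the torus: those whose `2π`-periodic lift to `ℝ²` is smooth. -/
def IsSmooth (φ : Torus → ℂ) : Prop :=
  ContDiff ℝ (⊤ : ℕ∞) (fun p : ℝ × ℝ => φ ((p.1 : Circ), (p.2 : Circ)))

/-- The classical partial derivative in `x`. -/
def dx (φ : Torus → ℂ) : Torus → ℂ :=
  fun p => deriv (fun s : ℝ => φ (p.1 + (s : Circ), p.2)) 0

/-- The classical partial derivative in `y`. -/
def dy (φ : Torus → ℂ) : Torus → ℂ :=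
  fun p => deriv (fun s : ℝ => φ (p.1, p.2 + (s : Circ))) 0

/-- `g` is the weak derivative `∂ₓᵏ ∂ᵧᵐ f` on the torus (used for square-integrable `f`, `g`). -/
def HasWeakPartial (k m : ℕ) (f g : Torus → ℂ) : Prop :=
  ∀ φ : Torus → ℂ, IsSmooth φ →
    ∫ p, f p * (dx^[k] (dy^[m] φ)) p = (-1) ^ (k + m) * ∫ p, g p * φ p

/-- `W^{2,2}(𝕋²)`: all weak partial derivatives of order at most two are in `L²`. -/
def MemW22 (ω : L2) : Prop :=
  ∀ k m : ℕ, k + m ≤ 2 → ∃ g : L2, HasWeakPartial k m ω g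

/-! ### The operators, given by their graphs -/

/-- `ω ∈ D(A) = W^{2,2}(𝕋²) ∩ L²₀(𝕋²)` and `A ω = Δ ω = g`. -/
def IsA (ω g : L20) : Prop :=
  MemW22 ω ∧ ∃ gxx gyy : L2, HasWeakPartial 2 0 (ω : L2) gxx ∧
    HasWeakPartial 0 2 (ω : L2) gyy ∧ (g : L2) = gxx + gyy

/-- `h ∈ L²₀(𝕋²)` is the weak derivative `∂ₓ (sin y · ω)`. -/
def IsDxSin (ω h : L20) : Prop :=
  HasWeakPartial 1 0 (fun p => (sinCirc p.2 : ℂ) * ((ω : L2) : Torus → ℂ) p) (h : L2)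

/-- `ω ∈ D(Λ̂) = {ω ∈ L²₀ | ∂ₓ (sin y · ω) ∈ L²₀}` and `Λ̂ ω = -i ∂ₓ (sin y · (ω + A⁻¹ ω)) = g`.
Here `ψ` is `A⁻¹ ω`. -/
def IsLambda (ω g : L20) : Prop :=
  (∃ h : L20, IsDxSin ω h) ∧
    ∃ ψ h : L20, IsA ψ ω ∧ IsDxSin (ω + ψ) h ∧ g = (-Complex.I) • h

/-- `ω ∈ D(L_α) = D(A)` and `L_α ω = A ω - i α Λ̂ ω = g`. -/
def IsLAlpha (α : ℝ) (ω g : L20) : Prop :=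
  ∃ a b : L20, IsA ω a ∧ IsLambda ω b ∧ g = a - (Complex.I * (α : ℂ)) • b

/-! ### Semigroups -/

/-- `S` (on times `t ≥ 0`) is a strongly continuous semigroup of bounded operators on `E` whose
infinitesimal generator is the operator with graph `G`: the right derivative of `t ↦ S t f` at `0`
exists and equals `g` exactly when `f` is in the domain and is mapped to `g`. -/
structure IsSemigroupGeneratedBy {E : Type*} [NormedAddCommGroup E] [NormedSpace ℂ E]
    (S : ℝ → E →L[ℂ] E) (G : E → E → Prop) : Prop where
  zero : S 0 = ContinuousLinearMap.id ℂ E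
  add : ∀ s t : ℝ, 0 ≤ s → 0 ≤ t → S (s + t) = (S s).comp (S t)
  tendsto_zero : ∀ f : E, Tendsto (fun t : ℝ => S t f) (𝓝[>] 0) (𝓝 f)
  generator : ∀ f g : E,
    G f g ↔ Tendsto (fun t : ℝ => ((t⁻¹ : ℝ) : ℂ) • (S t f - f)) (𝓝[>] 0) (𝓝 g)

/-! ### Fourier modes in `x` and the projection `ℚ` -/

/-- `y ↦ (2π)⁻¹ ∫ ω(s, y) e^{-ils} ds`. -/
def modeCoeff (l : ℤ) (ω : L2) (y : Circ) : ℂ :=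
  ((2 * Real.pi : ℝ) : ℂ)⁻¹ * ∫ s : Circ, (ω : Torus → ℂ) (s, y) * fourier (-l) s

/-- `(𝒫_l ω)(x, y) = (2π)⁻¹ ∫ ω(s, y) e^{-ils} ds · e^{ilx}`, as a function. -/
def modeFun (l : ℤ) (ω : L2) (p : Torus) : ℂ :=
  modeCoeff l ω p.2 * fourier l p.1

theorem stronglyMeasurable_modeCoeff (l : ℤ) (ω : L2) : StronglyMeasurable (modeCoeff l ω) := by
  unfold modeCoeff
  refine StronglyMeasurable.const_mul ?_ _
  have h : StronglyMeasurable
      (fun p : Circ × Circ => (ω : Torus → ℂ) p * fourier (-l) p.1) :=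
    (Lp.stronglyMeasurable ω).mul
      ((fourier (-l)).continuous.stronglyMeasurable.comp_measurable measurable_fst)
  exact h.integral_prod_left (μ := (volume : Measure Circ))

theorem memLp_modeCoeff (l : ℤ) (ω : L2) : MemLp (modeCoeff l ω) 2 volume := by
  refine MemLp.const_mul (f := fun y : Circ =>
    ∫ s : Circ, (ω : Torus → ℂ) (s, y) * fourier (-l) s) ?_ _
  have hm : StronglyMeasurable
      (fun p : Circ × Circ => (ω : Torus → ℂ) p * fourier (-l) p.1) :=
    (Lp.stronglyMeasurable ω).mul
      ((fourier (-l)).continuous.stronglyMeasurable.comp_measurable measurable_fst)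
  have hsq : Integrable (fun p : Circ × Circ => ‖(ω : Torus → ℂ) p‖ ^ 2) :=
    (memLp_two_iff_integrable_sq_norm (Lp.aestronglyMeasurable ω)).1 (Lp.memLp ω)
  have hmeas : StronglyMeasurable (fun y : Circ =>
      ∫ s : Circ, (ω : Torus → ℂ) (s, y) * fourier (-l) s) :=
    hm.integral_prod_left (μ := (volume : Measure Circ))
  rw [memLp_two_iff_integrable_sq_norm hmeas.aestronglyMeasurable]
  have hint : Integrable (fun y : Circ => (2 * Real.pi) *
      ∫ s : Circ, ‖(ω : Torus → ℂ) (s, y)‖ ^ 2) := hsq.integral_prod_right.const_mul _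
  refine hint.mono' (hmeas.norm.pow 2).aestronglyMeasurable ?_
  filter_upwards [hsq.prod_left_ae, L2.ae_integrable_slice ω] with y hy hy1
  have hvol : (volume : Measure Circ).real Set.univ = 2 * Real.pi := by
    simp [Measure.real, AddCircle.measure_univ, Real.pi_pos.le]
  have h1 : ‖∫ s : Circ, (ω : Torus → ℂ) (s, y) * fourier (-l) s‖ ≤
      ∫ s : Circ, ‖(ω : Torus → ℂ) (s, y)‖ := by
    refine (norm_integral_le_integral_norm _).trans_eq ?_
    simp only [norm_mul, norm_fourier, mul_one]
  set a : ℝ := ∫ s : Circ, ‖(ω : Torus → ℂ) (s, y)‖ with ha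
  have h2 : 0 ≤ ∫ s : Circ, (2 * Real.pi * ‖(ω : Torus → ℂ) (s, y)‖ - a) ^ 2 :=
    integral_nonneg fun _ => sq_nonneg _
  have h3 : ∫ s : Circ, (2 * Real.pi * ‖(ω : Torus → ℂ) (s, y)‖ - a) ^ 2 =
      (2 * Real.pi) ^ 2 * (∫ s : Circ, ‖(ω : Torus → ℂ) (s, y)‖ ^ 2)
        - 2 * (2 * Real.pi) * a * a + 2 * Real.pi * a ^ 2 := by
    have e : ∀ s : Circ, (2 * Real.pi * ‖(ω : Torus → ℂ) (s, y)‖ - a) ^ 2 =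
        ((2 * Real.pi) ^ 2 * ‖(ω : Torus → ℂ) (s, y)‖ ^ 2
          - 2 * (2 * Real.pi) * a * ‖(ω : Torus → ℂ) (s, y)‖) + a ^ 2 := fun s => by ring
    simp_rw [e]
    have hs : Integrable (fun s : Circ => (2 * Real.pi) ^ 2 * ‖(ω : Torus → ℂ) (s, y)‖ ^ 2
          - 2 * (2 * Real.pi) * a * ‖(ω : Torus → ℂ) (s, y)‖) :=
      (hy.const_mul _).sub (hy1.norm.const_mul _)
    rw [integral_add hs (integrable_const _), integral_sub (hy.const_mul _) (hy1.norm.const_mul _), integral_const_mul,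
      integral_const_mul, integral_const, hvol, smul_eq_mul]
  rw [h3] at h2
  have hpi := Real.two_pi_pos
  have h4 : a ^ 2 ≤ 2 * Real.pi * ∫ s : Circ, ‖(ω : Torus → ℂ) (s, y)‖ ^ 2 := by
    by_contra hcon
    push Not at hcon
    nlinarith [mul_pos hpi (sub_pos.2 hcon)]
  rw [Real.norm_of_nonneg (by positivity)]
  exact (pow_le_pow_left₀ (norm_nonneg _) h1 2).trans h4

theorem memLp_modeFun (l : ℤ) (ω : L2) : MemLp (modeFun l ω) 2 volume := by
  have h1 : MemLp (fun p : Circ × Circ => modeCoeff l ω p.2) 2 volume :=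
    (memLp_modeCoeff l ω).comp_snd (volume : Measure Circ)
  refine h1.of_le_mul (c := 1) ?_ (ae_of_all _ fun p => ?_)
  · exact h1.1.mul ((fourier l).continuous.comp continuous_fst).aestronglyMeasurable
  · simp only [modeFun, norm_mul, norm_fourier, mul_one, one_mul, le_refl]

theorem integral_fourier_of_ne {l : ℤ} (hl : l ≠ 0) : ∫ x : Circ, fourier l x = 0 :=
  integral_eq_zero_of_add_right_eq_neg (μ := (volume : Measure Circ))
      (fourier_add_half_inv_index hl Real.two_pi_pos)

theorem modeFun_toLp_mem (l : ℤ) (ω : L20) :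
    (memLp_modeFun l (ω : L2)).toLp (modeFun l (ω : L2)) ∈ L20 := by
  have h := ae_slice (memLp_modeFun l (ω : L2)).coeFn_toLp
  have hω : ∀ᵐ y : Circ, ∫ x : Circ, ((ω : L2) : Torus → ℂ) (x, y) = 0 := ω.2
  change ∀ᵐ y : Circ, _
  filter_upwards [h, hω] with y hy hωy
  rw [integral_congr_ae hy]
  simp only [modeFun]
  rw [integral_const_mul]
  by_cases hl : l = 0
  · subst hl
    simp [modeCoeff, hωy]
  · rw [integral_fourier_of_ne hl, mul_zero]

/-- The projection `𝒫_l` onto the `l`-th Fourier mode in `x`, acting on `L²₀(𝕋²)`. -/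
def modeProj (l : ℤ) (ω : L20) : L20 :=
  ⟨(memLp_modeFun l (ω : L2)).toLp (modeFun l (ω : L2)), modeFun_toLp_mem l ω⟩

theorem integral_modeFun (l : ℤ) (ω : L2) (x : Circ) :
    ∫ y : Circ, modeFun l ω (x, y) = ((2 * Real.pi : ℝ) : ℂ)⁻¹ *
      (∫ p : Torus, fourier (-l) p.1 * (ω : Torus → ℂ) p) * fourier l x := by
  have hi : Integrable (fun p : Circ × Circ => fourier (-l) p.1 * (ω : Torus → ℂ) p) := by
    refine (L2.integrable ω).bdd_mul (c := 1)
      ((fourier (-l)).continuous.comp continuous_fst).aestronglyMeasurable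
      (ae_of_all _ fun p => ?_)
    rw [norm_fourier]
  simp only [modeFun, modeCoeff]
  rw [integral_mul_const, integral_const_mul]
  congr 2
  refine Eq.trans ?_ (integral_prod_symm _ hi).symm
  simp_rw [mul_comm]

/-- The character `e^{ilx}` in `L²(𝕋²)`. -/
def charFun (l : ℤ) : L2 :=
  ContinuousMap.toLp (E := ℂ) 2 (volume : Measure Torus) ℂ
    ((fourier l : C(Circ, ℂ)).comp ⟨Prod.fst, continuous_fst⟩)

theorem inner_charFun (l : ℤ) (ω : L2) :
    ⟪charFun l, ω⟫_ℂ = ∫ p : Torus, fourier (-l) p.1 * (ω : Torus → ℂ) p := by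
  rw [L2.inner_def]
  refine integral_congr_ae ?_
  filter_upwards [ContinuousMap.coeFn_toLp (E := ℂ) (p := 2) (𝕜 := ℂ) (volume : Measure Torus)
    ((fourier l : C(Circ, ℂ)).comp ⟨Prod.fst, continuous_fst⟩)] with p hp
  rw [charFun, hp]
  simp [mul_comm]

theorem integral_modeFun_eq_zero_iff (l : ℤ) (ω : L2) :
    (∀ x : Circ, ∫ y : Circ, modeFun l ω (x, y) = 0) ↔ ⟪charFun l, ω⟫_ℂ = 0 := by
  simp_rw [integral_modeFun, inner_charFun]
  have hpi : ((2 * Real.pi : ℝ) : ℂ)⁻¹ ≠ 0 :=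
    inv_ne_zero (Complex.ofReal_ne_zero.2 Real.two_pi_pos.ne')
  constructor
  · intro h
    have h0 := h 0
    rw [fourier_eval_zero, mul_one] at h0
    exact (mul_eq_zero.1 h0).resolve_left hpi
  · intro h x
    rw [h, mul_zero, zero_mul]

/-- The space `Y` of all `ω ∈ L²₀(𝕋²)` with `∫ (𝒫_l ω)(x, y) dy = 0` for all `x` when `|l| = 1`. -/
def Y : Submodule ℂ L20 where
  carrier := {ω | ∀ l : ℤ, |l| = 1 → ∀ x : Circ, ∫ y : Circ, modeFun l (ω : L2) (x, y) = 0}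
  zero_mem' := by
    intro l _
    rw [integral_modeFun_eq_zero_iff]
    simp
  add_mem' := by
    intro f g hf hg l hl
    have h1 := (integral_modeFun_eq_zero_iff l f).1 (hf l hl)
    have h2 := (integral_modeFun_eq_zero_iff l g).1 (hg l hl)
    rw [integral_modeFun_eq_zero_iff, Submodule.coe_add, inner_add_right, h1, h2, add_zero]
  smul_mem' := by
    intro a f hf l hl
    have h1 := (integral_modeFun_eq_zero_iff l f).1 (hf l hl)
    rw [integral_modeFun_eq_zero_iff, Submodule.coe_smul, inner_smul_right, h1, mul_zero]

theorem isClosed_L20 : IsClosed (L20 : Set L2) := by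
  have key : (L20 : Set L2) = ⋂ E : {E : Set Circ // MeasurableSet E},
      {ω : L2 | ⟪indicatorConstLp 2 (MeasurableSet.univ.prod E.2)
        (measure_ne_top (volume : Measure Torus) _) (1 : ℂ), ω⟫_ℂ = 0} := by
    ext ω
    simp only [Set.mem_iInter, Set.mem_ofPred_eq, MeasureTheory.L2.inner_indicatorConstLp_one]
    have hset : ∀ E : Set Circ, ∫ p in Set.univ ×ˢ E, (ω : Torus → ℂ) p =
        ∫ y in E, ∫ x : Circ, (ω : Torus → ℂ) (x, y) := by
      intro E
      have hi : Integrable (ω : Torus → ℂ) ((volume : Measure Torus).restrict (Set.univ ×ˢ E)) :=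
        (L2.integrable ω).integrableOn
      have hr : (volume : Measure Torus).restrict (Set.univ ×ˢ E) =
          (volume : Measure Circ).prod ((volume : Measure Circ).restrict E) := by
        rw [Measure.volume_eq_prod, ← Measure.prod_restrict, Measure.restrict_univ]
      rw [hr] at hi ⊢
      exact integral_prod_symm _ hi
    constructor
    · intro h E
      rw [hset]
      have h' : ∀ᵐ y : Circ, ∫ x : Circ, (ω : Torus → ℂ) (x, y) = 0 := h
      rw [integral_congr_ae (ae_restrict_of_ae h')]
      simp
    · intro h
      refine (L2.integrable ω).integral_prod_right.ae_eq_zero_of_forall_setIntegral_eq_zero ?_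
      intro E hE _
      rw [← hset]
      exact h ⟨E, hE⟩
  rw [key]
  exact isClosed_iInter fun E => isClosed_eq (by fun_prop) continuous_const

instance instCompleteSpaceL20 : CompleteSpace L20 :=
  isClosed_L20.completeSpace_coe

theorem isClosed_Y : IsClosed (Y : Set L20) := by
  have h : (Y : Set L20) =
      ⋂ l : ℤ, ⋂ _ : |l| = 1, {ω : L20 | ⟪charFun l, (ω : L2)⟫_ℂ = 0} := by
    ext ω
    simp only [Set.mem_iInter, Set.mem_ofPred_eq]
    exact forall₂_congr fun l _ => integral_modeFun_eq_zero_iff l ω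
  rw [h]
  refine isClosed_iInter fun l => isClosed_iInter fun _ => ?_
  exact isClosed_eq (by fun_prop) continuous_const

instance instCompleteSpaceY : CompleteSpace Y :=
  isClosed_Y.completeSpace_coe

/-- The orthogonal projection `ℚ` of `L²₀(𝕋²)` onto `Y`. -/
def Q : L20 →L[ℂ] L20 := Y.starProjection

end Kolmogorov

end

noncomputable section

open MeasureTheory Filter Topology
open scoped InnerProductSpace

namespace Kolmogorov

section

/-! ### Orbits of a strongly continuous semigroup -/

section Orbits

variable {E : Type*} [NormedAddCommGroup E] [NormedSpace ℂ E] {S : ℝ → E →L[ℂ] E}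
  {G : E → E → Prop}

/-! In Fourier coordinates `Δ` and `I + Δ⁻¹` are diagonal and `sin y` is a combination of shifts in
`j`, so the `x`-modes decouple (`isLAlpha_iff`). The transport term splits into a skew part and a
bounded part, hence `L_α - |α|` is dissipative. A Neumann series solves the resolvent equation for
large real parameters, and Hille–Yosida gives the semigroup (`exists_semigroup`).

On mode `l`, with `β = α l`, let `w` be the vorticity coefficient and `u = (1 - (l² - ∂²)⁻¹) w`. The
kernel of this multiplier is exactly what `ℚ` removes: the mean in `y` when `|l| = 1`. The equation
for `u` closes: `∂ₜ u = -(l² - ∂²) u - iβ (sin y · u - h)` with `h = (l² - ∂²)⁻¹ (sin y · u)`. With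
`ψ = (l² - 1 - ∂²)⁻¹ u`, the energy `E = ⟪u, u + ψ⟫` is invariant under the transport part and
comparable to `‖ℚ w‖²` (`modeFrame_E_bounds`). Its dissipation gives `E ≤ e^{-2l²t} E(0)`, which is
the first estimate.

The enhanced rate is hypocoercive. The functional `Φ` adds to `E` the terms `τ Δ`, `β τ² X` and `β²
τ³ F`, with small coefficients. Here `Δ` is the `H¹` energy, `X` is the mixed term `⟪i cos y · u,
u'⟫`, and `F` is the difference of two transport invariants. Transport extracts from `β X` the new
dissipation `β² Γ`. Two facts make the nonlocal term `h` harmless: `F` and `Γ` are comparable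
(`Γ_le`, `F_le`), and `‖u‖² ≤ 8 √Γ √Δ` (`norm_sq_le`). The functional is nonincreasing while `τ = t`
grows up to `|β|^{-1/2}`. With `τ` frozen there, the interpolation inequality bounds `Φ` by `τ`
times its dissipation, hence decay at a rate proportional to `|β|^{1/2}` (`E_le_of_hypocoercive`).

For `|l| = 1` the mean obeys `w₀' = -w₀ - iβ (sin y · u)₀`; estimating the forcing directly through
the enhanced decay of `u` would cost `|α|^{1/2}`. Subtracting a linear functional of `u` replaces
the zeroth coefficient of `sin y · u` by its pairing with a hat-shaped multiplier of width `N`. In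
physical space this is a kernel concentrated at `y = 0`, where `sin y` vanishes, so a factor `1 / N`
is gained at the price of diffusion terms of size `N²`. Balancing at `N³ ≈ |β|` leaves `|α|^{1/3}`
(`corrected_mean_equation`, `norm_mean_le`). All orbit estimates are made for data in the domain and
extended by density (`forall_of_domain`). -/

theorem IsSemigroupGeneratedBy.tendsto_nhdsGE (hS : IsSemigroupGeneratedBy S G) (f : E) :
    Tendsto (fun t : ℝ => S t f) (𝓝[≥] 0) (𝓝 f) := by
  rw [← Set.Ioi_insert, nhdsWithin_insert]
  refine Tendsto.sup ?_ (hS.tendsto_zero f)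
  rw [tendsto_pure_left]
  intro s hs
  rw [hS.zero]
  exact mem_of_mem_nhds hs

/-- Otherwise there are times `t n → 0` with `‖S (t n)‖ > n`. Each orbit converges along these
times, hence is bounded there, and Banach–Steinhaus gives a contradiction. -/
theorem IsSemigroupGeneratedBy.exists_bound_near_zero [CompleteSpace E]
    (hS : IsSemigroupGeneratedBy S G) :
    ∃ δ > (0 : ℝ), ∃ M : ℝ, ∀ t, 0 ≤ t → t ≤ δ → ‖S t‖ ≤ M := by
  by_contra! hcon
  have h : ∀ n : ℕ, ∃ t : ℝ, 0 ≤ t ∧ t ≤ 1 / ((n : ℝ) + 1) ∧ (n : ℝ) < ‖S t‖ := fun n =>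
    hcon _ Nat.one_div_pos_of_nat n
  choose t ht0 ht1 ht2 using h
  have ht : Tendsto t atTop (𝓝[≥] 0) := by
    refine tendsto_nhdsWithin_iff.2 ⟨?_, Eventually.of_forall ht0⟩
    exact squeeze_zero ht0 ht1 tendsto_one_div_add_atTop_nhds_zero_nat
  have hb : ∀ f : E, ∃ C, ∀ n, ‖S (t n) f‖ ≤ C := by
    intro f
    obtain ⟨C, hC⟩ := ((hS.tendsto_nhdsGE f).comp ht).norm.bddAbove_range
    exact ⟨C, fun n => hC ⟨n, rfl⟩⟩
  obtain ⟨C, hC⟩ := banach_steinhaus hb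
  obtain ⟨n, hn⟩ := exists_nat_gt C
  exact absurd (hC n) (not_le.2 (hn.trans (ht2 n)))

theorem IsSemigroupGeneratedBy.exists_bound [CompleteSpace E]
    (hS : IsSemigroupGeneratedBy S G) (T : ℝ) :
    ∃ M : ℝ, ∀ t, 0 ≤ t → t ≤ T → ‖S t‖ ≤ M := by
  obtain ⟨δ, hδ, M, hM⟩ := hS.exists_bound_near_zero
  have key : ∀ n : ℕ, ∃ M' : ℝ, ∀ t, 0 ≤ t → t ≤ n * δ → ‖S t‖ ≤ M' := by
    intro n
    induction n with
    | zero => exact ⟨M, fun t h0 h1 => hM t h0 (by simp at h1; linarith)⟩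
    | succ n ih =>
      obtain ⟨M', hM'⟩ := ih
      refine ⟨max M (M * M'), fun t h0 h1 => ?_⟩
      rcases le_total t δ with h | h
      · exact (hM t h0 h).trans (le_max_left _ _)
      · have h2 : t - δ ≤ n * δ := by push_cast at h1; linarith
        have e : t = δ + (t - δ) := by ring
        rw [e, hS.add _ _ hδ.le (by linarith)]
        refine (ContinuousLinearMap.opNorm_comp_le _ _).trans (le_trans ?_ (le_max_right _ _))
        have h3 := hM δ hδ.le le_rfl
        exact mul_le_mul h3 (hM' _ (by linarith) h2) (norm_nonneg _) ((norm_nonneg _).trans h3)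
  obtain ⟨n, hn⟩ := exists_nat_ge (T / δ)
  obtain ⟨M', hM'⟩ := key n
  exact ⟨M', fun t h0 h1 => hM' t h0 (h1.trans ((div_le_iff₀ hδ).1 hn))⟩

/-- Factoring out the semigroup at the smaller of two times reduces continuity to continuity at
zero. Approaching `t` from the left requires the bound to be uniform on `[0, t]`. -/
theorem IsSemigroupGeneratedBy.continuousOn [CompleteSpace E]
    (hS : IsSemigroupGeneratedBy S G) (f : E) : ContinuousOn (fun t => S t f) (Set.Ici 0) := by
  intro t ht
  have ht0 : 0 ≤ t := ht
  obtain ⟨M, hM⟩ := hS.exists_bound t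
  have key : ∀ s, 0 ≤ s → ‖S s f - S t f‖ ≤ M * ‖S |s - t| f - f‖ := by
    intro s hs
    rcases le_total s t with h | h
    · have e : S t f = S s (S |s - t| f) := by
        rw [← ContinuousLinearMap.comp_apply, ← hS.add _ _ hs (abs_nonneg _),
          abs_of_nonpos (by linarith)]
        congr 2; ring
      rw [e, ← map_sub, norm_sub_rev (S |s - t| f)]
      exact (S s).le_of_opNorm_le (hM s hs h) _
    · have e : S s f = S t (S |s - t| f) := by
        rw [← ContinuousLinearMap.comp_apply, ← hS.add _ _ ht0 (abs_nonneg _),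
          abs_of_nonneg (by linarith)]
        congr 2; ring
      rw [e, ← map_sub]
      exact (S t).le_of_opNorm_le (hM t ht0 le_rfl) _
  have hlim2 : Tendsto (fun s : ℝ => |s - t|) (𝓝[Set.Ici 0] t) (𝓝[≥] 0) := by
    refine tendsto_nhdsWithin_iff.2 ⟨?_, Eventually.of_forall fun s => Set.mem_Ici.2 (abs_nonneg _)⟩
    have : Tendsto (fun s : ℝ => |s - t|) (𝓝 t) (𝓝 |t - t|) :=
      ((continuous_id.sub continuous_const).abs).tendsto t
    rw [sub_self, abs_zero] at this
    exact this.mono_left nhdsWithin_le_nhds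
  have h0 : Tendsto (fun s : ℝ => M * ‖S |s - t| f - f‖) (𝓝[Set.Ici 0] t) (𝓝 0) := by
    have := (((hS.tendsto_nhdsGE f).comp hlim2).sub_const f).norm.const_mul M
    simpa using this
  refine tendsto_iff_norm_sub_tendsto_zero.2 ?_
  refine squeeze_zero' (Eventually.of_forall fun _ => norm_nonneg _) ?_ h0
  filter_upwards [self_mem_nhdsWithin] with s hs using key s hs

theorem IsSemigroupGeneratedBy.generator_orbit (hS : IsSemigroupGeneratedBy S G) {f g : E}
    (hfg : G f g) {t : ℝ} (ht : 0 ≤ t) : G (S t f) (S t g) := by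
  rw [hS.generator]
  have h := ((S t).continuous.tendsto _).comp ((hS.generator f g).1 hfg)
  refine h.congr' ?_
  filter_upwards [self_mem_nhdsWithin] with h hh
  have hh' : 0 ≤ h := le_of_lt hh
  simp only [Function.comp_apply, map_smul, map_sub]
  rw [← ContinuousLinearMap.comp_apply (S h), ← hS.add _ _ hh' ht,
    ← ContinuousLinearMap.comp_apply (S t), ← hS.add _ _ ht hh', add_comm]

/-- The generator directly supplies right derivatives; the comparison lemmas used below ask for
nothing more. -/
theorem IsSemigroupGeneratedBy.hasDerivWithinAt (hS : IsSemigroupGeneratedBy S G) {f g : E}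
    (hfg : G f g) {t : ℝ} (ht : 0 ≤ t) :
    HasDerivWithinAt (fun s => S s f) (S t g) (Set.Ici t) t := by
  rw [← hasDerivWithinAt_Ioi_iff_Ici, hasDerivWithinAt_iff_tendsto_slope' (by simp)]
  have h := (hS.generator _ _).1 (hS.generator_orbit hfg ht)
  have hlim : Tendsto (fun s : ℝ => s - t) (𝓝[>] t) (𝓝[>] 0) := by
    refine tendsto_nhdsWithin_iff.2 ⟨?_, ?_⟩
    · have : Tendsto (fun s : ℝ => s - t) (𝓝 t) (𝓝 (t - t)) :=
        (continuous_id.sub continuous_const).tendsto t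
      rw [sub_self] at this
      exact this.mono_left nhdsWithin_le_nhds
    · filter_upwards [self_mem_nhdsWithin] with s hs using sub_pos.2 (Set.mem_Ioi.1 hs)
  refine (h.comp hlim).congr' ?_
  filter_upwards [self_mem_nhdsWithin] with s hs
  have hs' : 0 ≤ s - t := (sub_pos.2 (Set.mem_Ioi.1 hs)).le
  simp only [Function.comp_apply, slope, vsub_eq_sub]
  rw [← ContinuousLinearMap.comp_apply (S (s - t)), ← hS.add _ _ hs' ht, sub_add_cancel]
  exact Complex.coe_smul _ _

end Orbits

/-! ### The Hille–Yosida theorem for contraction semigroups -/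

section HilleYosida

open NormedSpace

variable {E : Type*} [NormedAddCommGroup E] [NormedSpace ℂ E]

theorem tendsto_of_tendsto_on_dense {ι : Type*} {l : Filter ι} {T : ι → E →L[ℂ] E}
    (hT : ∀ i f, ‖T i f‖ ≤ ‖f‖) {D : Set E} (hD : Dense D)
    (h : ∀ f ∈ D, Tendsto (fun i => T i f) l (𝓝 f)) (f : E) :
    Tendsto (fun i => T i f) l (𝓝 f) := by
  rw [Metric.tendsto_nhds]
  intro ε hε
  obtain ⟨g, hg, hfg⟩ := Metric.dense_iff.1 hD f (ε / 3) (by linarith)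
  have hg' : ‖f - g‖ < ε / 3 := by rw [← dist_eq_norm, dist_comm]; exact hg
  filter_upwards [Metric.tendsto_nhds.1 (h g hfg) (ε / 3) (by linarith)] with i hi
  rw [dist_eq_norm] at hi ⊢
  have e : T i f - f = T i (f - g) + (T i g - g) - (f - g) := by rw [map_sub]; abel
  rw [e]
  have h1 := norm_sub_le (T i (f - g) + (T i g - g)) (f - g)
  have h2 := norm_add_le (T i (f - g)) (T i g - g)
  have h3 := hT i (f - g)
  linarith

theorem cauchySeq_of_cauchySeq_on_dense {T : ℕ → E →L[ℂ] E}
    (hT : ∀ i f, ‖T i f‖ ≤ ‖f‖) {D : Set E} (hD : Dense D)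
    (h : ∀ f ∈ D, CauchySeq (fun i => T i f)) (f : E) : CauchySeq (fun i => T i f) := by
  rw [Metric.cauchySeq_iff]
  intro ε hε
  obtain ⟨g, hg, hfg⟩ := Metric.dense_iff.1 hD f (ε / 3) (by linarith)
  have hg' : ‖f - g‖ < ε / 3 := by rw [← dist_eq_norm, dist_comm]; exact hg
  obtain ⟨N, hN⟩ := Metric.cauchySeq_iff.1 (h g hfg) (ε / 3) (by linarith)
  refine ⟨N, fun m hm n hn => ?_⟩
  have hi := hN m hm n hn
  rw [dist_eq_norm] at hi ⊢
  have e : T m f - T n f = T m (f - g) + (T m g - T n g) - T n (f - g) := by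
    rw [map_sub, map_sub]; abel
  rw [e]
  have h1 := norm_sub_le (T m (f - g) + (T m g - T n g)) (T n (f - g))
  have h2 := norm_add_le (T m (f - g)) (T m g - T n g)
  have h3 := hT m (f - g)
  have h4 := hT n (f - g)
  linarith

/-- Rescaling a semigroup by `e^{μt}` adds `μ` to its generator. -/
theorem IsSemigroupGeneratedBy.exp_smul {G G' : E → E → Prop} {S : ℝ → E →L[ℂ] E}
    (hS : IsSemigroupGeneratedBy S G) (μ : ℝ) (hG : ∀ f g, G' f g ↔ G f (g - (μ : ℂ) • f)) :
    IsSemigroupGeneratedBy (fun t => Real.exp (μ * t) • S t) G' := by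
  have hexp : Tendsto (fun t : ℝ => Real.exp (μ * t)) (𝓝[>] 0) (𝓝 1) := by
    have : Tendsto (fun t : ℝ => Real.exp (μ * t)) (𝓝 0) (𝓝 (Real.exp (μ * 0))) :=
      (by fun_prop : Continuous fun t : ℝ => Real.exp (μ * t)).tendsto 0
    rw [mul_zero, Real.exp_zero] at this
    exact this.mono_left nhdsWithin_le_nhds
  have hder : Tendsto (fun t : ℝ => t⁻¹ * (Real.exp (μ * t) - 1)) (𝓝[>] 0) (𝓝 μ) := by
    have h1 : HasDerivAt (fun t : ℝ => Real.exp (μ * t)) μ 0 := by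
      simpa using ((hasDerivAt_id (0 : ℝ)).const_mul μ).exp
    have h2 := (hasDerivAt_iff_tendsto_slope.1 h1).mono_left
      (nhdsWithin_mono 0 fun t (ht : t ∈ Set.Ioi (0 : ℝ)) => (Set.mem_Ioi.1 ht).ne')
    refine h2.congr fun t => ?_
    simp [slope]
  refine ⟨by simp [hS.zero], ?_, ?_, ?_⟩
  · intro s t hs ht
    ext f
    simp [hS.add s t hs ht, mul_add, Real.exp_add, smul_smul, mul_comm]
  · intro f
    simpa using hexp.smul (hS.tendsto_zero f)
  · intro f g
    rw [hG, hS.generator, Complex.coe_smul]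
    have hf : Tendsto (fun t : ℝ => (t⁻¹ * (Real.exp (μ * t) - 1)) • f) (𝓝[>] 0) (𝓝 (μ • f)) :=
      hder.smul_const f
    have key : ∀ t : ℝ, ((t⁻¹ : ℝ) : ℂ) • ((Real.exp (μ * t) • S t) f - f)
        = Real.exp (μ * t) • (((t⁻¹ : ℝ) : ℂ) • (S t f - f))
          + (t⁻¹ * (Real.exp (μ * t) - 1)) • f := by
      intro t
      have e : (Real.exp (μ * t) • S t) f = Real.exp (μ * t) • S t f := rfl
      rw [e, Complex.coe_smul, Complex.coe_smul]
      module
    constructor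
    · intro h
      have := (hexp.smul h).add hf
      simp only [one_smul, sub_add_cancel] at this
      exact this.congr fun t => (key t).symm
    · intro h
      have hinv : Tendsto (fun t : ℝ => (Real.exp (μ * t))⁻¹) (𝓝[>] 0) (𝓝 1) := by
        simpa using hexp.inv₀ one_ne_zero
      have := hinv.smul (h.sub hf)
      rw [one_smul] at this
      refine this.congr fun t => ?_
      rw [key t, add_sub_cancel_right, smul_smul, inv_mul_cancel₀ (Real.exp_pos _).ne', one_smul]

variable [CompleteSpace E]

theorem exp_add_smul (A : E →L[ℂ] E) (s t : ℝ) :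
    exp ((s + t) • A) = exp (s • A) * exp (t • A) := by
  let _ : NormedAlgebra ℚ (E →L[ℂ] E) := NormedAlgebra.restrictScalars ℚ ℝ (E →L[ℂ] E)
  rw [add_smul]
  exact exp_add_of_commute (((Commute.refl A).smul_left s).smul_right t)

theorem hasDerivAt_exp_smul_apply (A : E →L[ℂ] E) (f : E) (t : ℝ) :
    HasDerivAt (fun t : ℝ => exp (t • A) f) (exp (t • A) (A f)) t := by
  have h := (hasDerivAt_exp_smul_const (𝕂 := ℝ) A t)
  exact ((ContinuousLinearMap.apply ℂ E f).restrictScalars ℝ).hasFDerivAt.comp_hasDerivAt t h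

/-- Exponentials of commuting bounded generators of contractions stay close. -/
theorem norm_exp_smul_sub_le {A B : E →L[ℂ] E} (hAB : Commute A B)
    (hA : ∀ (t : ℝ) (f : E), 0 ≤ t → ‖exp (t • A) f‖ ≤ ‖f‖)
    (hB : ∀ (t : ℝ) (f : E), 0 ≤ t → ‖exp (t • B) f‖ ≤ ‖f‖) {t : ℝ} (ht : 0 ≤ t) (f : E) :
    ‖exp (t • A) f - exp (t • B) f‖ ≤ ‖A f - B f‖ * t := by
  -- The path `e^{sA} e^{(t-s)B} f` joins the two vectors, and commutativity collapses its
  -- derivative to contractions applied to `A f - B f`.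
  have hd : ∀ s : ℝ, HasDerivAt (fun s : ℝ => (exp (s • A) * exp ((t - s) • B)) f)
      (exp (s • A) (exp ((t - s) • B) (A f - B f))) s := by
    intro s
    have h1 := (hasDerivAt_exp_smul_const (𝕂 := ℝ) A s)
    have h2 := (hasDerivAt_exp_smul_const' (𝕂 := ℝ) B (t - s)).scomp s
      ((hasDerivAt_id s).const_sub t)
    have h3 := ((ContinuousLinearMap.apply ℂ E f).restrictScalars ℝ).hasFDerivAt.comp_hasDerivAt s
      (h1.mul h2)
    refine h3.congr_deriv ?_
    have hc : A * exp ((t - s) • B) = exp ((t - s) • B) * A :=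
      ((hAB.smul_right (t - s)).exp_right).eq
    have hc' : B * exp ((t - s) • B) = exp ((t - s) • B) * B :=
      (((Commute.refl B).smul_right (t - s)).exp_right).eq
    have e : exp (s • A) * A * exp ((t - s) • B) + exp (s • A) * ((-1 : ℝ) • (B * exp ((t - s) • B)))
        = exp (s • A) * (exp ((t - s) • B) * (A - B)) := by
      rw [mul_assoc, hc, hc', neg_one_smul, mul_sub, mul_sub, mul_neg, ← sub_eq_add_neg]
    exact congrArg (fun T : E →L[ℂ] E => T f) e
  have h := norm_image_sub_le_of_norm_deriv_le_segment' (a := 0) (b := t)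
    (C := ‖A f - B f‖) (fun s _ => (hd s).hasDerivWithinAt)
    (fun s hs => (hA s _ hs.1).trans (hB _ _ (by linarith [hs.2]))) t ⟨ht, le_rfl⟩
  simpa using h

/-- The factor `e^{rs}` cancels the term `-r • 1`. What remains satisfies an equation with generator
`r² R`, whose norm is at most `r`, so Grönwall gives growth at most `e^{rt}`, which is divided out
again. -/
theorem norm_exp_yosida_le {R : E →L[ℂ] E} {r : ℝ} (hr : 0 ≤ r) (hR : r * ‖R‖ ≤ 1) (f : E)
    {t : ℝ} (ht : 0 ≤ t) :
    ‖exp (t • ((r ^ 2) • R - r • (1 : E →L[ℂ] E))) f‖ ≤ ‖f‖ := by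
  set A := (r ^ 2) • R - r • (1 : E →L[ℂ] E) with hAdef
  have hd : ∀ s : ℝ, HasDerivAt (fun s : ℝ => Real.exp (r * s) • exp (s • A) f)
      ((r ^ 2) • R (Real.exp (r * s) • exp (s • A) f)) s := by
    intro s
    have h1 : HasDerivAt (fun s : ℝ => Real.exp (r * s)) (Real.exp (r * s) * r) s := by
      simpa using ((hasDerivAt_id s).const_mul r).exp
    have h2 := h1.smul (hasDerivAt_exp_smul_apply A f s)
    refine h2.congr_deriv ?_
    have hc : exp (s • A) (A f) = A (exp (s • A) f) :=
      congrArg (fun T : E →L[ℂ] E => T f) (((Commute.refl A).smul_left s).exp_left).eq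
    have hA : ∀ x, A x = (r ^ 2) • R x - r • x := fun x => rfl
    rw [hc, hA, R.map_smul_of_tower, smul_sub, smul_smul, smul_smul, smul_smul,
      mul_comm (Real.exp _) (r ^ 2)]
    abel
  have h := norm_le_gronwallBound_of_norm_deriv_right_le (a := 0) (b := t) (δ := ‖f‖) (K := r)
    (ε := 0) (f := fun s : ℝ => Real.exp (r * s) • exp (s • A) f)
    (fun s _ => (hd s).continuousAt.continuousWithinAt) (fun s _ => (hd s).hasDerivWithinAt)
    (by simp) (fun s _ => by
      rw [norm_smul, add_zero, Real.norm_of_nonneg (by positivity)]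
      refine (mul_le_mul_of_nonneg_left (R.le_opNorm _) (by positivity)).trans ?_
      rw [← mul_assoc]
      refine mul_le_mul_of_nonneg_right ?_ (norm_nonneg _)
      nlinarith) t ⟨ht, le_rfl⟩
  rw [gronwallBound_ε0, norm_smul, Real.norm_of_nonneg (Real.exp_pos _).le, sub_zero,
    mul_comm] at h
  exact le_of_mul_le_mul_right h (Real.exp_pos _)

/-- An operator (given by its graph) whose resolvents at the positive integers are bounded by
`1 / n`, and which is densely defined, generates a contraction semigroup. -/
theorem exists_semigroup_of_resolvent {G : E → E → Prop} {R : ℕ → E →L[ℂ] E}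
    (hn : ∀ n : ℕ, ((n : ℝ) + 1) * ‖R n‖ ≤ 1)
    (hR' : ∀ (n : ℕ) f, G (R n f) ((((n : ℝ) + 1 : ℝ) : ℂ) • R n f - f))
    (hI' : ∀ (n : ℕ) f g, G f g → R n ((((n : ℝ) + 1 : ℝ) : ℂ) • f - g) = f)
    (hD : Dense {f | ∃ g, G f g}) : ∃ S : ℝ → E →L[ℂ] E, IsSemigroupGeneratedBy S G := by
  have hR : ∀ (n : ℕ) f, G (R n f) (((n : ℝ) + 1) • R n f - f) := fun n f => by
    rw [← Complex.coe_smul]; exact hR' n f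
  have hI : ∀ (n : ℕ) f g, G f g → R n (((n : ℝ) + 1) • f - g) = f := fun n f g h => by
    rw [← Complex.coe_smul]; exact hI' n f g h
  have hpos : ∀ n : ℕ, (0 : ℝ) < (n : ℝ) + 1 := fun n => by positivity
  -- The resolvent identity, obtained by applying the left-inverse property of `R n` to `R m f`. It
  -- forces the resolvents, and hence the Yosida approximations `A n`, to commute.
  have hres : ∀ (n m : ℕ) f, ((n : ℝ) - m) • R n (R m f) = R m f - R n f := by
    intro n m f
    have h := hI n _ _ (hR m f)
    have e : ((n : ℝ) + 1) • R m f - (((m : ℝ) + 1) • R m f - f) = ((n : ℝ) - m) • R m f + f := by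
      rw [← sub_add, ← sub_smul]; congr 2; ring
    rw [e, map_add, (R n).map_smul_of_tower] at h
    rw [eq_sub_iff_add_eq]; exact h
  have hcomm : ∀ n m, Commute (R n) (R m) := by
    intro n m
    rcases eq_or_ne n m with rfl | hnm
    · exact Commute.refl _
    · ext f
      have h1 := hres n m f
      have h2 := hres m n f
      have hne : (n : ℝ) - m ≠ 0 := sub_ne_zero.2 (by exact_mod_cast hnm)
      have h3 : ((n : ℝ) - m) • R n (R m f) = ((n : ℝ) - m) • R m (R n f) := by
        rw [h1, ← neg_sub (m : ℝ), neg_smul, h2, neg_sub]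
      exact smul_right_injective E hne h3
  set A : ℕ → E →L[ℂ] E := fun n => (((n : ℝ) + 1) ^ 2) • R n - ((n : ℝ) + 1) • (1 : E →L[ℂ] E)
    with hAdef
  have hAcomm : ∀ n m, Commute (A n) (A m) := by
    intro n m
    refine Commute.sub_left ?_ ((Commute.one_left _).smul_left _)
    exact (Commute.sub_right ((hcomm n m).smul_right _)
      ((Commute.one_right _).smul_right _)).smul_left _
  have hAapp : ∀ n f, A n f = (((n : ℝ) + 1) ^ 2) • R n f - ((n : ℝ) + 1) • f := fun n f => rfl
  have hexp : ∀ n (t : ℝ) (f : E), 0 ≤ t → ‖exp (t • A n) f‖ ≤ ‖f‖ := fun n t f ht =>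
    norm_exp_yosida_le (hpos n).le (hn n) f ht
  have hAf : ∀ n f g, G f g → A n f = ((n : ℝ) + 1) • R n g := by
    intro n f g hfg
    have h := hI n f g hfg
    rw [map_sub, (R n).map_smul_of_tower] at h
    have h' : R n g = ((n : ℝ) + 1) • R n f - f := by
      rw [eq_sub_iff_add_eq, add_comm (R n g)]; exact (sub_eq_iff_eq_add.1 h).symm
    rw [hAapp, h', smul_sub, smul_smul, sq]
  have hRn : ∀ (n : ℕ) f, ‖((n : ℝ) + 1) • R n f‖ ≤ ‖f‖ := by
    intro n f
    rw [norm_smul, Real.norm_of_nonneg (hpos n).le]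
    refine (mul_le_mul_of_nonneg_left ((R n).le_opNorm f) (hpos n).le).trans ?_
    rw [← mul_assoc]
    exact mul_le_of_le_one_left (norm_nonneg _) (hn n)
  have hlim : ∀ g, Tendsto (fun n : ℕ => ((n : ℝ) + 1) • R n g) atTop (𝓝 g) := by
    refine tendsto_of_tendsto_on_dense (T := fun n : ℕ => ((n : ℝ) + 1) • R n) hRn hD ?_
    rintro f ⟨k, hk⟩
    rw [tendsto_iff_norm_sub_tendsto_zero]
    have h0 : Tendsto (fun n : ℕ => ‖k‖ * (1 / ((n : ℝ) + 1))) atTop (𝓝 0) := by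
      simpa using tendsto_one_div_add_atTop_nhds_zero_nat.const_mul ‖k‖
    refine squeeze_zero (fun _ => norm_nonneg _) (fun n => ?_) h0
    have h := hI n f k hk
    rw [map_sub, (R n).map_smul_of_tower] at h
    have e : ((n : ℝ) + 1) • R n f - f = R n k := by
      rw [sub_eq_iff_eq_add, add_comm (R n k)]; exact sub_eq_iff_eq_add.1 h
    change ‖((n : ℝ) + 1) • R n f - f‖ ≤ _
    rw [e, mul_one_div, le_div_iff₀ (hpos n), mul_comm]
    have := hRn n k
    rwa [norm_smul, Real.norm_of_nonneg (hpos n).le] at this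
  have hcauchy : ∀ t : ℝ, 0 ≤ t → ∀ f, CauchySeq (fun n => exp (t • A n) f) := by
    intro t ht
    refine cauchySeq_of_cauchySeq_on_dense (fun n f => hexp n t f ht) hD ?_
    rintro f ⟨g, hfg⟩
    have hc : CauchySeq (fun n => A n f) := by
      have := (hlim g).cauchySeq
      simpa only [hAf _ f g hfg] using this
    rw [Metric.cauchySeq_iff] at hc ⊢
    intro ε hε
    obtain ⟨N, hN⟩ := hc (ε / (t + 1)) (by positivity)
    refine ⟨N, fun m hm n hn' => ?_⟩
    have h1 := hN m hm n hn'
    rw [dist_eq_norm] at h1 ⊢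
    refine (norm_exp_smul_sub_le (hAcomm m n) (hexp m) (hexp n) ht f).trans_lt ?_
    rw [lt_div_iff₀ (by positivity)] at h1
    nlinarith [norm_nonneg (A m f - A n f)]
  choose! lim hlimS using fun t (ht : (0 : ℝ) ≤ t) =>
    (fun f => cauchySeq_tendsto_of_complete (hcauchy t ht f))
  set S : ℝ → E →L[ℂ] E := fun t => if h : 0 ≤ t then
    continuousLinearMapOfTendsto (fun n => exp (t • A n)) (f := lim t)
      (tendsto_pi_nhds.2 (hlimS t h)) else 0 with hSdef
  have hS : ∀ t, 0 ≤ t → ∀ f, Tendsto (fun n => exp (t • A n) f) atTop (𝓝 (S t f)) := by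
    intro t ht f
    have e : S t f = lim t f := by
      simp only [hSdef, dif_pos ht]
      rfl
    rw [e]
    exact hlimS t ht f
  have hSc : ∀ t, 0 ≤ t → ∀ f, ‖S t f‖ ≤ ‖f‖ := fun t ht f =>
    le_of_tendsto (hS t ht f).norm (Eventually.of_forall fun n => hexp n t f ht)
  have hone : ∀ n t f, 0 ≤ t → ‖exp (t • A n) f - f‖ ≤ ‖A n f‖ * t := by
    intro n t f ht
    have h := norm_exp_smul_sub_le (A := A n) (B := 0) (Commute.zero_right _) (hexp n)
      (fun s f _ => by simp) ht f
    simpa using h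
  -- Equicontinuity at time zero, uniformly in `n`. It is used both for strong continuity of the
  -- limit and for its derivative on the domain.
  have hunif : ∀ g, ∀ ε > (0 : ℝ), ∃ δ > (0 : ℝ), ∀ t, 0 ≤ t → t ≤ δ → ∀ n,
      ‖exp (t • A n) g - g‖ ≤ ε := by
    intro g ε hε
    obtain ⟨k, hk, hgk⟩ := Metric.dense_iff.1 hD g (ε / 3) (by linarith)
    obtain ⟨k', hk'⟩ := hgk
    have hg' : ‖g - k‖ < ε / 3 := by rw [← dist_eq_norm, dist_comm]; exact hk
    refine ⟨ε / 3 / (‖k'‖ + 1), by positivity, fun t ht0 ht n => ?_⟩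
    have e : exp (t • A n) g - g = exp (t • A n) (g - k) + (exp (t • A n) k - k) - (g - k) := by
      rw [map_sub]; abel
    rw [e]
    have h1 := norm_sub_le (exp (t • A n) (g - k) + (exp (t • A n) k - k)) (g - k)
    have h2 := norm_add_le (exp (t • A n) (g - k)) (exp (t • A n) k - k)
    have h3 := hexp n t (g - k) ht0
    have h4 := hone n t k ht0
    have h5 : ‖A n k‖ ≤ ‖k'‖ := by rw [hAf n k k' hk']; exact hRn n k'
    rw [le_div_iff₀ (by positivity)] at ht
    have h6 : ‖A n k‖ * t ≤ ‖k'‖ * t := mul_le_mul_of_nonneg_right h5 ht0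
    nlinarith
  have hgen : ∀ f g, G f g →
      Tendsto (fun t : ℝ => ((t⁻¹ : ℝ) : ℂ) • (S t f - f)) (𝓝[>] 0) (𝓝 g) := by
    intro f g hfg
    rw [Metric.tendsto_nhds]
    intro ε hε
    obtain ⟨δ, hδ, hδ'⟩ := hunif g (ε / 2) (by linarith)
    filter_upwards [Ioc_mem_nhdsGT hδ] with t ht
    have ht0 : 0 ≤ t := ht.1.le
    have hb : ∀ n, ‖exp (t • A n) f - f - t • g‖ ≤ (‖A n f - g‖ + ε / 2) * t := by
      intro n
      have hd : ∀ s : ℝ, HasDerivAt (fun s : ℝ => exp (s • A n) f - s • g)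
          (exp (s • A n) (A n f) - g) s := by
        intro s
        have h1 := (hasDerivAt_exp_smul_apply (A n) f s).sub
          ((hasDerivAt_id s).smul_const g)
        rw [one_smul] at h1
        exact h1
      have h := norm_image_sub_le_of_norm_deriv_le_segment' (a := 0) (b := t)
        (C := ‖A n f - g‖ + ε / 2) (fun s _ => (hd s).hasDerivWithinAt)
        (fun s hs => by
          have e : exp (s • A n) (A n f) - g = exp (s • A n) (A n f - g)
              + (exp (s • A n) g - g) := by rw [map_sub]; abel
          rw [e]
          exact (norm_add_le _ _).trans (add_le_add (hexp n s _ hs.1)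
            (hδ' s hs.1 (hs.2.le.trans ht.2) n))) t ⟨ht0, le_rfl⟩
      have e : exp (t • A n) f - t • g - (exp ((0 : ℝ) • A n) f - (0 : ℝ) • g)
          = exp (t • A n) f - f - t • g := by simp; abel
      rwa [e, sub_zero] at h
    have hAlim : Tendsto (fun n => A n f) atTop (𝓝 g) := by
      simpa only [hAf _ f g hfg] using hlim g
    have hl : ‖S t f - f - t • g‖ ≤ (0 + ε / 2) * t := by
      refine le_of_tendsto_of_tendsto' (((hS t ht0 f).sub_const f).sub_const (t • g)).norm
        (((tendsto_iff_norm_sub_tendsto_zero.1 hAlim).add_const (ε / 2)).mul_const t) hb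
    rw [dist_eq_norm]
    have e : ((t⁻¹ : ℝ) : ℂ) • (S t f - f) - g = t⁻¹ • (S t f - f - t • g) := by
      rw [smul_sub (t⁻¹) _ (t • g), smul_smul, inv_mul_cancel₀ ht.1.ne', one_smul]
      rw [Complex.coe_smul]
    rw [e, norm_smul, norm_inv, Real.norm_of_nonneg ht0, inv_mul_lt_iff₀ ht.1]
    nlinarith [ht.1]
  refine ⟨S, ?_, ?_, ?_, ?_⟩
  · ext f
    refine tendsto_nhds_unique (hS 0 le_rfl f) ?_
    simp
  · intro s t hs ht
    ext f
    refine tendsto_nhds_unique (hS (s + t) (add_nonneg hs ht) f) ?_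
    rw [tendsto_iff_norm_sub_tendsto_zero]
    have h1 := tendsto_iff_norm_sub_tendsto_zero.1 (hS t ht f)
    have h2 := tendsto_iff_norm_sub_tendsto_zero.1 (hS s hs (S t f))
    refine squeeze_zero (fun _ => norm_nonneg _) (fun n => ?_)
      (by simpa using h1.add h2)
    have e : exp ((s + t) • A n) f - S s (S t f) = exp (s • A n) (exp (t • A n) f - S t f)
        + (exp (s • A n) (S t f) - S s (S t f)) := by
      rw [exp_add_smul, map_sub]
      simp
    rw [ContinuousLinearMap.comp_apply, e]
    exact (norm_add_le _ _).trans (add_le_add (hexp n s _ hs) le_rfl)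
  · intro f
    rw [Metric.tendsto_nhds]
    intro ε hε
    obtain ⟨δ, hδ, hδ'⟩ := hunif f (ε / 2) (by linarith)
    filter_upwards [Ioc_mem_nhdsGT hδ] with t ht
    rw [dist_eq_norm]
    have : ‖S t f - f‖ ≤ ε / 2 := le_of_tendsto ((hS t ht.1.le f).sub_const f).norm
      (Eventually.of_forall fun n => hδ' t ht.1.le ht.2 n)
    linarith
  · intro f g
    refine ⟨hgen f g, fun hfg => ?_⟩
    -- Maximality: the generator of `S` already extends `G`. Solving the resolvent equation at `1`
    -- inside `G` produces `u`, and the difference `x = f - u` is an eigenvector of the generator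
    -- with eigenvalue `1`.
    set u := R 0 (f - g) with hu
    have hGu : G u (u - (f - g)) := by
      have := hR 0 (f - g)
      rwa [Nat.cast_zero, zero_add, one_smul, ← hu] at this
    have hx : Tendsto (fun t : ℝ => ((t⁻¹ : ℝ) : ℂ) • (S t (f - u) - (f - u))) (𝓝[>] 0)
        (𝓝 (f - u)) := by
      have h := hfg.sub (hgen _ _ hGu)
      have e : g - (u - (f - g)) = f - u := by abel
      rw [e] at h
      refine h.congr fun t => ?_
      rw [← smul_sub, map_sub]
      congr 1; abel
    have hx0 : f - u = 0 := by
      -- Along such an eigenvector `S t x = (1 + t) x + o(t)`, which a contraction allows only for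
      -- `x = 0`.
      have hle : ‖f - u‖ ≤ 0 := by
        have hre : Tendsto (fun t : ℝ => ‖((t⁻¹ : ℝ) : ℂ) • (S t (f - u) - (f - u)) - (f - u)‖)
            (𝓝[>] 0) (𝓝 0) := tendsto_iff_norm_sub_tendsto_zero.1 hx
        refine ge_of_tendsto hre ?_
        filter_upwards [self_mem_nhdsWithin] with t ht
        have ht' : (0 : ℝ) < t := ht
        set x := f - u
        have h1 := hSc t ht'.le x
        have e : S t x = t • (((t⁻¹ : ℝ) : ℂ) • (S t x - x) - x) + (1 + t) • x := by
          rw [Complex.coe_smul, smul_sub, smul_smul, mul_inv_cancel₀ ht'.ne', one_smul, add_smul,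
            one_smul]
          abel
        have h2 : ‖(1 + t) • x‖ ≤ ‖S t x‖ + ‖t • (((t⁻¹ : ℝ) : ℂ) • (S t x - x) - x)‖ := by
          have e2 : (1 + t) • x = S t x - t • (((t⁻¹ : ℝ) : ℂ) • (S t x - x) - x) := by
            rw [eq_sub_iff_add_eq, add_comm]; exact e.symm
          rw [e2]; exact norm_sub_le _ _
        rw [norm_smul, norm_smul, Real.norm_of_nonneg (by linarith),
          Real.norm_of_nonneg ht'.le] at h2
        have h3 : t * ‖x‖ ≤ t * ‖((t⁻¹ : ℝ) : ℂ) • (S t x - x) - x‖ := by linarith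
        exact le_of_mul_le_mul_left h3 ht'
      exact norm_le_zero_iff.1 hle
    have hfu : f = u := sub_eq_zero.1 hx0
    have : u - (f - g) = g := by rw [← hfu]; abel
    rw [this, ← hfu] at hGu
    exact hGu

end HilleYosida

end

section

/-! ### Directional derivatives of smooth functions on the torus -/

section Smooth

/-- The class in the torus of a point of the plane. -/
def toTorus (v : ℝ × ℝ) : Torus := ((v.1 : Circ), (v.2 : Circ))

theorem toTorus_add (v w : ℝ × ℝ) : toTorus (v + w) = toTorus v + toTorus w := by
  simp [toTorus]

theorem toTorus_zero : toTorus 0 = 0 := by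
  simp [toTorus]

theorem exists_toTorus (p : Torus) : ∃ v, toTorus v = p := by
  obtain ⟨a, ha⟩ := QuotientAddGroup.mk_surjective p.1
  obtain ⟨b, hb⟩ := QuotientAddGroup.mk_surjective p.2
  exact ⟨(a, b), Prod.ext ha hb⟩

/-- The derivative in the direction `v`. -/
def dirDeriv (v : ℝ × ℝ) (φ : Torus → ℂ) (p : Torus) : ℂ :=
  deriv (fun s : ℝ => φ (p + toTorus (s • v))) 0

theorem dx_eq_dirDeriv (φ : Torus → ℂ) : dx φ = dirDeriv (1, 0) φ := by
  funext p
  simp only [dx, dirDeriv]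
  congr 1
  funext s
  congr 1
  ext <;> simp [toTorus]

theorem dy_eq_dirDeriv (φ : Torus → ℂ) : dy φ = dirDeriv (0, 1) φ := by
  funext p
  simp only [dy, dirDeriv]
  congr 1
  funext s
  congr 1
  ext <;> simp [toTorus]

/-- The map `ℝ² → 𝕋²` is an open quotient map, so continuity of the lift descends. -/
theorem IsSmooth.continuous {φ : Torus → ℂ} (hφ : IsSmooth φ) : Continuous φ := by
  have h1 : IsOpenQuotientMap (fun a : ℝ => (a : Circ)) := QuotientAddGroup.isOpenQuotientMap_mk
  exact (h1.prodMap h1).continuous_comp_iff.1 (ContDiff.continuous hφ)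

theorem hasDerivAt_lift {φ : Torus → ℂ} (hφ : IsSmooth φ) (v w : ℝ × ℝ) (s : ℝ) :
    HasDerivAt (fun s : ℝ => φ (toTorus w + toTorus (s • v)))
      (fderiv ℝ (fun q : ℝ × ℝ => φ (toTorus q)) (w + s • v) v) s := by
  have h1 : HasFDerivAt (fun q : ℝ × ℝ => φ (toTorus q))
      (fderiv ℝ (fun q : ℝ × ℝ => φ (toTorus q)) (w + s • v)) (w + s • v) :=
    ((ContDiff.differentiable hφ (by simp)) _).hasFDerivAt
  have h2 : HasDerivAt (fun s : ℝ => w + s • v) v s := by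
    simpa using ((hasDerivAt_id s).smul_const v).const_add w
  have h3 := h1.comp_hasDerivAt s h2
  refine h3.congr_of_eventuallyEq (Eventually.of_forall fun s => ?_)
  simp [toTorus_add]

theorem dirDeriv_toTorus {φ : Torus → ℂ} (hφ : IsSmooth φ) (v w : ℝ × ℝ) :
    dirDeriv v φ (toTorus w) = fderiv ℝ (fun q : ℝ × ℝ => φ (toTorus q)) w v := by
  have := (hasDerivAt_lift hφ v w 0).deriv
  rwa [zero_smul, add_zero] at this

theorem hasDerivAt_dirDeriv {φ : Torus → ℂ} (hφ : IsSmooth φ) (v : ℝ × ℝ) (p : Torus) (s : ℝ) :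
    HasDerivAt (fun s : ℝ => φ (p + toTorus (s • v))) (dirDeriv v φ (p + toTorus (s • v))) s := by
  obtain ⟨w, rfl⟩ := exists_toTorus p
  rw [← toTorus_add, dirDeriv_toTorus hφ]
  exact hasDerivAt_lift hφ v w s

theorem IsSmooth.dirDeriv {φ : Torus → ℂ} (hφ : IsSmooth φ) (v : ℝ × ℝ) :
    IsSmooth (dirDeriv v φ) := by
  have h : ContDiff ℝ (⊤ : ℕ∞) (fun w : ℝ × ℝ => fderiv ℝ (fun q : ℝ × ℝ => φ (toTorus q)) w v) :=
    (ContDiff.fderiv_right (m := (⊤ : ℕ∞)) hφ (by simp)).clm_apply contDiff_const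
  have e : (fun p : ℝ × ℝ => Kolmogorov.dirDeriv v φ ((p.1 : Circ), (p.2 : Circ))) =
      fun w : ℝ × ℝ => fderiv ℝ (fun q : ℝ × ℝ => φ (toTorus q)) w v :=
    funext fun w => dirDeriv_toTorus hφ v w
  rw [IsSmooth, e]
  exact h

theorem IsSmooth.mul {φ χ : Torus → ℂ} (hφ : IsSmooth φ) (hχ : IsSmooth χ) :
    IsSmooth (fun p => φ p * χ p) :=
  ContDiff.mul hφ hχ

theorem dirDeriv_mul {φ χ : Torus → ℂ} (hφ : IsSmooth φ) (hχ : IsSmooth χ) (v : ℝ × ℝ)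
    (p : Torus) : dirDeriv v (fun p => φ p * χ p) p
      = dirDeriv v φ p * χ p + φ p * dirDeriv v χ p := by
  have h := ((hasDerivAt_dirDeriv hφ v p 0).mul (hasDerivAt_dirDeriv hχ v p 0)).deriv
  simp only [zero_smul, toTorus_zero, add_zero] at h
  exact h

theorem integrable_of_continuous {φ : Torus → ℂ} (hφ : Continuous φ) : Integrable φ :=
  hφ.integrable_of_hasCompactSupport (HasCompactSupport.of_compactSpace φ)

instance instIsAddRightInvariantTorus : (volume : Measure Torus).IsAddRightInvariant := by
  rw [Measure.volume_eq_prod]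
  infer_instance

/-- By translation invariance `s ↦ ∫ φ (p + s v)` is constant; the integral in question is its
derivative at `0`. -/
theorem integral_dirDeriv {φ : Torus → ℂ} (hφ : IsSmooth φ) (v : ℝ × ℝ) :
    ∫ p, dirDeriv v φ p = 0 := by
  have hc := (hφ.dirDeriv v).continuous
  obtain ⟨C, hC⟩ := (HasCompactSupport.of_compactSpace (dirDeriv v φ)).exists_bound_of_continuous hc
  have h := (hasDerivAt_integral_of_dominated_loc_of_deriv_le (μ := (volume : Measure Torus))
    (F := fun (s : ℝ) p => φ (p + toTorus (s • v)))
    (F' := fun (s : ℝ) p => dirDeriv v φ (p + toTorus (s • v))) (x₀ := 0) (s := Set.univ)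
    (bound := fun _ => C) univ_mem
    (Eventually.of_forall fun s =>
      (hφ.continuous.comp (continuous_id.add continuous_const)).aestronglyMeasurable)
    (integrable_of_continuous (hφ.continuous.comp (continuous_id.add continuous_const)))
    (hc.comp (continuous_id.add continuous_const)).aestronglyMeasurable
    (ae_of_all _ fun p s _ => hC _) (integrable_const _)
    (ae_of_all _ fun p s _ => hasDerivAt_dirDeriv hφ v p s)).2
  have e : (fun s : ℝ => ∫ p, φ (p + toTorus (s • v))) = fun _ => ∫ p, φ p :=
    funext fun s => integral_add_right_eq_self (μ := (volume : Measure Torus)) φ _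
  rw [e] at h
  have := h.unique (hasDerivAt_const _ _)
  simpa [toTorus_zero] using this

end Smooth

/-! ### Characters of the torus -/

section Characters

/-- The character `e^{i (n₁ x + n₂ y)}`. -/
def torusChar (n : ℤ × ℤ) : C(Torus, ℂ) where
  toFun p := fourier n.1 p.1 * fourier n.2 p.2
  continuous_toFun := by fun_prop

theorem torusChar_apply (n : ℤ × ℤ) (p : Torus) :
    torusChar n p = fourier n.1 p.1 * fourier n.2 p.2 := rfl

theorem torusChar_neg (n : ℤ × ℤ) (p : Torus) :
    torusChar (-n) p = (starRingEnd ℂ) (torusChar n p) := by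
  simp only [torusChar_apply, Prod.fst_neg, Prod.snd_neg, fourier_neg, map_mul]

theorem torusChar_add (m n : ℤ × ℤ) (p : Torus) :
    torusChar (m + n) p = torusChar m p * torusChar n p := by
  simp only [torusChar_apply, Prod.fst_add, Prod.snd_add, fourier_add]
  ring

theorem norm_torusChar (n : ℤ × ℤ) (p : Torus) : ‖torusChar n p‖ = 1 := by
  rw [torusChar_apply, norm_mul, norm_fourier, norm_fourier, one_mul]

theorem torusChar_toTorus (n : ℤ × ℤ) (v : ℝ × ℝ) :
    torusChar n (toTorus v) = Complex.exp (Complex.I * (n.1 * v.1 + n.2 * v.2)) := by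
  have hpi : (Real.pi : ℂ) ≠ 0 := Complex.ofReal_ne_zero.2 Real.pi_ne_zero
  simp only [torusChar_apply, toTorus, fourier_coe_apply, ← Complex.exp_add]
  congr 1
  push_cast
  field_simp

theorem isSmooth_torusChar (n : ℤ × ℤ) : IsSmooth (torusChar n) := by
  have e : (fun p : ℝ × ℝ => torusChar n ((p.1 : Circ), (p.2 : Circ))) =
      fun v : ℝ × ℝ => Complex.exp (Complex.I * (n.1 * (v.1 : ℂ) + n.2 * (v.2 : ℂ))) :=
    funext fun v => torusChar_toTorus n v
  rw [IsSmooth, e]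
  have h1 : ContDiff ℝ (⊤ : ℕ∞) (fun v : ℝ × ℝ => (v.1 : ℂ)) :=
    Complex.ofRealCLM.contDiff.comp contDiff_fst
  have h2 : ContDiff ℝ (⊤ : ℕ∞) (fun v : ℝ × ℝ => (v.2 : ℂ)) :=
    Complex.ofRealCLM.contDiff.comp contDiff_snd
  exact (contDiff_const.mul ((contDiff_const.mul h1).add (contDiff_const.mul h2))).cexp

theorem dirDeriv_const_mul_torusChar (n : ℤ × ℤ) (v : ℝ × ℝ) (a : ℂ) :
    dirDeriv v (fun p => a * torusChar n p) =
      fun p => (Complex.I * (n.1 * v.1 + n.2 * v.2) * a) * torusChar n p := by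
  funext p
  obtain ⟨w, rfl⟩ := exists_toTorus p
  simp only [dirDeriv, ← toTorus_add, torusChar_toTorus]
  have h : HasDerivAt (fun s : ℝ => Complex.I * (n.1 * (((w + s • v).1 : ℝ) : ℂ)
      + n.2 * (((w + s • v).2 : ℝ) : ℂ))) (Complex.I * (n.1 * v.1 + n.2 * v.2)) 0 := by
    have hs : HasDerivAt (fun s : ℝ => (s : ℂ)) 1 (0 : ℝ) := Complex.ofRealCLM.hasDerivAt
    have h1 := ((((hs.mul_const (v.1 : ℂ)).const_add (w.1 : ℂ)).const_mul (n.1 : ℂ)).add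
      (((hs.mul_const (v.2 : ℂ)).const_add (w.2 : ℂ)).const_mul (n.2 : ℂ))).const_mul Complex.I
    simp only [one_mul] at h1
    refine h1.congr_of_eventuallyEq (Eventually.of_forall fun s => ?_)
    simp
  have h2 := (h.cexp.const_mul a).deriv
  simp only [zero_smul, add_zero] at h2
  rw [h2]
  ring

theorem iterate_dx_dy_torusChar (k m : ℕ) (n : ℤ × ℤ) :
    dx^[k] (dy^[m] (torusChar n)) =
      fun p => ((Complex.I * n.1) ^ k * (Complex.I * n.2) ^ m) * torusChar n p := by
  have hy : ∀ m : ℕ, dy^[m] (torusChar n) = fun p => (Complex.I * n.2) ^ m * torusChar n p := by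
    intro m
    induction m with
    | zero => simp
    | succ m ih =>
      rw [Function.iterate_succ_apply', ih, dy_eq_dirDeriv, dirDeriv_const_mul_torusChar]
      funext p
      simp only [Complex.ofReal_zero, Complex.ofReal_one]
      ring
  rw [hy]
  induction k with
  | zero => simp
  | succ k ih =>
    rw [Function.iterate_succ_apply', ih, dx_eq_dirDeriv, dirDeriv_const_mul_torusChar]
    funext p
    simp only [Complex.ofReal_zero, Complex.ofReal_one]
    ring

theorem integral_dirDeriv_mul_torusChar {φ : Torus → ℂ} (hφ : IsSmooth φ) (v : ℝ × ℝ)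
    (n : ℤ × ℤ) : ∫ p, dirDeriv v φ p * torusChar n p =
      -(Complex.I * (n.1 * v.1 + n.2 * v.2)) * ∫ p, φ p * torusChar n p := by
  have hχ := isSmooth_torusChar n
  have h := integral_dirDeriv (hφ.mul hχ) v
  simp_rw [dirDeriv_mul hφ hχ] at h
  rw [integral_add (integrable_of_continuous ((hφ.dirDeriv v).mul hχ).continuous)
    (integrable_of_continuous (hφ.mul (hχ.dirDeriv v)).continuous)] at h
  have e : ∀ p, dirDeriv v (torusChar n) p = Complex.I * (n.1 * v.1 + n.2 * v.2) * torusChar n p := by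
    intro p
    have := congrFun (dirDeriv_const_mul_torusChar n v 1) p
    simpa using this
  simp_rw [e] at h
  rw [eq_neg_of_add_eq_zero_left h, neg_mul, ← integral_const_mul]
  congr 2
  funext p
  ring

theorem IsSmooth.iterate_dx_dy {φ : Torus → ℂ} (hφ : IsSmooth φ) (k m : ℕ) :
    IsSmooth (dx^[k] (dy^[m] φ)) := by
  have hy : ∀ m : ℕ, IsSmooth (dy^[m] φ) := by
    intro m
    induction m with
    | zero => exact hφ
    | succ m ih =>
      rw [Function.iterate_succ_apply', dy_eq_dirDeriv]
      exact ih.dirDeriv _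
  induction k with
  | zero => exact hy m
  | succ k ih =>
    rw [Function.iterate_succ_apply', dx_eq_dirDeriv]
    exact ih.dirDeriv _

theorem integral_iterate_dx_dy_mul_torusChar {φ : Torus → ℂ} (hφ : IsSmooth φ) (k m : ℕ)
    (n : ℤ × ℤ) : ∫ p, (dx^[k] (dy^[m] φ)) p * torusChar n p =
      (-1) ^ (k + m) * ((Complex.I * n.1) ^ k * (Complex.I * n.2) ^ m)
        * ∫ p, φ p * torusChar n p := by
  have hy : ∀ m : ℕ, ∫ p, (dy^[m] φ) p * torusChar n p =
      (-1) ^ m * (Complex.I * n.2) ^ m * ∫ p, φ p * torusChar n p := by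
    intro m
    induction m with
    | zero => simp
    | succ m ih =>
      rw [Function.iterate_succ_apply', dy_eq_dirDeriv,
        integral_dirDeriv_mul_torusChar (φ := dy^[m] φ) (hφ.iterate_dx_dy 0 m), ih]
      simp only [Complex.ofReal_zero, Complex.ofReal_one]
      ring
  induction k with
  | zero => rw [Function.iterate_zero, id, hy]; simp
  | succ k ih =>
    rw [Function.iterate_succ_apply', dx_eq_dirDeriv,
      integral_dirDeriv_mul_torusChar (hφ.iterate_dx_dy k m), ih]
    simp only [Complex.ofReal_zero, Complex.ofReal_one]
    ring

end Characters

/-! ### The Fourier basis of `L²(𝕋²)` -/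

section Basis

theorem integral_fourier (l : ℤ) :
    ∫ x : Circ, fourier l x = if l = 0 then ((2 * Real.pi : ℝ) : ℂ) else 0 := by
  split_ifs with h
  · subst h
    have hvol : (volume : Measure Circ).real Set.univ = 2 * Real.pi := by
      simp [Measure.real, AddCircle.measure_univ, Real.pi_pos.le]
    simp_rw [fourier_zero]
    rw [integral_const, hvol, Complex.real_smul, mul_one]
  · exact integral_fourier_of_ne h

theorem integral_torusChar (n : ℤ × ℤ) :
    ∫ p, torusChar n p = if n = 0 then ((2 * Real.pi : ℝ) : ℂ) ^ 2 else 0 := by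
  have h : ∫ p : Circ × Circ, torusChar n p = (∫ x : Circ, fourier n.1 x) * ∫ y : Circ, fourier n.2 y :=
    integral_prod_mul (μ := (volume : Measure Circ)) (ν := (volume : Measure Circ))
      (fun x : Circ => (fourier n.1 x : ℂ)) (fun y : Circ => (fourier n.2 y : ℂ))
  rw [h, integral_fourier, integral_fourier]
  simp only [Prod.ext_iff, Prod.fst_zero, Prod.snd_zero]
  split_ifs <;> simp_all [sq]

/-- The star subalgebra of continuous functions generated by the characters. -/
def torusSubalgebra : StarSubalgebra ℂ C(Torus, ℂ) where
  toSubalgebra := Algebra.adjoin ℂ (Set.range torusChar)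
  star_mem' := by
    change Algebra.adjoin ℂ (Set.range torusChar) ≤ star (Algebra.adjoin ℂ (Set.range torusChar))
    refine Algebra.adjoin_le ?_
    rintro _ ⟨n, rfl⟩
    refine Algebra.subset_adjoin ⟨-n, ?_⟩
    ext1 x
    simp only [torusChar_neg, starRingEnd_apply, ContinuousMap.star_apply]

theorem torusSubalgebra_coe : Subalgebra.toSubmodule torusSubalgebra.toSubalgebra
    = Submodule.span ℂ (Set.range torusChar) := by
  apply Algebra.adjoin_eq_span_of_subset
  refine .trans (fun x => Submonoid.closure_induction (fun _ => id) ⟨0, ?_⟩ ?_)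
    Submodule.subset_span
  · ext z
    simp [torusChar_apply]
  · rintro _ _ _ _ ⟨m, rfl⟩ ⟨n, rfl⟩
    exact ⟨m + n, ContinuousMap.ext fun z => torusChar_add m n z⟩

/-- One character per coordinate suffices, because `fourier 1` is injective on the circle. -/
theorem torusSubalgebra_separatesPoints : torusSubalgebra.SeparatesPoints := by
  intro p q hpq
  have hinj : Function.Injective fun x : Circ => (fourier 1 x : ℂ) := by
    intro x y hxy
    simp only [fourier_one] at hxy
    exact AddCircle.injective_toCircle Real.two_pi_pos.ne' (Subtype.coe_injective hxy)
  by_cases h1 : p.1 = q.1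
  · have h2 : p.2 ≠ q.2 := fun h => hpq (Prod.ext h1 h)
    refine ⟨torusChar (0, 1), ⟨torusChar (0, 1), Algebra.subset_adjoin ⟨(0, 1), rfl⟩, rfl⟩, ?_⟩
    simp only [torusChar_apply, fourier_zero, one_mul]
    exact fun h => h2 (hinj h)
  · refine ⟨torusChar (1, 0), ⟨torusChar (1, 0), Algebra.subset_adjoin ⟨(1, 0), rfl⟩, rfl⟩, ?_⟩
    simp only [torusChar_apply, fourier_zero, mul_one]
    exact fun h => h1 (hinj h)

theorem span_torusChar_closure_eq_top :
    (Submodule.span ℂ (Set.range torusChar)).topologicalClosure = ⊤ := by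
  rw [← torusSubalgebra_coe]
  exact congr_arg (Subalgebra.toSubmodule <| StarSubalgebra.toSubalgebra ·)
    (ContinuousMap.starSubalgebra_topologicalClosure_eq_top_of_separatesPoints _
      torusSubalgebra_separatesPoints)

/-- The normalised characters in `L²(𝕋²)`. -/
def unitChar (n : ℤ × ℤ) : L2 :=
  ((2 * Real.pi : ℝ) : ℂ)⁻¹ • ContinuousMap.toLp (E := ℂ) 2 (volume : Measure Torus) ℂ (torusChar n)

theorem two_pi_ne_zero' : ((2 * Real.pi : ℝ) : ℂ) ≠ 0 :=
  Complex.ofReal_ne_zero.2 Real.two_pi_pos.ne'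

theorem orthonormal_unitChar : Orthonormal ℂ unitChar := by
  rw [orthonormal_iff_ite]
  intro m n
  rw [unitChar, unitChar, inner_smul_left, inner_smul_right, ContinuousMap.inner_toLp]
  simp_rw [← torusChar_neg, ← torusChar_add]
  have e : n + -m = 0 ↔ m = n := by rw [add_neg_eq_zero, eq_comm]
  rw [integral_torusChar]
  simp only [e]
  split_ifs
  · rw [← Complex.ofReal_inv, Complex.conj_ofReal]
    push_cast
    have hpi : (Real.pi : ℂ) ≠ 0 := Complex.ofReal_ne_zero.2 Real.pi_ne_zero
    field_simp
  · simp

theorem span_unitChar_closure_eq_top :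
    (Submodule.span ℂ (Set.range unitChar)).topologicalClosure = ⊤ := by
  have h := (ContinuousMap.toLp_denseRange ℂ (volume : Measure Torus) ℂ
    (p := 2) (by simp)).topologicalClosure_map_submodule span_torusChar_closure_eq_top
  rw [eq_top_iff, ← h]
  refine Submodule.topologicalClosure_mono ?_
  rw [Submodule.map_span, Submodule.span_le]
  rintro _ ⟨_, ⟨n, rfl⟩, rfl⟩
  have e : ContinuousMap.toLp (E := ℂ) 2 (volume : Measure Torus) ℂ (torusChar n)
      = ((2 * Real.pi : ℝ) : ℂ) • unitChar n := by
    rw [unitChar, smul_smul, mul_inv_cancel₀ two_pi_ne_zero', one_smul]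
  exact e ▸ Submodule.smul_mem _ _ (Submodule.subset_span ⟨n, rfl⟩)

/-- The Fourier basis of `L²(𝕋²)`. -/
def torusBasis : HilbertBasis (ℤ × ℤ) ℂ L2 :=
  HilbertBasis.mk orthonormal_unitChar span_unitChar_closure_eq_top.ge

theorem torusBasis_apply (n : ℤ × ℤ) : torusBasis n = unitChar n := by
  rw [torusBasis, HilbertBasis.coe_mk]

/-- Fourier coefficients, normalised as coordinates in the orthonormal Fourier basis. -/
def coeff (f : Torus → ℂ) (n : ℤ × ℤ) : ℂ :=
  ((2 * Real.pi : ℝ) : ℂ)⁻¹ * ∫ p, f p * torusChar (-n) p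

theorem inner_toLp_left (χ : C(Torus, ℂ)) (ω : L2) :
    ⟪ContinuousMap.toLp (E := ℂ) 2 (volume : Measure Torus) ℂ χ, ω⟫_ℂ
      = ∫ p, (ω : Torus → ℂ) p * (starRingEnd ℂ) (χ p) := by
  rw [L2.inner_def]
  refine integral_congr_ae ?_
  filter_upwards [ContinuousMap.coeFn_toLp (E := ℂ) (p := 2) (𝕜 := ℂ) (volume : Measure Torus) χ]
    with p hp
  rw [hp]
  simp

theorem inner_unitChar (n : ℤ × ℤ) (ω : L2) : ⟪unitChar n, ω⟫_ℂ = coeff ω n := by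
  rw [unitChar, inner_smul_left, inner_toLp_left, coeff, ← Complex.ofReal_inv,
    Complex.conj_ofReal]
  simp_rw [torusChar_neg]

theorem torusBasis_repr (ω : L2) (n : ℤ × ℤ) : torusBasis.repr ω n = coeff ω n := by
  rw [HilbertBasis.repr_apply_apply, torusBasis_apply, inner_unitChar]

theorem coeff_congr {f g : Torus → ℂ} (h : f =ᵐ[volume] g) (n : ℤ × ℤ) :
    coeff f n = coeff g n := by
  rw [coeff, coeff]
  congr 1
  exact integral_congr_ae (h.mono fun p hp => by simp only [hp])

theorem eq_of_coeff_eq {f g : L2} (h : ∀ n, coeff f n = coeff g n) : f = g := by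
  apply torusBasis.repr.injective
  ext n
  rw [torusBasis_repr, torusBasis_repr, h]

/-- Conjugate characters are admissible test functions, and differentiating one only multiplies it
by a scalar. -/
theorem HasWeakPartial.coeff_eq {k m : ℕ} {f g : Torus → ℂ} (h : HasWeakPartial k m f g)
    (n : ℤ × ℤ) : coeff g n = (Complex.I * n.1) ^ k * (Complex.I * n.2) ^ m * coeff f n := by
  have h1 := h _ (isSmooth_torusChar (-n))
  rw [iterate_dx_dy_torusChar] at h1
  have e : ∀ p, f p * ((Complex.I * ((-n).1 : ℤ)) ^ k * (Complex.I * ((-n).2 : ℤ)) ^ m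
      * torusChar (-n) p) = ((-1) ^ (k + m) * ((Complex.I * n.1) ^ k * (Complex.I * n.2) ^ m))
        * (f p * torusChar (-n) p) := by
    intro p
    simp only [Prod.fst_neg, Prod.snd_neg, Int.cast_neg, mul_neg]
    rw [neg_pow (Complex.I * _) k, neg_pow (Complex.I * _) m, pow_add]
    ring
  simp_rw [e] at h1
  rw [integral_const_mul, mul_assoc] at h1
  have h2 := mul_left_cancel₀ (pow_ne_zero _ (by norm_num)) h1
  rw [coeff, coeff, ← h2]
  ring

/-- Parseval expands both sides of the weak identity, and integration by parts against characters,
legitimate because the test function is smooth, matches them term by term. -/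
theorem hasWeakPartial_of_coeff {k m : ℕ} {f g : L2}
    (h : ∀ n : ℤ × ℤ, coeff g n = (Complex.I * n.1) ^ k * (Complex.I * n.2) ^ m * coeff f n) :
    HasWeakPartial k m f g := by
  intro φ hφ
  have key : ∀ (ψ : Torus → ℂ) (_ : Continuous ψ) (ω : L2), HasSum (fun n =>
      (((2 * Real.pi : ℝ) : ℂ)⁻¹ * ∫ p, ψ p * torusChar n p) * coeff ω n)
      (∫ p, (ω : Torus → ℂ) p * ψ p) := by
    intro ψ hψ ω
    set χ : C(Torus, ℂ) := ⟨fun p => (starRingEnd ℂ) (ψ p), Complex.continuous_conj.comp hψ⟩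
    have h1 := torusBasis.hasSum_inner_mul_inner
      (ContinuousMap.toLp (E := ℂ) 2 (volume : Measure Torus) ℂ χ) ω
    rw [inner_toLp_left] at h1
    simp only [χ, ContinuousMap.coe_mk, Complex.conj_conj] at h1
    refine h1.congr_fun fun n => ?_
    rw [torusBasis_apply, inner_unitChar]
    congr 1
    rw [unitChar, inner_smul_right, ContinuousMap.inner_toLp]
    congr 2
    funext p
    simp [mul_comm]
  have h1 := key _ (hφ.iterate_dx_dy k m).continuous f
  have h2 := (key φ hφ.continuous g).mul_left ((-1) ^ (k + m))
  refine h1.unique ?_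
  refine h2.congr_fun fun n => ?_
  rw [integral_iterate_dx_dy_mul_torusChar hφ, h n]
  ring

end Basis

/-! ### Multiplication by `sin y` -/

section Sine

theorem sinCirc_eq (y : Circ) :
    (sinCirc y : ℂ) = (fourier 1 y - fourier (-1) y) / (2 * Complex.I) := by
  obtain ⟨a, rfl⟩ := QuotientAddGroup.mk_surjective y
  have e : sinCirc (QuotientAddGroup.mk a : Circ) = Real.sin a := rfl
  have h1 : fourier 1 (QuotientAddGroup.mk a : Circ) = Complex.exp (a * Complex.I) := by
    have := fourier_coe_apply (T := 2 * Real.pi) (n := 1) (x := a)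
    refine this.trans ?_
    have hpi : (Real.pi : ℂ) ≠ 0 := Complex.ofReal_ne_zero.2 Real.pi_ne_zero
    congr 1
    push_cast
    field_simp
  rw [e, fourier_neg, h1, ← Complex.exp_conj, Complex.ofReal_sin, Complex.sin]
  simp only [map_mul, Complex.conj_ofReal, Complex.conj_I]
  field_simp
  rw [Complex.I_sq]
  ring_nf

theorem continuous_sinCirc : Continuous fun y : Circ => (sinCirc y : ℂ) := by
  simp_rw [sinCirc_eq]
  fun_prop

theorem norm_sinCirc_le (y : Circ) : ‖(sinCirc y : ℂ)‖ ≤ 1 := by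
  obtain ⟨a, rfl⟩ := QuotientAddGroup.mk_surjective y
  rw [Complex.norm_real, Real.norm_eq_abs]
  exact Real.abs_sin_le_one a

theorem memLp_sin_mul (ω : L2) :
    MemLp (fun p : Torus => (sinCirc p.2 : ℂ) * (ω : Torus → ℂ) p) 2 volume := by
  refine (Lp.memLp ω).of_le_mul (c := 1) ?_ (ae_of_all _ fun p => ?_)
  · exact (continuous_sinCirc.comp continuous_snd).aestronglyMeasurable.mul
      (Lp.aestronglyMeasurable ω)
  · rw [norm_mul]
    exact mul_le_mul_of_nonneg_right (norm_sinCirc_le _) (norm_nonneg _)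

theorem integrable_mul_torusChar (ω : L2) (n : ℤ × ℤ) :
    Integrable (fun p => (ω : Torus → ℂ) p * torusChar n p) :=
  (L2.integrable ω).mul_bdd (c := 1) (torusChar n).continuous.aestronglyMeasurable
    (ae_of_all _ fun p => (norm_torusChar n p).le)

theorem coeff_sin_mul (ω : L2) (l j : ℤ) :
    coeff (fun p : Torus => (sinCirc p.2 : ℂ) * (ω : Torus → ℂ) p) (l, j) =
      (coeff ω (l, j - 1) - coeff ω (l, j + 1)) / (2 * Complex.I) := by
  have e : ∀ p : Torus, (sinCirc p.2 : ℂ) * (ω : Torus → ℂ) p * torusChar (-(l, j)) p =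
      (2 * Complex.I)⁻¹ * ((ω : Torus → ℂ) p * torusChar (-(l, j - 1)) p
        - (ω : Torus → ℂ) p * torusChar (-(l, j + 1)) p) := by
    intro p
    have h1 : torusChar (-(l, j - 1)) p = fourier 1 p.2 * torusChar (-(l, j)) p := by
      simp only [torusChar_apply, Prod.neg_mk, neg_sub]
      rw [sub_eq_add_neg, fourier_add]; ring
    have h2 : torusChar (-(l, j + 1)) p = fourier (-1) p.2 * torusChar (-(l, j)) p := by
      simp only [torusChar_apply, Prod.neg_mk, neg_add]
      rw [fourier_add]; ring
    rw [h1, h2, sinCirc_eq]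
    field_simp
  simp_rw [coeff, e]
  rw [integral_const_mul, integral_sub (integrable_mul_torusChar ω _) (integrable_mul_torusChar ω _)]
  field_simp

end Sine

end

section

/-! ### Diagonal operators on `ℓ²` -/

section Diagonal

variable {ι : Type*}

theorem memℓp_two_of_le {x : ι → ℂ} {y : lp (fun _ : ι => ℂ) 2} {C : ℝ}
    (h : ∀ i, ‖x i‖ ≤ C * ‖y i‖) : Memℓp x 2 := by
  have hy := (memℓp_gen_iff (p := 2) (by norm_num)).1 (lp.memℓp y)
  rw [memℓp_gen_iff (by norm_num)]
  refine Summable.of_nonneg_of_le (fun i => by positivity) (fun i => ?_) (hy.mul_left (C ^ 2))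
  simp only [ENNReal.toReal_ofNat, Real.rpow_ofNat]
  rw [← mul_pow]
  exact pow_le_pow_left₀ (norm_nonneg _) (h i) 2

theorem lp_norm_sq (x : lp (fun _ : ι => ℂ) 2) : ‖x‖ ^ 2 = ∑' i, ‖x i‖ ^ 2 := by
  have := lp.norm_rpow_eq_tsum (p := 2) (by norm_num) x
  simpa using this

theorem lp_summable_sq (x : lp (fun _ : ι => ℂ) 2) : Summable fun i => ‖x i‖ ^ 2 := by
  have := (memℓp_gen_iff (p := 2) (by norm_num)).1 (lp.memℓp x)
  simpa using this

theorem lp_norm_le_of_le {x y : lp (fun _ : ι => ℂ) 2} {C : ℝ} (hC : 0 ≤ C)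
    (h : ∀ i, ‖x i‖ ≤ C * ‖y i‖) : ‖x‖ ≤ C * ‖y‖ := by
  rw [← abs_of_nonneg (norm_nonneg x), ← abs_of_nonneg (by positivity : 0 ≤ C * ‖y‖), ← sq_le_sq]
  rw [mul_pow, lp_norm_sq, lp_norm_sq, ← tsum_mul_left]
  refine (lp_summable_sq x).tsum_le_tsum (fun i => ?_) ((lp_summable_sq y).mul_left _)
  rw [← mul_pow]
  exact pow_le_pow_left₀ (norm_nonneg _) (h i) 2

/-- The diagonal operator on `ℓ²` with bounded entries `m`. -/
def lpDiag (m : ι → ℂ) (C : ℝ) (hm : ∀ i, ‖m i‖ ≤ C) :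
    lp (fun _ : ι => ℂ) 2 →L[ℂ] lp (fun _ : ι => ℂ) 2 :=
  LinearMap.mkContinuous
    { toFun := fun x => ⟨fun i => m i * x i, memℓp_two_of_le (y := x) (C := C) fun i => by
        rw [norm_mul]; exact mul_le_mul_of_nonneg_right (hm i) (norm_nonneg _)⟩
      map_add' := fun x y => by ext i; exact mul_add _ _ _
      map_smul' := fun a x => by ext i; exact mul_left_comm _ _ _ } (max C 0) (fun x => by
        refine lp_norm_le_of_le (le_max_right _ _) fun i => ?_
        change ‖m i * x i‖ ≤ _
        rw [norm_mul]
        exact mul_le_mul_of_nonneg_right ((hm i).trans (le_max_left _ _)) (norm_nonneg _))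

@[simp]
theorem lpDiag_apply (m : ι → ℂ) (C : ℝ) (hm : ∀ i, ‖m i‖ ≤ C) (x : lp (fun _ : ι => ℂ) 2)
    (i : ι) : lpDiag m C hm x i = m i * x i := rfl

end Diagonal

/-! ### Fourier coordinates on `L²₀(𝕋²)` -/

section ZeroMean

theorem coeff_zero_of_mem {ω : L2} (hω : ω ∈ L20) (j : ℤ) : coeff ω (0, j) = 0 := by
  have h : ∫ p : Circ × Circ, (ω : Torus → ℂ) p * torusChar (-(0, j)) p = 0 := by
    refine (integral_prod_symm _ (integrable_mul_torusChar ω _)).trans ?_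
    have hω' : ∀ᵐ y : Circ, ∫ x : Circ, (ω : Torus → ℂ) (x, y) = 0 := hω
    rw [← integral_zero Circ ℂ (μ := volume)]
    refine integral_congr_ae ?_
    filter_upwards [hω'] with y hy
    simp only [torusChar_apply, Prod.neg_mk, neg_zero, fourier_zero, one_mul]
    rw [integral_mul_const, hy, zero_mul]
  rw [coeff, h, mul_zero]

theorem unitChar_mem {n : ℤ × ℤ} (hn : n.1 ≠ 0) : unitChar n ∈ L20 := by
  refine Submodule.smul_mem _ _ ?_
  change ∀ᵐ y : Circ, _
  filter_upwards [ae_slice (ContinuousMap.coeFn_toLp (E := ℂ) (p := 2) (𝕜 := ℂ)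
    (volume : Measure Torus) (torusChar n))] with y hy
  rw [integral_congr_ae hy]
  simp only [torusChar_apply]
  rw [integral_mul_const, integral_fourier_of_ne hn, zero_mul]

/-- The frequencies `(l, j)` with `l ≠ 0`. -/
abbrev Freq : Type := {l : ℤ // l ≠ 0} × ℤ

/-- A frequency as a pair of integers. -/
def Freq.pair (i : Freq) : ℤ × ℤ := (i.1.1, i.2)

theorem Freq.pair_injective : Function.Injective Freq.pair := by
  rintro ⟨⟨l, hl⟩, j⟩ ⟨⟨l', hl'⟩, j'⟩ h
  simp only [Freq.pair, Prod.mk.injEq] at h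
  obtain ⟨rfl, rfl⟩ := h
  rfl

/-- The normalised characters in `L²₀(𝕋²)`. -/
def freqChar (i : Freq) : L20 := ⟨unitChar i.pair, unitChar_mem i.1.2⟩

theorem orthonormal_freqChar : Orthonormal ℂ freqChar := by
  have h := orthonormal_unitChar.comp _ Freq.pair_injective
  exact ⟨fun i => h.1 i, fun i j hij => h.2 hij⟩

theorem eq_of_coeff_pair_eq {f g : L20} (h : ∀ i : Freq, coeff (f : L2) i.pair = coeff (g : L2) i.pair) :
    f = g := by
  refine Subtype.ext (eq_of_coeff_eq fun n => ?_)
  by_cases hn : n.1 = 0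
  · obtain ⟨l, j⟩ := n
    simp only at hn
    subst hn
    rw [coeff_zero_of_mem f.2, coeff_zero_of_mem g.2]
  · exact h (⟨n.1, hn⟩, n.2)

theorem coeff_zero (n : ℤ × ℤ) : coeff ((0 : L20) : L2) n = 0 := by
  rw [← inner_unitChar]; simp

theorem span_freqChar_orthogonal : (Submodule.span ℂ (Set.range freqChar))ᗮ = ⊥ := by
  rw [eq_bot_iff]
  intro ω hω
  rw [Submodule.mem_bot]
  refine eq_of_coeff_pair_eq fun i => ?_
  rw [coeff_zero, ← inner_unitChar]
  exact (Submodule.mem_orthogonal _ _).1 hω _ (Submodule.subset_span ⟨i, rfl⟩)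

/-- The Fourier basis of `L²₀(𝕋²)`. -/
def freqBasis : HilbertBasis Freq ℂ L20 :=
  HilbertBasis.mkOfOrthogonalEqBot orthonormal_freqChar span_freqChar_orthogonal

/-- The Fourier coordinates on `L²₀(𝕋²)`. -/
def crd (ω : L20) (i : Freq) : ℂ := freqBasis.repr ω i

theorem freqBasis_apply (i : Freq) : freqBasis i = freqChar i := by
  rw [freqBasis, HilbertBasis.coe_mkOfOrthogonalEqBot]

theorem crd_eq_coeff (ω : L20) (i : Freq) : crd ω i = coeff (ω : L2) i.pair := by
  rw [crd, HilbertBasis.repr_apply_apply, freqBasis_apply, ← inner_unitChar]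
  rfl

theorem crd_ext {f g : L20} (h : ∀ i, crd f i = crd g i) : f = g :=
  freqBasis.repr.injective (lp.ext (funext h))

theorem crd_add (f g : L20) (i : Freq) : crd (f + g) i = crd f i + crd g i := by
  simp [crd]

theorem crd_sub (f g : L20) (i : Freq) : crd (f - g) i = crd f i - crd g i := by
  simp [crd]

theorem crd_smul (c : ℂ) (f : L20) (i : Freq) : crd (c • f) i = c * crd f i := by
  simp [crd]

theorem norm_le_of_crd {f g : L20} {C : ℝ} (hC : 0 ≤ C) (h : ∀ i, ‖crd f i‖ ≤ C * ‖crd g i‖) :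
    ‖f‖ ≤ C * ‖g‖ := by
  rw [← freqBasis.repr.norm_map f, ← freqBasis.repr.norm_map g]
  exact lp_norm_le_of_le hC h

theorem exists_of_crd_le {c : Freq → ℂ} {g : L20} {C : ℝ} (h : ∀ i, ‖c i‖ ≤ C * ‖crd g i‖) :
    ∃ f : L20, ∀ i, crd f i = c i :=
  ⟨freqBasis.repr.symm ⟨c, memℓp_two_of_le h⟩, fun i => by
    rw [crd, LinearIsometryEquiv.apply_symm_apply]⟩

/-- `l² + j²`. -/
def Freq.lam (i : Freq) : ℝ := (i.1.1 : ℝ) ^ 2 + (i.2 : ℝ) ^ 2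

theorem one_le_cast_sq {l : ℤ} (hl : l ≠ 0) : (1 : ℝ) ≤ (l : ℝ) ^ 2 := by
  have : (1 : ℤ) ≤ l ^ 2 := by
    have := sq_pos_of_ne_zero hl
    omega
  exact_mod_cast this

theorem Freq.one_le_lam (i : Freq) : 1 ≤ i.lam := by
  have := one_le_cast_sq i.1.2
  have := sq_nonneg (i.2 : ℝ)
  rw [Freq.lam]; linarith

theorem norm_neg_lam_mul (i : Freq) (z : ℂ) : ‖-(i.lam : ℂ) * z‖ = i.lam * ‖z‖ := by
  rw [norm_mul, norm_neg, Complex.norm_real, Real.norm_of_nonneg (zero_le_one.trans i.one_le_lam)]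

/-- A shifted frequency `(l, j + k)`. -/
def Freq.shift (i : Freq) (k : ℤ) : Freq := (i.1, i.2 + k)

/-- Elliptic regularity at the level of symbols: because `l² ≥ 1`, every monomial of order at most
two is dominated by `l² + j²`. -/
theorem norm_deriv_symbol_le (i : Freq) {k m : ℕ} (h : k + m ≤ 2) :
    ‖(Complex.I * i.pair.1) ^ k * (Complex.I * i.pair.2) ^ m‖ ≤ i.lam := by
  have h1 := one_le_cast_sq i.1.2
  have e1 : ‖Complex.I * (i.pair.1 : ℂ)‖ = |(i.1.1 : ℝ)| := by
    simp [Freq.pair]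
  have e2 : ‖Complex.I * (i.pair.2 : ℂ)‖ = |(i.2 : ℝ)| := by
    simp [Freq.pair]
  rw [norm_mul, norm_pow, norm_pow, e1, e2, Freq.lam]
  have hl : 1 ≤ |(i.1.1 : ℝ)| := by
    by_contra hcon
    push Not at hcon
    nlinarith [sq_abs (i.1.1 : ℝ), abs_nonneg (i.1.1 : ℝ)]
  have s1 := sq_abs (i.1.1 : ℝ)
  have s2 := sq_abs (i.2 : ℝ)
  have hj := abs_nonneg (i.2 : ℝ)
  rw [← s1, ← s2]
  have : (k = 0 ∧ m = 0) ∨ (k = 0 ∧ m = 1) ∨ (k = 0 ∧ m = 2) ∨ (k = 1 ∧ m = 0) ∨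
    (k = 1 ∧ m = 1) ∨ (k = 2 ∧ m = 0) := by omega
  rcases this with ⟨rfl, rfl⟩ | ⟨rfl, rfl⟩ | ⟨rfl, rfl⟩ | ⟨rfl, rfl⟩ | ⟨rfl, rfl⟩ | ⟨rfl, rfl⟩ <;>
    simp only [pow_zero, pow_one, one_mul, mul_one] <;>
    nlinarith [sq_nonneg (|(i.1.1 : ℝ)| - |(i.2 : ℝ)|), sq_nonneg (|(i.2 : ℝ)| - 1)]

theorem hasWeakPartial_of_crd {k m : ℕ} {f g : L20} (h : ∀ i : Freq,
    crd g i = (Complex.I * i.pair.1) ^ k * (Complex.I * i.pair.2) ^ m * crd f i) :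
    HasWeakPartial k m (f : L2) (g : L2) := by
  refine hasWeakPartial_of_coeff fun n => ?_
  by_cases hn : n.1 = 0
  · obtain ⟨l, j⟩ := n
    simp only at hn
    subst hn
    rw [coeff_zero_of_mem f.2, coeff_zero_of_mem g.2, mul_zero]
  · have := h (⟨n.1, hn⟩, n.2)
    rwa [crd_eq_coeff, crd_eq_coeff] at this

/-- Square summability of `(l² + j²) crd ω` already yields all weak derivatives up to order two, so
membership in `W^{2,2}` imposes no further condition. -/
theorem isA_iff (ω g : L20) : IsA ω g ↔ ∀ i, crd g i = -(i.lam : ℂ) * crd ω i := by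
  constructor
  · rintro ⟨-, gxx, gyy, hx, hy, e⟩ i
    have h1 := hx.coeff_eq i.pair
    have h2 := hy.coeff_eq i.pair
    rw [crd_eq_coeff, crd_eq_coeff, e, ← inner_unitChar, inner_add_right, inner_unitChar,
      inner_unitChar, h1, h2]
    simp only [pow_zero, one_mul, mul_one, mul_pow, Complex.I_sq, Freq.lam, Freq.pair]
    push_cast
    ring
  · intro h
    have key : ∀ k m : ℕ, k + m ≤ 2 → ∃ f : L20, ∀ i : Freq,
        crd f i = (Complex.I * i.pair.1) ^ k * (Complex.I * i.pair.2) ^ m * crd ω i := by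
      intro k m hkm
      refine exists_of_crd_le (g := g) (C := 1) fun i => ?_
      rw [h i, norm_mul, norm_neg_lam_mul, one_mul]
      exact mul_le_mul_of_nonneg_right (norm_deriv_symbol_le i hkm) (norm_nonneg _)
    obtain ⟨gxx, hxx⟩ := key 2 0 (by norm_num)
    obtain ⟨gyy, hyy⟩ := key 0 2 (by norm_num)
    refine ⟨fun k m hkm => ?_, gxx, gyy, hasWeakPartial_of_crd hxx, hasWeakPartial_of_crd hyy, ?_⟩
    · obtain ⟨f, hf⟩ := key k m hkm
      exact ⟨f, hasWeakPartial_of_crd hf⟩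
    · have : g = gxx + gyy := by
        refine crd_ext fun i => ?_
        rw [h i]
        rw [crd_add, hxx i, hyy i]
        simp only [pow_zero, one_mul, mul_one, mul_pow, Complex.I_sq, Freq.lam, Freq.pair]
        push_cast
        ring
      rw [this]; rfl

/-- Multiplication by `sin y`. -/
def sinFun (ω : L20) : L20 := ⟨(memLp_sin_mul (ω : L2)).toLp _, by
  have hω : ∀ᵐ y : Circ, ∫ x : Circ, ((ω : L2) : Torus → ℂ) (x, y) = 0 := ω.2
  change ∀ᵐ y : Circ, _
  filter_upwards [ae_slice (memLp_sin_mul (ω : L2)).coeFn_toLp, hω] with y hy h0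
  rw [integral_congr_ae hy, integral_const_mul, h0, mul_zero]⟩

theorem coeff_sinFun (ω : L20) (n : ℤ × ℤ) : coeff (sinFun ω : L2) n =
    coeff (fun p : Torus => (sinCirc p.2 : ℂ) * ((ω : L2) : Torus → ℂ) p) n :=
  coeff_congr (memLp_sin_mul (ω : L2)).coeFn_toLp n

theorem crd_sinFun (ω : L20) (i : Freq) : crd (sinFun ω) i =
    (crd ω (i.shift (-1)) - crd ω (i.shift 1)) / (2 * Complex.I) := by
  rw [crd_eq_coeff, coeff_sinFun, Freq.pair, coeff_sin_mul, crd_eq_coeff, crd_eq_coeff]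
  rfl

theorem norm_sinFun_le (f : L20) : ‖sinFun f‖ ≤ ‖f‖ := by
  change ‖(memLp_sin_mul (f : L2)).toLp _‖ ≤ ‖(f : L2)‖
  refine Lp.norm_le_norm_of_ae_le ?_
  filter_upwards [(memLp_sin_mul (f : L2)).coeFn_toLp] with p hp
  rw [hp, norm_mul]
  exact mul_le_of_le_one_left (norm_nonneg _) (norm_sinCirc_le _)

/-- Multiplication by `sin y` as a bounded operator. -/
def sinOp : L20 →L[ℂ] L20 :=
  LinearMap.mkContinuous
    { toFun := sinFun
      map_add' := fun f g => crd_ext fun i => by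
        simp only [crd_add, crd_sinFun]
        ring
      map_smul' := fun a f => crd_ext fun i => by
        simp only [crd_smul, crd_sinFun, RingHom.id_apply]
        ring } 1 (fun f => by
        rw [one_mul]
        exact norm_sinFun_le f)

theorem norm_sinOp_le : ‖sinOp‖ ≤ 1 := LinearMap.mkContinuous_norm_le _ zero_le_one _

theorem crd_sinOp (ω : L20) (i : Freq) : crd (sinOp ω) i =
    (crd ω (i.shift (-1)) - crd ω (i.shift 1)) / (2 * Complex.I) := crd_sinFun ω i

theorem isDxSin_iff (ω h : L20) :
    IsDxSin ω h ↔ ∀ i : Freq, crd h i = Complex.I * i.1.1 * crd (sinOp ω) i := by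
  constructor
  · intro hh i
    have := hh.coeff_eq i.pair
    rw [pow_one, pow_zero, mul_one, ← coeff_sinFun, ← crd_eq_coeff, ← crd_eq_coeff] at this
    exact this
  · intro hh
    have h1 : HasWeakPartial 1 0 (sinFun ω : L2) (h : L2) := hasWeakPartial_of_crd fun i => by
      rw [pow_one, pow_zero, mul_one]
      exact hh i
    intro φ hφ
    rw [← h1 φ hφ]
    refine integral_congr_ae ?_
    filter_upwards [(memLp_sin_mul (ω : L2)).coeFn_toLp] with p hp
    have : (sinFun ω : L2) p = (sinCirc p.2 : ℂ) * ((ω : L2) : Torus → ℂ) p := hp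
    rw [this]

/-- The symbol `1 - 1 / (l² + j²)` of `I + Δ⁻¹`. -/
def Freq.wt (i : Freq) : ℝ := 1 - 1 / i.lam

theorem Freq.abs_wt_le (i : Freq) : |i.wt| ≤ 1 := by
  have h := i.one_le_lam
  have h1 : 1 / i.lam ≤ 1 := by rw [div_le_one (by linarith)]; exact h
  have h2 : 0 ≤ 1 / i.lam := by positivity
  rw [Freq.wt, abs_of_nonneg (by linarith)]
  linarith

/-- A diagonal operator in the Fourier basis of `L²₀(𝕋²)`. -/
def freqDiag (m : Freq → ℂ) (C : ℝ) (hm : ∀ i, ‖m i‖ ≤ C) : L20 →L[ℂ] L20 :=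
  (freqBasis.repr.symm.toContinuousLinearEquiv : _ →L[ℂ] L20).comp
    ((lpDiag m C hm).comp (freqBasis.repr.toContinuousLinearEquiv : L20 →L[ℂ] _))

theorem crd_freqDiag (m : Freq → ℂ) (C : ℝ) (hm : ∀ i, ‖m i‖ ≤ C) (ω : L20) (i : Freq) :
    crd (freqDiag m C hm ω) i = m i * crd ω i := by
  simp [crd, freqDiag]

theorem norm_freqDiag_le (m : Freq → ℂ) {C : ℝ} (hm : ∀ i, ‖m i‖ ≤ C) (hC : 0 ≤ C) :
    ‖freqDiag m C hm‖ ≤ C :=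
  ContinuousLinearMap.opNorm_le_bound _ hC fun x => norm_le_of_crd hC fun i => by
    rw [crd_freqDiag, norm_mul]
    exact mul_le_mul_of_nonneg_right (hm i) (norm_nonneg _)

/-- The operator `I + Δ⁻¹`. -/
def wtOp : L20 →L[ℂ] L20 := freqDiag (fun i => (i.wt : ℂ)) 1 fun i => by
  rw [Complex.norm_real]; exact i.abs_wt_le

theorem crd_wtOp (ω : L20) (i : Freq) : crd (wtOp ω) i = i.wt * crd ω i := crd_freqDiag _ _ _ _ _

/-- The operator `L_α` in Fourier coordinates. -/
theorem isLAlpha_iff (α : ℝ) (ω g : L20) : IsLAlpha α ω g ↔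
    ∃ a : L20, (∀ i, crd a i = -(i.lam : ℂ) * crd ω i) ∧
      ∀ i : Freq, crd g i = crd a i - α * (Complex.I * i.1.1) * crd (sinOp (wtOp ω)) i := by
  have hψ : ∀ ψ : L20, (∀ i, crd ω i = -(i.lam : ℂ) * crd ψ i) → ω + ψ = wtOp ω := by
    intro ψ hψ
    refine crd_ext fun i => ?_
    have hl : (i.lam : ℂ) ≠ 0 := by
      have := i.one_le_lam
      exact Complex.ofReal_ne_zero.2 (by linarith)
    rw [crd_add, crd_wtOp, Freq.wt, hψ i]
    push_cast
    field_simp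
    ring
  constructor
  · rintro ⟨a, b, ha, ⟨-, ψ, h, hψω, hh, rfl⟩, rfl⟩
    refine ⟨a, (isA_iff _ _).1 ha, fun i => ?_⟩
    rw [hψ ψ ((isA_iff _ _).1 hψω)] at hh
    rw [crd_sub, crd_smul, crd_smul, (isDxSin_iff _ _).1 hh i]
    linear_combination ((α : ℂ) * (Complex.I * i.1.1 * crd (sinOp (wtOp ω)) i)) * Complex.I_sq
  · rintro ⟨a, ha, hg⟩
    -- The domain of `A` lies in that of `Λ̂`: since `|l| ≤ l² + j²`, `∂ₓ v` exists in `L²₀`, and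
    -- `∂ₓ` commutes with multiplication by `sin y`.
    have hx : ∀ v : L20, (∀ i, ‖crd v i‖ ≤ ‖crd ω i‖) → ∃ h : L20, IsDxSin v h := by
      intro v hv
      obtain ⟨x, hx⟩ := exists_of_crd_le (c := fun i => Complex.I * i.1.1 * crd v i) (g := a)
        (C := 1) fun i => by
          have h1 := norm_deriv_symbol_le i (k := 1) (m := 0) (by norm_num)
          rw [pow_one, pow_zero, mul_one] at h1
          rw [ha i, norm_mul, norm_neg_lam_mul, one_mul]
          exact mul_le_mul h1 (hv i) (norm_nonneg _) (zero_le_one.trans i.one_le_lam)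
      refine ⟨sinOp x, (isDxSin_iff _ _).2 fun i => ?_⟩
      rw [crd_sinOp, crd_sinOp, hx, hx]
      simp only [Freq.shift]
      ring
    obtain ⟨ψ, hψ'⟩ := exists_of_crd_le (c := fun i => -(i.lam : ℂ)⁻¹ * crd ω i) (g := ω)
      (C := 1) fun i => by
        have h1 := i.one_le_lam
        rw [norm_mul, norm_neg, norm_inv, Complex.norm_real, Real.norm_of_nonneg (by linarith)]
        exact mul_le_mul_of_nonneg_right (inv_le_one_of_one_le₀ h1) (norm_nonneg _)
    have hAψ : ∀ i, crd ω i = -(i.lam : ℂ) * crd ψ i := fun i => by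
      have hl : (i.lam : ℂ) ≠ 0 := by
        have := i.one_le_lam
        exact Complex.ofReal_ne_zero.2 (by linarith)
      rw [hψ']
      field_simp
    obtain ⟨h, hh⟩ := hx (wtOp ω) fun i => by
      rw [crd_wtOp, norm_mul, Complex.norm_real]
      exact mul_le_of_le_one_left (norm_nonneg _) i.abs_wt_le
    refine ⟨a, (-Complex.I) • h, (isA_iff _ _).2 ha, ⟨hx ω fun _ => le_rfl, ψ, h,
      (isA_iff _ _).2 hAψ, ?_, rfl⟩, ?_⟩
    · rw [hψ ψ hAψ]; exact hh
    · refine crd_ext fun i => ?_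
      rw [crd_sub, crd_smul, crd_smul, (isDxSin_iff _ _).1 hh i, hg i]
      linear_combination (-(α : ℂ) * (Complex.I * i.1.1 * crd (sinOp (wtOp ω)) i)) * Complex.I_sq

end ZeroMean

end

section

/-! ### Generation of the semigroup -/

section Generation

instance instInnerL20 : Inner ℂ L20 := InnerProductSpace.toInner

theorem inner_smul_right_L20 (f g : L20) (c : ℂ) : ⟪f, c • g⟫_ℂ = c * ⟪f, g⟫_ℂ :=
  inner_smul_right f g c

theorem inner_eq_of_crd {f g f' g' : L20}
    (h : ∀ i, crd g i * (starRingEnd ℂ) (crd f i) = crd g' i * (starRingEnd ℂ) (crd f' i)) :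
    ⟪f, g⟫_ℂ = ⟪f', g'⟫_ℂ := by
  rw [← freqBasis.repr.inner_map_map f g, ← freqBasis.repr.inner_map_map f' g',
    lp.inner_eq_tsum, lp.inner_eq_tsum]
  refine tsum_congr fun i => ?_
  simp only [RCLike.inner_apply]
  exact h i

theorem inner_sinOp_left (f g : L20) : ⟪sinOp f, g⟫_ℂ = ⟪f, sinOp g⟫_ℂ := by
  change ⟪((sinFun f : L20) : L2), (g : L2)⟫_ℂ = ⟪(f : L2), ((sinFun g : L20) : L2)⟫_ℂ
  rw [L2.inner_def, L2.inner_def]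
  refine integral_congr_ae ?_
  filter_upwards [(memLp_sin_mul (f : L2)).coeFn_toLp, (memLp_sin_mul (g : L2)).coeFn_toLp]
    with p hf hg
  have hf' : (sinFun f : L2) p = (sinCirc p.2 : ℂ) * ((f : L2) : Torus → ℂ) p := hf
  have hg' : (sinFun g : L2) p = (sinCirc p.2 : ℂ) * ((g : L2) : Torus → ℂ) p := hg
  rw [hf', hg']
  simp only [RCLike.inner_apply, map_mul, Complex.conj_ofReal]
  ring

theorem Freq.abs_le_lam (i : Freq) : |(i.1.1 : ℝ)| ≤ i.lam := by
  have := norm_deriv_symbol_le i (k := 1) (m := 0) (by norm_num)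
  simpa [Freq.pair] using this

theorem exists_crd_of_le_lam {ω a : L20} (ha : ∀ i, crd a i = -(i.lam : ℂ) * crd ω i)
    {m : Freq → ℂ} (hm : ∀ i, ‖m i‖ ≤ i.lam) : ∃ x : L20, ∀ i, crd x i = m i * crd ω i :=
  exists_of_crd_le (g := a) (C := 1) fun i => by
    rw [ha i, norm_mul, norm_neg_lam_mul, one_mul]
    exact mul_le_mul_of_nonneg_right (hm i) (norm_nonneg _)

theorem exists_isLAlpha (α : ℝ) {ω a : L20} (ha : ∀ i, crd a i = -(i.lam : ℂ) * crd ω i) :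
    ∃ g, IsLAlpha α ω g := by
  obtain ⟨x, hx⟩ := exists_crd_of_le_lam ha (m := fun i => (i.1.1 : ℂ)) fun i => by
    simpa using i.abs_le_lam
  refine ⟨a - (α * Complex.I) • sinOp (wtOp x), (isLAlpha_iff _ _ _).2 ⟨a, ha, fun i => ?_⟩⟩
  rw [crd_sub, crd_smul, crd_sinOp, crd_sinOp]
  simp only [crd_wtOp, hx, Freq.shift]
  ring

/-- Finite combinations of characters belong to the domain of `A`, which is the domain of `L_α`. -/
theorem dense_domain (α : ℝ) : Dense {ω : L20 | ∃ g, IsLAlpha α ω g} := by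
  have h := freqBasis.dense_span
  rw [← Submodule.dense_iff_topologicalClosure_eq_top] at h
  refine h.mono fun ω hω => ?_
  have key : ∃ a : L20, ∀ i, crd a i = -(i.lam : ℂ) * crd ω i := by
    refine Submodule.span_induction (p := fun ω _ => ∃ a : L20, ∀ i, crd a i = -(i.lam : ℂ) * crd ω i)
      ?_ ?_ ?_ ?_ hω
    · rintro _ ⟨i, rfl⟩
      refine ⟨(-(i.lam : ℂ)) • freqBasis i, fun j => ?_⟩
      rw [crd_smul, crd, HilbertBasis.repr_self]
      by_cases hij : j = i
      · subst hij; rfl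
      · rw [lp.single_apply_ne _ _ _ hij, mul_zero, mul_zero]
    · exact ⟨0, fun i => by simp [crd]⟩
    · rintro f g _ _ ⟨a, ha⟩ ⟨b, hb⟩
      exact ⟨a + b, fun i => by rw [crd_add, crd_add, ha, hb]; ring⟩
    · rintro c f _ ⟨a, ha⟩
      exact ⟨c • a, fun i => by rw [crd_smul, crd_smul, ha]; ring⟩
  obtain ⟨a, ha⟩ := key
  exact exists_isLAlpha α ha

/-- `L_α - |α|` is dissipative. -/
theorem re_inner_le_of_isLAlpha {α : ℝ} {ω g : L20} (h : IsLAlpha α ω g) :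
    (⟪ω, g⟫_ℂ).re ≤ |α| * ‖ω‖ ^ 2 := by
  obtain ⟨a, ha, hg⟩ := (isLAlpha_iff _ _ _).1 h
  obtain ⟨x, hx⟩ := exists_crd_of_le_lam ha (m := fun i => (i.1.1 : ℂ)) fun i => by
    simpa using i.abs_le_lam
  obtain ⟨y, hy⟩ := exists_crd_of_le_lam ha (m := fun i => (Real.sqrt i.lam : ℂ)) fun i => by
    rw [Complex.norm_real, Real.norm_of_nonneg (Real.sqrt_nonneg _), Real.sqrt_le_left
      (by linarith [i.one_le_lam])]
    nlinarith [i.one_le_lam]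
  obtain ⟨z, hz⟩ := exists_of_crd_le (c := fun i => (i.lam : ℂ)⁻¹ * crd x i) (g := ω)
    (C := 1) fun i => by
      have h1 := i.one_le_lam
      rw [hx, ← mul_assoc, norm_mul, norm_mul, norm_inv, Complex.norm_real,
        Real.norm_of_nonneg (by linarith)]
      refine mul_le_mul_of_nonneg_right ?_ (norm_nonneg _)
      rw [inv_mul_le_iff₀ (by linarith), mul_one]
      simpa using i.abs_le_lam
  -- The transport term splits into the local part built from `x`, with symbol `l`, and the part
  -- coming from `Δ⁻¹`, built from `z`, with symbol `l / (l² + j²)` of modulus at most one. The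
  -- first is skew; the second is bounded and produces the constant `|α|`.
  have hgeq : g = a - (α * Complex.I) • sinOp x + (α * Complex.I) • sinOp z := by
    refine crd_ext fun i => ?_
    rw [hg, crd_add, crd_sub, crd_smul, crd_smul, crd_sinOp, crd_sinOp, crd_sinOp]
    simp only [crd_wtOp, hz, hx, Freq.shift, Freq.wt]
    push_cast
    ring
  have h1 : ⟪ω, a⟫_ℂ = -⟪y, y⟫_ℂ := by
    rw [← inner_neg_right]
    refine inner_eq_of_crd fun i => ?_
    have e : crd (-y) i = - crd y i := by simp [crd]
    have hs : (Real.sqrt i.lam : ℂ) * (Real.sqrt i.lam : ℂ) = (i.lam : ℂ) := by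
      rw [← Complex.ofReal_mul, Real.mul_self_sqrt (by linarith [i.one_le_lam])]
    rw [e, ha, hy, map_mul, Complex.conj_ofReal, ← hs]
    ring
  -- Multiplication by `sin y` is symmetric and acts only in `j`, while `l` is a real multiplier, so
  -- the product is symmetric and the inner product equals its own conjugate.
  have h2 : (⟪ω, sinOp x⟫_ℂ).im = 0 := by
    have e1 : ⟪sinOp ω, x⟫_ℂ = ⟪sinOp x, ω⟫_ℂ := by
      refine inner_eq_of_crd fun i => ?_
      have hl : (starRingEnd ℂ) (i.1.1 : ℂ) = (i.1.1 : ℂ) := map_intCast _ _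
      rw [crd_sinOp, crd_sinOp, hx, hx, hx]
      simp only [Freq.shift, map_div₀, map_sub, map_mul, hl]
      ring
    rw [← inner_sinOp_left, e1]
    have := congrArg Complex.im (inner_conj_symm (𝕜 := ℂ) ω (sinOp x))
    rw [Complex.conj_im, ← inner_sinOp_left, e1] at this
    linarith
  have h3 : |(⟪ω, (α * Complex.I) • sinOp z⟫_ℂ).re| ≤ |α| * ‖ω‖ ^ 2 := by
    refine (Complex.abs_re_le_norm _).trans ((norm_inner_le_norm _ _).trans ?_)
    rw [norm_smul, norm_mul, Complex.norm_real, Complex.norm_I, mul_one, Real.norm_eq_abs]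
    have hz' : ‖z‖ ≤ 1 * ‖ω‖ := norm_le_of_crd zero_le_one fun i => by
      have h1 := i.one_le_lam
      rw [hz, hx, ← mul_assoc, norm_mul, norm_mul, norm_inv, Complex.norm_real,
        Real.norm_of_nonneg (by linarith)]
      refine mul_le_mul_of_nonneg_right ?_ (norm_nonneg _)
      rw [inv_mul_le_iff₀ (by linarith), mul_one]
      simpa using i.abs_le_lam
    have hs : ‖sinOp z‖ ≤ ‖ω‖ := by
      have := sinOp.le_of_opNorm_le norm_sinOp_le z
      linarith
    have := mul_le_mul_of_nonneg_left hs (mul_nonneg (norm_nonneg ω) (abs_nonneg α))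
    nlinarith
  rw [hgeq, inner_add_right, inner_sub_right, h1, inner_smul_right_L20]
  have h4 : 0 ≤ (⟪y, y⟫_ℂ).re := inner_self_nonneg (𝕜 := ℂ) (x := y)
  have h5 : ((α : ℂ) * Complex.I * ⟪ω, sinOp x⟫_ℂ).re = 0 := by
    rw [mul_assoc, Complex.re_ofReal_mul, Complex.I_mul_re, h2, neg_zero, mul_zero]
  simp only [Complex.add_re, Complex.sub_re, Complex.neg_re, h5]
  have := le_abs_self (⟪ω, (α * Complex.I) • sinOp z⟫_ℂ).re
  linarith

theorem isLAlpha_sub {α : ℝ} {ω ω' g g' : L20} (h : IsLAlpha α ω g) (h' : IsLAlpha α ω' g') :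
    IsLAlpha α (ω - ω') (g - g') := by
  obtain ⟨a, ha, hg⟩ := (isLAlpha_iff _ _ _).1 h
  obtain ⟨a', ha', hg'⟩ := (isLAlpha_iff _ _ _).1 h'
  refine (isLAlpha_iff _ _ _).2 ⟨a - a', fun i => ?_, fun i => ?_⟩
  · rw [crd_sub, crd_sub, ha, ha']; ring
  · rw [crd_sub, crd_sub, map_sub, map_sub, crd_sub, hg, hg']; ring

/-- Solvability of the resolvent equation `(r - L_α) ω = f` for large `r`. -/
theorem exists_resolvent {α r : ℝ} (hr : α ^ 2 + 1 ≤ r) :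
    ∃ R : L20 →L[ℂ] L20, ∀ f, IsLAlpha α (R f) ((r : ℂ) • R f - f) := by
  have hpos : ∀ i : Freq, 0 < r + i.lam := fun i => by nlinarith [i.one_le_lam, sq_nonneg α]
  have hm : ∀ i : Freq, ‖(α * (Complex.I * i.1.1) * i.wt * ((r + i.lam : ℝ) : ℂ)⁻¹ : ℂ)‖ ≤ 1 / 2 := by
    intro i
    have hw := i.abs_wt_le
    rw [norm_mul, norm_mul, norm_mul, norm_mul, norm_inv, Complex.norm_real, Complex.norm_real,
      Complex.norm_real, Complex.norm_I, one_mul, Complex.norm_intCast, Real.norm_eq_abs,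
      Real.norm_eq_abs, Real.norm_of_nonneg (hpos i).le]
    -- From `2 |α| |l| ≤ α² + l²`; this is where the size required of `r` comes from.
    have h1 : |α| * |(i.1.1 : ℝ)| * |i.wt| ≤ (r + i.lam) / 2 := by
      have h2 : |α| * |(i.1.1 : ℝ)| * |i.wt| ≤ |α| * |(i.1.1 : ℝ)| :=
        mul_le_of_le_one_right (by positivity) hw
      have h3 := sq_nonneg (|α| - |(i.1.1 : ℝ)|)
      have h4 := sq_abs α
      have h5 := sq_abs (i.1.1 : ℝ)
      have h6 := sq_nonneg (i.2 : ℝ)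
      simp only [Freq.lam]
      nlinarith
    rw [← div_eq_mul_inv, div_le_iff₀ (hpos i)]
    linarith
  have hp : ∀ i : Freq, ‖(((r + i.lam : ℝ) : ℂ)⁻¹ : ℂ)‖ ≤ 1 := by
    intro i
    rw [norm_inv, Complex.norm_real, Real.norm_of_nonneg (hpos i).le]
    exact inv_le_one_of_one_le₀ (by nlinarith [i.one_le_lam, sq_nonneg α])
  -- Writing the unknown as `P v` with `P = (r - Δ)⁻¹` turns the resolvent equation into `(1 + N) v
  -- = f`, which a Neumann series solves since `‖N‖ ≤ 1/2`.
  set N : L20 →L[ℂ] L20 := sinOp.comp (freqDiag _ (1 / 2) hm) with hN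
  set P : L20 →L[ℂ] L20 := freqDiag _ 1 hp with hP
  have hNn : ‖-N‖ < 1 := by
    refine lt_of_eq_of_lt (norm_neg N) ?_
    refine lt_of_le_of_lt ((ContinuousLinearMap.opNorm_comp_le _ _).trans
      (mul_le_mul norm_sinOp_le (norm_freqDiag_le _ hm (by norm_num)) (ContinuousLinearMap.opNorm_nonneg _) zero_le_one)) ?_
    norm_num
  set U := Units.oneSub (-N) hNn with hU
  refine ⟨P.comp (↑U⁻¹ : L20 →L[ℂ] L20), fun f => ?_⟩
  set v : L20 := (↑U⁻¹ : L20 →L[ℂ] L20) f with hv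
  have hvf : v + N v = f := by
    have h1 : ((U : L20 →L[ℂ] L20) * (↑U⁻¹ : L20 →L[ℂ] L20)) f = f := by
      rw [Units.mul_inv]; rfl
    have h2 : (U : L20 →L[ℂ] L20) = 1 - -N := rfl
    rw [h2] at h1
    have h3 : v - -N v = f := h1
    rwa [sub_neg_eq_add] at h3
  change IsLAlpha α (P v) ((r : ℂ) • P v - f)
  have hPv : ∀ i, crd (P v) i = ((r + i.lam : ℝ) : ℂ)⁻¹ * crd v i := fun i => crd_freqDiag _ _ _ _ _
  obtain ⟨a, ha⟩ := exists_of_crd_le (c := fun i => -(i.lam : ℂ) * crd (P v) i) (g := v)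
    (C := 1) fun i => by
      rw [norm_neg_lam_mul, hPv, norm_mul, norm_inv, Complex.norm_real,
        Real.norm_of_nonneg (hpos i).le, ← mul_assoc]
      refine mul_le_mul_of_nonneg_right ?_ (norm_nonneg _)
      rw [← div_eq_mul_inv, div_le_one (hpos i)]
      nlinarith [sq_nonneg α]
  refine (isLAlpha_iff _ _ _).2 ⟨a, ha, fun i => ?_⟩
  have hne : ((r + i.lam : ℝ) : ℂ) ≠ 0 := Complex.ofReal_ne_zero.2 (hpos i).ne'
  have e1 : crd (N v) i = α * (Complex.I * i.1.1) * crd (sinOp (wtOp (P v))) i := by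
    rw [hN, ContinuousLinearMap.comp_apply, crd_sinOp, crd_sinOp, crd_freqDiag, crd_freqDiag,
      crd_wtOp, crd_wtOp, hPv, hPv]
    simp only [Freq.shift]
    ring
  have e3 : crd v i = ((r + i.lam : ℝ) : ℂ) * crd (P v) i := by
    rw [hPv, mul_inv_cancel_left₀ hne]
  rw [crd_sub, ← hvf, crd_add, e1, crd_smul, ha, e3]
  push_cast
  ring

/-- Hille–Yosida is applied to `L_α - μ`. The summand `|α|` of `μ` makes the shifted operator
dissipative, and `α²` makes its resolvent equation solvable at every positive integer. Dissipativity
gives both the resolvent bound and the uniqueness behind the left-inverse property. The shift is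
then undone by an exponential factor. -/
theorem exists_semigroup (α : ℝ) :
    ∃ S : ℝ → L20 →L[ℂ] L20, IsSemigroupGeneratedBy S (IsLAlpha α) := by
  set μ : ℝ := α ^ 2 + |α| with hμ
  have hr : ∀ n : ℕ, α ^ 2 + 1 ≤ (n : ℝ) + 1 + μ := fun n => by
    have := abs_nonneg α
    have : (0 : ℝ) ≤ n := n.cast_nonneg
    linarith
  choose R hR using fun n : ℕ => exists_resolvent (hr n)
  have hdis : ∀ (n : ℕ) (ω f : L20), IsLAlpha α ω ((((n : ℝ) + 1 + μ : ℝ) : ℂ) • ω - f) →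
      ((n : ℝ) + 1) * ‖ω‖ ≤ ‖f‖ := by
    intro n ω f h
    have h1 := re_inner_le_of_isLAlpha h
    rw [inner_sub_right, Complex.sub_re, inner_smul_right_L20,
      Complex.re_ofReal_mul] at h1
    have h2 : (⟪ω, ω⟫_ℂ).re = ‖ω‖ ^ 2 := inner_self_eq_norm_sq (𝕜 := ℂ) ω
    have h3 : (⟪ω, f⟫_ℂ).re ≤ ‖ω‖ * ‖f‖ := (Complex.re_le_norm _).trans (norm_inner_le_norm _ _)
    rw [h2] at h1
    rcases eq_or_lt_of_le (norm_nonneg ω) with h0 | h0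
    · rw [← h0, mul_zero]; exact norm_nonneg _
    · have h4 : ((n : ℝ) + 1) * ‖ω‖ ^ 2 ≤ ‖ω‖ * ‖f‖ := by
        nlinarith [mul_nonneg (sq_nonneg α) (sq_nonneg ‖ω‖)]
      have h5 : ‖ω‖ * (((n : ℝ) + 1) * ‖ω‖) ≤ ‖ω‖ * ‖f‖ := by nlinarith
      exact le_of_mul_le_mul_left h5 h0
  have hG : ∀ n f, IsLAlpha α (R n f) (((((n : ℝ) + 1 : ℝ) : ℂ) • R n f - f) + (μ : ℂ) • R n f) := by
    intro n f
    have := hR n f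
    rwa [Complex.ofReal_add _ μ, add_smul, add_sub_right_comm] at this
  obtain ⟨S, hS⟩ := exists_semigroup_of_resolvent (G := fun f g : L20 => IsLAlpha α f (g + (μ : ℂ) • f))
    (R := R) (fun n => by
      have hb : ‖R n‖ ≤ 1 / ((n : ℝ) + 1) :=
        ContinuousLinearMap.opNorm_le_bound _ (by positivity) fun f => by
          rw [div_mul_eq_mul_div, one_mul, le_div_iff₀ (by positivity), mul_comm]
          exact hdis n _ _ (hR n f)
      rw [le_div_iff₀ (by positivity)] at hb
      linarith) hG (fun n f g hfg => by
      have h1 := isLAlpha_sub hfg (hG n ((((n : ℝ) + 1 : ℝ) : ℂ) • f - g))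
      set u := R n ((((n : ℝ) + 1 : ℝ) : ℂ) • f - g)
      have h2 := hdis n (f - u) 0 (by
        convert h1 using 1
        rw [Complex.ofReal_add _ μ]
        module)
      rw [norm_zero] at h2
      have h3 : ‖f - u‖ ≤ 0 := by
        by_contra hcon
        push Not at hcon
        have : (0 : ℝ) ≤ n := n.cast_nonneg
        nlinarith
      exact (sub_eq_zero.1 (norm_le_zero_iff.1 h3)).symm) (by
      refine (dense_domain α).mono ?_
      rintro f ⟨g, hg⟩
      exact ⟨g - (μ : ℂ) • f, by rwa [sub_add_cancel]⟩)
  exact ⟨_, hS.exp_smul μ fun f g => by rw [sub_add_cancel]⟩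

end Generation

end

section

/-! ### Energy identities for the linearised operator on one Fourier mode -/

/-- Multiplication by `sin y`, `cos y` and `i`, together with the relation `D x x'` expressing that
`x'` is the derivative of `x`, on a real Hilbert space of functions of `y`. -/
structure TrigCalculus (V : Type*) [NormedAddCommGroup V] [InnerProductSpace ℝ V] where
  s : V →L[ℝ] V
  c : V →L[ℝ] V
  J : V →L[ℝ] V
  D : V → V → Prop
  s_symm : ∀ x y, ⟪s x, y⟫_ℝ = ⟪x, s y⟫_ℝ
  c_symm : ∀ x y, ⟪c x, y⟫_ℝ = ⟪x, c y⟫_ℝ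
  J_skew : ∀ x y, ⟪J x, y⟫_ℝ = -⟪x, J y⟫_ℝ
  J_J : ∀ x, J (J x) = -x
  c_s : ∀ x, c (s x) = s (c x)
  s_J : ∀ x, s (J x) = J (s x)
  c_J : ∀ x, c (J x) = J (c x)
  sq_add_sq : ∀ x, s (s x) + c (c x) = x
  D_skew : ∀ {x x' y y'}, D x x' → D y y' → ⟪x', y⟫_ℝ = -⟪x, y'⟫_ℝ
  D_s : ∀ {x x'}, D x x' → D (s x) (c x + s x')
  D_c : ∀ {x x'}, D x x' → D (c x) (c x' - s x)
  D_J : ∀ {x x'}, D x x' → D (J x) (J x')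

namespace TrigCalculus

variable {V : Type*} [NormedAddCommGroup V] [InnerProductSpace ℝ V] (T : TrigCalculus V)

theorem inner_J_s_self (x : V) : ⟪T.J (T.s x), x⟫_ℝ = 0 := by
  have h := T.J_skew (T.s x) x
  rw [T.s_symm, T.s_J, real_inner_comm (T.J (T.s x)) x] at h
  linarith

theorem inner_J_J (x y : V) : ⟪T.J x, T.J y⟫_ℝ = ⟪x, y⟫_ℝ := by
  rw [T.J_skew, T.J_J, inner_neg_right, neg_neg]

theorem inner_c_s (x y : V) : ⟪T.c x, T.s y⟫_ℝ = ⟪T.s x, T.c y⟫_ℝ := by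
  rw [T.c_symm, T.c_s, ← T.s_symm]

theorem norm_sq_eq (x : V) : ‖T.s x‖ ^ 2 + ‖T.c x‖ ^ 2 = ‖x‖ ^ 2 := by
  rw [← real_inner_self_eq_norm_sq, ← real_inner_self_eq_norm_sq, ← real_inner_self_eq_norm_sq,
    T.s_symm, T.c_symm, ← inner_add_right, T.sq_add_sq]

theorem norm_s_le (x : V) : ‖T.s x‖ ≤ ‖x‖ := by
  have h := T.norm_sq_eq x
  nlinarith [norm_nonneg x, norm_nonneg (T.s x), sq_nonneg ‖T.c x‖]

theorem norm_c_le (x : V) : ‖T.c x‖ ≤ ‖x‖ := by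
  have h := T.norm_sq_eq x
  nlinarith [norm_nonneg x, norm_nonneg (T.c x), sq_nonneg ‖T.s x‖]

theorem norm_J (x : V) : ‖T.J x‖ = ‖x‖ := by
  have h := T.inner_J_J x x
  rw [real_inner_self_eq_norm_sq, real_inner_self_eq_norm_sq] at h
  nlinarith [norm_nonneg x, norm_nonneg (T.J x)]

/-- Integration by parts with weight `sin y cos y`, whose derivative is `cos² y - sin² y`. -/
theorem two_inner_s_c {x x' : V} (hx : T.D x x') :
    2 * ⟪T.s x, T.c x'⟫_ℝ = ‖T.s x‖ ^ 2 - ‖T.c x‖ ^ 2 := by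
  have h := T.D_skew (T.D_c (T.D_s hx)) hx
  rw [inner_sub_left, map_add, inner_add_left, T.c_symm (T.c x), T.s_symm (T.s x),
    T.c_symm (T.s x'), T.c_symm (T.s x), real_inner_self_eq_norm_sq, real_inner_self_eq_norm_sq,
    ← T.inner_c_s, real_inner_comm] at h
  linarith

end TrigCalculus

/-- A function `u` of `y`, its stream functions `h = (m² - ∂²)⁻¹ (sin y · u)` and
`ψ = (m² - 1 - ∂²)⁻¹ u`, and their derivatives. -/
structure ModeFrame {V : Type*} [NormedAddCommGroup V] [InnerProductSpace ℝ V]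
    (T : TrigCalculus V) (m : ℝ) where
  u : V
  u₁ : V
  u₂ : V
  h : V
  h₁ : V
  h₂ : V
  ψ : V
  ψ₁ : V
  ψ₂ : V
  Du : T.D u u₁
  Du₁ : T.D u₁ u₂
  Dh : T.D h h₁
  Dh₁ : T.D h₁ h₂
  Dψ : T.D ψ ψ₁
  Dψ₁ : T.D ψ₁ ψ₂
  eq_h : m ^ 2 • h - h₂ = T.s u
  eq_ψ : m ^ 2 • ψ - ψ₂ - ψ = u
  one_le : 1 ≤ m
  coercive : m ^ 2 * ‖ψ‖ ^ 2 + ‖ψ₁‖ ^ 2 ≤ 2 * ⟪ψ, u⟫_ℝ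
  inner_ψ_le : ⟪ψ, u⟫_ℝ ≤ ‖u‖ ^ 2

namespace ModeFrame

variable {V : Type*} [NormedAddCommGroup V] [InnerProductSpace ℝ V] {T : TrigCalculus V} {m : ℝ}
  (f : ModeFrame T m)

/-- `(m² - ∂²) u`. -/
def y : V := m ^ 2 • f.u - f.u₂

/-- The right-hand side `-(m² - ∂²) u - i β (sin y · u - h)` of the evolution equation. -/
def rhs (β : ℝ) : V := -f.y - β • T.J (T.s f.u - f.h)

def g : V := T.c f.u - f.h₁

/-- This is `⟪u, u + ψ⟫`, where `u + ψ` is the vorticity with its kernel component removed. -/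
def E : ℝ := ‖f.u‖ ^ 2 + ⟪f.ψ, f.u⟫_ℝ

def Δ : ℝ := ‖f.u₁‖ ^ 2 + m ^ 2 * ‖f.u‖ ^ 2

def X : ℝ := ⟪T.J (T.c f.u), f.u₁⟫_ℝ

/-- The dissipation that transport extracts from the mixed term `X`. Without `h` it would be `‖cos y
· u‖²`, which degenerates at the critical points of the shear. -/
def Γ : ℝ := ‖f.g‖ ^ 2 + m ^ 2 * ‖f.h‖ ^ 2

/-- This equals `E - ⟪sin y · u, sin y · u - h⟫`, a difference of two invariants of the transport
part, so its time derivative has no contribution proportional to `β`. -/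
def F : ℝ := ‖T.c f.u‖ ^ 2 + ⟪f.ψ, f.u⟫_ℝ + ⟪f.h, T.s f.u⟫_ℝ

theorem h₂_eq : f.h₂ = m ^ 2 • f.h - T.s f.u := by
  rw [← f.eq_h]; abel

theorem ψ₂_eq : f.ψ₂ = m ^ 2 • f.ψ - f.ψ - f.u := by
  rw [← f.eq_ψ]; abel

theorem inner_y_u : ⟪f.y, f.u⟫_ℝ = f.Δ := by
  have h := T.D_skew f.Du₁ f.Du
  rw [y, inner_sub_left, inner_smul_left, h, Δ, real_inner_self_eq_norm_sq,
    real_inner_self_eq_norm_sq]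
  simp only [conj_trivial]
  ring

theorem inner_y_ψ : ⟪f.y, f.ψ⟫_ℝ = f.E := by
  have h1 := T.D_skew f.Du₁ f.Dψ
  have h2 := T.D_skew f.Du f.Dψ₁
  rw [y, inner_sub_left, inner_smul_left, h1, h2, E, f.ψ₂_eq, inner_sub_right, inner_sub_right,
    inner_smul_right, real_inner_self_eq_norm_sq, real_inner_comm]
  simp only [conj_trivial]
  ring

theorem inner_J_s_u (x x₁ x₂ : V) (hx : T.D x x₁) (hx₁ : T.D x₁ x₂) :
    ⟪T.J (T.s f.u), x⟫_ℝ = ⟪T.J f.h, m ^ 2 • x - x₂⟫_ℝ := by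
  have h1 := T.D_skew (T.D_J f.Dh₁) hx
  have h2 := T.D_skew (T.D_J f.Dh) hx₁
  rw [f.h₂_eq, map_sub, map_smul, inner_sub_left, inner_smul_left] at h1
  rw [inner_sub_right, inner_smul_right]
  simp only [conj_trivial] at h1
  linarith

/-- Moving `m² - ∂²` from `h` onto `ψ` turns `⟪J (sin y · u), ψ⟫` into `⟪J h, u + ψ⟫`, which cancels
the remaining term; `⟪J (sin y · u), u⟫` vanishes by skewness. -/
theorem inner_J_u_add_ψ : ⟪T.J (T.s f.u - f.h), f.u + f.ψ⟫_ℝ = 0 := by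
  have h1 := f.inner_J_s_u _ _ _ f.Dψ f.Dψ₁
  have h2 := T.inner_J_s_self f.u
  have e : m ^ 2 • f.ψ - f.ψ₂ = f.u + f.ψ := by rw [f.ψ₂_eq]; abel
  rw [e] at h1
  rw [map_sub, inner_sub_left, inner_add_right (T.J (T.s f.u)), h1, h2]
  ring

theorem inner_rhs_E (β : ℝ) : ⟪f.rhs β, f.u + f.ψ⟫_ℝ = -f.Δ - f.E := by
  rw [rhs, inner_sub_left, inner_smul_left, f.inner_J_u_add_ψ, inner_neg_left, inner_add_right,
    f.inner_y_u, f.inner_y_ψ]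
  simp only [conj_trivial]
  ring

theorem inner_J_s_y : ⟪T.J (T.s f.u), f.y⟫_ℝ = f.X := by
  have h1 := T.D_skew (T.D_J (T.D_s f.Du)) f.Du₁
  have h2 := T.inner_J_s_self f.u₁
  have h3 := T.inner_J_s_self f.u
  rw [map_add, inner_add_left, h2] at h1
  rw [y, inner_sub_right, inner_smul_right, h3, X]
  linarith

theorem inner_J_h_y : ⟪T.J f.h, f.y⟫_ℝ = 0 := by
  have h1 := f.inner_J_s_u _ _ _ f.Du f.Du₁
  rw [T.inner_J_s_self] at h1
  exact h1.symm

theorem inner_rhs_y (β : ℝ) : ⟪f.rhs β, f.y⟫_ℝ = -‖f.y‖ ^ 2 - β * f.X := by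
  rw [rhs, inner_sub_left, inner_smul_left, map_sub, inner_sub_left (T.J (T.s f.u)),
    f.inner_J_s_y, f.inner_J_h_y, inner_neg_left, real_inner_self_eq_norm_sq]
  simp only [conj_trivial]
  ring

theorem inner_h_s_u : ⟪f.h, T.s f.u⟫_ℝ = m ^ 2 * ‖f.h‖ ^ 2 + ‖f.h₁‖ ^ 2 := by
  have h1 := T.D_skew f.Dh₁ f.Dh
  rw [f.h₂_eq, inner_sub_left, inner_smul_left, real_inner_self_eq_norm_sq,
    real_inner_self_eq_norm_sq, real_inner_comm] at h1
  simp only [conj_trivial] at h1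
  linarith

theorem inner_h_c_u₁ : ⟪f.h, T.c f.u₁⟫_ℝ = ⟪f.h, T.s f.u⟫_ℝ - ⟪f.h₁, T.c f.u⟫_ℝ := by
  have h1 := T.D_skew (T.D_c f.Dh) f.Du
  rw [inner_sub_left, T.c_symm, T.s_symm, T.c_symm] at h1
  linarith

theorem Γ_eq : f.Γ = ‖T.c f.u‖ ^ 2 - 2 * ⟪f.h₁, T.c f.u⟫_ℝ + ⟪f.h, T.s f.u⟫_ℝ := by
  rw [Γ, g, norm_sub_sq_real, f.inner_h_s_u, real_inner_comm]
  ring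

/-- The vector paired with the right-hand side is the gradient of the quadratic form `X`. Its
pairing with the transport part is exactly `Γ`, which explains the definition of `Γ`. -/
theorem inner_rhs_X (β : ℝ) : ⟪f.rhs β, T.J (T.s f.u - (2 : ℝ) • T.c f.u₁)⟫_ℝ
    = -f.X + 2 * ⟪f.y, T.J (T.c f.u₁)⟫_ℝ - β * f.Γ := by
  have h1 : ⟪T.J (T.s f.u - f.h), T.J (T.s f.u - (2 : ℝ) • T.c f.u₁)⟫_ℝ = f.Γ := by
    rw [T.inner_J_J, inner_sub_right, inner_sub_left, inner_smul_right, inner_sub_left,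
      real_inner_self_eq_norm_sq, f.inner_h_c_u₁, f.Γ_eq]
    have := T.two_inner_s_c f.Du
    linarith
  have h2 : ⟪f.y, T.J (T.s f.u)⟫_ℝ = f.X := by rw [real_inner_comm, f.inner_J_s_y]
  rw [rhs, inner_sub_left, inner_smul_left, h1, inner_neg_left, map_sub, map_smul, inner_sub_right,
    inner_smul_right, h2]
  simp only [conj_trivial]
  ring

/-- The vector `u + ψ - s (s u - h)` is half the gradient of `F`. Transport is orthogonal to `u + ψ`
by the energy identity and to `s (s u - h)` by skewness of `J s`, so `β` drops out and only
diffusion is computed. -/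
theorem inner_rhs_F (β : ℝ) : ⟪f.rhs β, f.u + f.ψ - T.s (T.s f.u - f.h)⟫_ℝ
    = -(‖T.c f.u₁‖ ^ 2 + m ^ 2 * ‖T.c f.u‖ ^ 2) - f.E - ‖T.c f.u‖ ^ 2 + ⟪f.h, T.s f.u⟫_ℝ
      - 2 * ⟪f.h, T.c f.u₁⟫_ℝ := by
  have h0 : ⟪T.J (T.s f.u - f.h), T.s (T.s f.u - f.h)⟫_ℝ = 0 := by
    rw [← T.s_symm, T.s_J, T.inner_J_s_self]
  have h1 : ⟪f.y, T.s (T.s f.u)⟫_ℝ = m ^ 2 * ‖T.s f.u‖ ^ 2 + ‖T.s f.u‖ ^ 2 - ‖T.c f.u‖ ^ 2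
      + ‖T.s f.u₁‖ ^ 2 := by
    have e1 := T.D_skew f.Du₁ (T.D_s (T.D_s f.Du))
    have e2 := T.two_inner_s_c f.Du
    rw [map_add, inner_add_right, inner_add_right, ← T.s_symm f.u₁ (T.c f.u),
      ← T.s_symm f.u₁ (T.s f.u₁), real_inner_self_eq_norm_sq, ← T.c_symm f.u₁ (T.s f.u),
      ← T.inner_c_s, real_inner_comm (T.s f.u) (T.c f.u₁)] at e1
    rw [y, inner_sub_left, inner_smul_left, e1, ← T.s_symm f.u, real_inner_self_eq_norm_sq]
    simp only [conj_trivial]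
    linarith
  have h2 : ⟪f.y, T.s f.h⟫_ℝ = ‖T.s f.u‖ ^ 2 + 2 * ⟪f.h, T.c f.u₁⟫_ℝ - ⟪f.h, T.s f.u⟫_ℝ := by
    have e1 := T.D_skew f.Du₁ (T.D_s f.Dh)
    have e2 := T.D_skew (T.D_s f.Du) f.Dh₁
    have e3 := f.inner_h_c_u₁
    rw [inner_add_right, ← T.s_symm f.u₁, ← T.c_symm f.u₁] at e1
    rw [inner_add_left, f.h₂_eq, inner_sub_right, inner_smul_right, real_inner_self_eq_norm_sq,
      real_inner_comm f.h (T.s f.u), real_inner_comm f.h₁ (T.c f.u)] at e2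
    rw [y, inner_sub_left, inner_smul_left, e1, ← T.s_symm f.u, real_inner_comm f.h (T.s f.u),
      real_inner_comm f.h (T.c f.u₁)]
    simp only [conj_trivial]
    linarith
  have h3 := f.inner_rhs_E β
  have h4 : ⟪f.rhs β, T.s (T.s f.u - f.h)⟫_ℝ = -(⟪f.y, T.s (T.s f.u)⟫_ℝ - ⟪f.y, T.s f.h⟫_ℝ) := by
    rw [rhs, inner_sub_left, inner_smul_left, h0, inner_neg_left, map_sub, inner_sub_right]
    simp only [conj_trivial]
    ring
  rw [inner_sub_right, h3, h4, h1, h2, Δ, ← T.norm_sq_eq f.u, ← T.norm_sq_eq f.u₁]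
  ring

/-- Rewrites the mixed term through `g` and `h`, the two quantities measured by `Γ`, so that
Cauchy–Schwarz bounds it by `√Γ √Δ`. -/
theorem X_eq : f.X = ⟪T.J f.g, f.u₁⟫_ℝ - m ^ 2 * ⟪T.J f.h, f.u⟫_ℝ := by
  have h1 := T.D_skew (T.D_J f.Dh₁) f.Du
  rw [f.h₂_eq, map_sub, map_smul, inner_sub_left, inner_smul_left, T.inner_J_s_self] at h1
  simp only [conj_trivial] at h1
  rw [X, g, map_sub, inner_sub_left]
  linarith

/-- Integration by parts expresses `‖u‖²` as a sum of products, each with one factor controlled by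
`√Γ` and the other by `√Δ`. It comes from expanding `‖sin y · u‖²` through the equation for `h` and
subtracting `⟪sin y · u, cos y · u'⟫`. -/
theorem half_norm_sq_eq : ‖f.u‖ ^ 2 / 2 = m ^ 2 * ⟪f.h, T.s f.u⟫_ℝ - ⟪T.s f.u₁, f.g⟫_ℝ
    + (⟪f.h, T.s f.u⟫_ℝ - ⟪f.h, T.c f.u₁⟫_ℝ) := by
  have e1 := T.D_skew (T.D_s f.Du) f.Dh₁
  have e2 := T.two_inner_s_c f.Du
  have e3 := f.inner_h_c_u₁
  have e4 : ⟪T.s f.u₁, f.g⟫_ℝ = ⟪T.s f.u, T.c f.u₁⟫_ℝ - ⟪T.s f.u₁, f.h₁⟫_ℝ := by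
    rw [g, inner_sub_right, ← T.inner_c_s, real_inner_comm]
  rw [inner_add_left, f.h₂_eq, inner_sub_right, inner_smul_right, real_inner_self_eq_norm_sq,
    real_inner_comm f.h (T.s f.u), real_inner_comm f.h₁ (T.c f.u)] at e1
  have e5 := T.norm_sq_eq f.u
  linarith

/-! ### Interpolation, and comparison of `F` with `Γ` -/

theorem Δ_nonneg : 0 ≤ f.Δ := by rw [Δ]; positivity

theorem Γ_nonneg : 0 ≤ f.Γ := by rw [Γ]; positivity

theorem u₁_le : ‖f.u₁‖ ≤ √f.Δ := Real.le_sqrt_of_sq_le (by rw [Δ]; nlinarith [sq_nonneg (m * ‖f.u‖)])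

theorem mu_le : m * ‖f.u‖ ≤ √f.Δ :=
  Real.le_sqrt_of_sq_le (by rw [Δ, mul_pow]; nlinarith [sq_nonneg ‖f.u₁‖])

theorem g_le : ‖f.g‖ ≤ √f.Γ := Real.le_sqrt_of_sq_le (by rw [Γ]; nlinarith [sq_nonneg (m * ‖f.h‖)])

theorem mh_le : m * ‖f.h‖ ≤ √f.Γ :=
  Real.le_sqrt_of_sq_le (by rw [Γ, mul_pow]; nlinarith [sq_nonneg ‖f.g‖])

theorem h_le : ‖f.h‖ ≤ √f.Γ := by
  have := f.mh_le
  nlinarith [f.one_le, norm_nonneg f.h]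

theorem abs_X_le : |f.X| ≤ √f.Γ * √f.Δ := by
  have h1 : |⟪T.J f.g, f.u₁⟫_ℝ| ≤ ‖f.g‖ * ‖f.u₁‖ := by
    rw [← T.norm_J f.g]; exact abs_real_inner_le_norm _ _
  have h2 : |⟪T.J f.h, f.u⟫_ℝ| ≤ ‖f.h‖ * ‖f.u‖ := by
    rw [← T.norm_J f.h]; exact abs_real_inner_le_norm _ _
  have h3 : |f.X| ≤ ‖f.g‖ * ‖f.u₁‖ + (m * ‖f.h‖) * (m * ‖f.u‖) := by
    rw [f.X_eq]
    refine (abs_sub _ _).trans ?_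
    rw [abs_mul, abs_of_nonneg (sq_nonneg m)]
    nlinarith [mul_le_mul_of_nonneg_left h2 (sq_nonneg m)]
  refine h3.trans ?_
  rw [← Real.sqrt_mul f.Γ_nonneg]
  refine Real.le_sqrt_of_sq_le ?_
  rw [Γ, Δ]
  nlinarith [sq_nonneg (‖f.g‖ * (m * ‖f.u‖) - (m * ‖f.h‖) * ‖f.u₁‖)]

theorem norm_sq_le : ‖f.u‖ ^ 2 ≤ 8 * (√f.Γ * √f.Δ) := by
  have h0 := f.half_norm_sq_eq
  have hm := f.one_le
  have h1 : ⟪f.h, T.s f.u⟫_ℝ ≤ ‖f.h‖ * ‖f.u‖ :=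
    (real_inner_le_norm _ _).trans (mul_le_mul_of_nonneg_left (T.norm_s_le _) (norm_nonneg _))
  have h2 : -⟪T.s f.u₁, f.g⟫_ℝ ≤ ‖f.u₁‖ * ‖f.g‖ :=
    (neg_le_abs _).trans ((abs_real_inner_le_norm _ _).trans
      (mul_le_mul_of_nonneg_right (T.norm_s_le _) (norm_nonneg _)))
  have h3 : -⟪f.h, T.c f.u₁⟫_ℝ ≤ ‖f.h‖ * ‖f.u₁‖ :=
    (neg_le_abs _).trans ((abs_real_inner_le_norm _ _).trans
      (mul_le_mul_of_nonneg_left (T.norm_c_le _) (norm_nonneg _)))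
  have a1 : (m * ‖f.h‖) * (m * ‖f.u‖) ≤ √f.Γ * √f.Δ :=
    mul_le_mul f.mh_le f.mu_le (by positivity) (Real.sqrt_nonneg _)
  have a2 : ‖f.g‖ * ‖f.u₁‖ ≤ √f.Γ * √f.Δ :=
    mul_le_mul f.g_le f.u₁_le (by positivity) (Real.sqrt_nonneg _)
  have a3 : ‖f.h‖ * ‖f.u₁‖ ≤ √f.Γ * √f.Δ :=
    mul_le_mul f.h_le f.u₁_le (by positivity) (Real.sqrt_nonneg _)
  have a4 : ‖f.h‖ * ‖f.u‖ ≤ √f.Γ * √f.Δ := by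
    refine mul_le_mul f.h_le ?_ (by positivity) (Real.sqrt_nonneg _)
    nlinarith [f.mu_le, norm_nonneg f.u]
  have a5 : m ^ 2 * ⟪f.h, T.s f.u⟫_ℝ ≤ (m * ‖f.h‖) * (m * ‖f.u‖) := by
    nlinarith [mul_le_mul_of_nonneg_left h1 (sq_nonneg m)]
  linarith

theorem norm_h_le : ‖f.h‖ ≤ ‖f.u‖ := by
  have h1 : ⟪f.h, T.s f.u⟫_ℝ ≤ ‖f.h‖ * ‖f.u‖ :=
    (real_inner_le_norm _ _).trans (mul_le_mul_of_nonneg_left (T.norm_s_le _) (norm_nonneg _))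
  have h2 := f.inner_h_s_u
  have hm := f.one_le
  by_contra hcon
  push Not at hcon
  have h3 : ‖f.h‖ ^ 2 ≤ m ^ 2 * ‖f.h‖ ^ 2 := le_mul_of_one_le_left (by positivity) (by nlinarith)
  nlinarith [sq_nonneg ‖f.h₁‖, norm_nonneg f.u, norm_nonneg f.h]

theorem inner_h_s_u_le : ⟪f.h, T.s f.u⟫_ℝ ≤ ‖f.u‖ ^ 2 := by
  have h1 : ⟪f.h, T.s f.u⟫_ℝ ≤ ‖f.h‖ * ‖f.u‖ :=
    (real_inner_le_norm _ _).trans (mul_le_mul_of_nonneg_left (T.norm_s_le _) (norm_nonneg _))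
  nlinarith [f.norm_h_le, norm_nonneg f.u]

theorem inner_ψ_nonneg : 0 ≤ ⟪f.ψ, f.u⟫_ℝ := by
  have := f.coercive
  have : 0 ≤ m ^ 2 * ‖f.ψ‖ ^ 2 + ‖f.ψ₁‖ ^ 2 := by positivity
  linarith

theorem norm_sq_le_E : ‖f.u‖ ^ 2 ≤ f.E := by
  have := f.inner_ψ_nonneg
  rw [E]; linarith

theorem E_le : f.E ≤ 2 * ‖f.u‖ ^ 2 := by
  have := f.inner_ψ_le
  rw [E]; linarith

/-- The term `⟪h, s u⟫` is at most `‖u‖² ≤ E` and is absorbed there. The cross term with `c u₁`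
costs half of the dissipation `2 ‖c u₁‖²` and `4 ‖h‖² ≤ 4 Γ`. -/
theorem inner_rhs_F_le (β : ℝ) : 2 * ⟪f.rhs β, f.u + f.ψ - T.s (T.s f.u - f.h)⟫_ℝ
    ≤ -‖T.c f.u₁‖ ^ 2 + 4 * f.Γ := by
  rw [f.inner_rhs_F]
  have h1 := f.norm_sq_le_E
  have h2 := f.inner_h_s_u_le
  have h3 : -⟪f.h, T.c f.u₁⟫_ℝ ≤ ‖f.h‖ * ‖T.c f.u₁‖ :=
    (neg_le_abs _).trans (abs_real_inner_le_norm _ _)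
  have h4 : ‖f.h‖ ^ 2 ≤ f.Γ := by
    have := f.h_le
    calc ‖f.h‖ ^ 2 ≤ √f.Γ ^ 2 := pow_le_pow_left₀ (norm_nonneg _) this 2
      _ = f.Γ := Real.sq_sqrt f.Γ_nonneg
  have h5 : 0 ≤ m ^ 2 * ‖T.c f.u‖ ^ 2 := by positivity
  nlinarith [sq_nonneg (‖T.c f.u₁‖ - 2 * ‖f.h‖), sq_nonneg ‖T.c f.u‖]

/-- Since `⟪h, s u⟫ ≥ ‖h₁‖²`, the difference `2 F - Γ` dominates the square `(‖h₁‖ - ‖c u‖)²`. -/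
theorem Γ_le : f.Γ ≤ 2 * f.F := by
  rw [f.Γ_eq, F]
  have h1 := f.inner_h_s_u
  have h2 := f.inner_ψ_nonneg
  have h3 : -⟪f.h₁, T.c f.u⟫_ℝ ≤ ‖f.h₁‖ * ‖T.c f.u‖ :=
    (neg_le_abs _).trans (abs_real_inner_le_norm _ _)
  have h5 : 0 ≤ m ^ 2 * ‖f.h‖ ^ 2 := by positivity
  nlinarith [sq_nonneg (‖f.h₁‖ - ‖T.c f.u‖)]

theorem F_nonneg : 0 ≤ f.F := by linarith [f.Γ_le, f.Γ_nonneg]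

/-- Eliminating `u` between `g = c u - h₁` and the equation for `h` leaves a degenerate elliptic
equation for `h` with source `g`. The next two bounds come from testing it. -/
theorem c_h₂_add : T.c f.h₂ + T.s f.h₁ = m ^ 2 • T.c f.h - T.s f.g := by
  rw [f.h₂_eq, g, map_sub, map_smul, map_sub, T.c_s]
  abel

/-- Test the equation of `c_h₂_add` with `c h`; apart from `‖c h₁‖²` only `h` and `g` remain. -/
theorem norm_c_h₁_sq_le : ‖T.c f.h₁‖ ^ 2 ≤ 2 * f.Γ := by
  have e1 := congrArg (fun z => ⟪z, T.c f.h⟫_ℝ) f.c_h₂_add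
  simp only [inner_add_left, inner_sub_left, inner_smul_left, conj_trivial,
    real_inner_self_eq_norm_sq] at e1
  have e2 := T.D_skew f.Dh₁ (T.D_c (T.D_c f.Dh))
  rw [inner_sub_right, map_sub, inner_sub_right, ← T.c_symm f.h₂ (T.c f.h),
    ← T.c_symm f.h₁ (T.c f.h₁), ← T.c_symm f.h₁ (T.s f.h), ← T.s_symm f.h₁ (T.c f.h),
    real_inner_self_eq_norm_sq, ← T.inner_c_s f.h₁] at e2
  rw [← T.inner_c_s f.h₁] at e1
  have e3 := T.two_inner_s_c f.Dh
  rw [real_inner_comm] at e3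
  have e4 := T.norm_sq_eq f.h
  have h4 : ‖f.h‖ ^ 2 ≤ f.Γ - ‖f.g‖ ^ 2 := by
    rw [Γ, add_sub_cancel_left]
    exact le_mul_of_one_le_left (by positivity) (by nlinarith [f.one_le])
  have h5 : ⟪T.s f.g, T.c f.h⟫_ℝ ≤ ‖f.g‖ * ‖f.h‖ :=
    (real_inner_le_norm _ _).trans
      (mul_le_mul (T.norm_s_le _) (T.norm_c_le _) (norm_nonneg _) (norm_nonneg _))
  have h6 : 0 ≤ m ^ 2 * ‖T.c f.h‖ ^ 2 := by positivity
  nlinarith [sq_nonneg (‖f.g‖ - ‖f.h‖), sq_nonneg ‖T.c f.h‖, sq_nonneg ‖f.g‖]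

/-- Test the same equation with `s h₁`. Integration by parts turns the second-order term into half
of `‖s h₁‖² - ‖c h₁‖²`, and the unfavourable part is the previous bound. -/
theorem norm_s_h₁_sq_le : ‖T.s f.h₁‖ ^ 2 ≤ 2 * f.Γ := by
  have e1 := congrArg (fun z => ⟪z, T.s f.h₁⟫_ℝ) f.c_h₂_add
  simp only [inner_add_left, inner_sub_left, inner_smul_left, conj_trivial,
    real_inner_self_eq_norm_sq] at e1
  have e2 := T.two_inner_s_c f.Dh₁
  have e3 := T.two_inner_s_c f.Dh
  rw [real_inner_comm (T.s f.h₁) (T.c f.h₂), T.inner_c_s f.h] at e1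
  have e4 := T.norm_sq_eq f.h
  have e5 := f.norm_c_h₁_sq_le
  have h5 : -⟪T.s f.g, T.s f.h₁⟫_ℝ ≤ ‖f.g‖ * ‖T.s f.h₁‖ :=
    (neg_le_abs _).trans ((abs_real_inner_le_norm _ _).trans
      (mul_le_mul_of_nonneg_right (T.norm_s_le _) (norm_nonneg _)))
  have h6 : f.Γ = ‖f.g‖ ^ 2 + m ^ 2 * ‖f.h‖ ^ 2 := rfl
  have h7 : 2 * (m ^ 2 * ⟪T.s f.h, T.c f.h₁⟫_ℝ) ≤ m ^ 2 * ‖f.h‖ ^ 2 := by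
    have : 2 * ⟪T.s f.h, T.c f.h₁⟫_ℝ ≤ ‖f.h‖ ^ 2 := by nlinarith [sq_nonneg ‖T.c f.h‖]
    nlinarith [mul_le_mul_of_nonneg_left this (sq_nonneg m)]
  nlinarith [sq_nonneg (‖f.g‖ - ‖T.s f.h₁‖)]

theorem norm_h₁_le : ‖f.h₁‖ ≤ 2 * √f.Γ := by
  have h := T.norm_sq_eq f.h₁
  have h1 := f.norm_s_h₁_sq_le
  have h2 := f.norm_c_h₁_sq_le
  have h3 := Real.sq_sqrt f.Γ_nonneg
  have h4 := Real.sqrt_nonneg f.Γ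
  nlinarith [norm_nonneg f.h₁]

theorem norm_c_u_le : ‖T.c f.u‖ ≤ 3 * √f.Γ := by
  have e : T.c f.u = f.g + f.h₁ := by rw [g]; abel
  rw [e]
  have := norm_add_le f.g f.h₁
  linarith [f.norm_h₁_le, f.g_le]

/-- Inserting `u = s (s u) + c (c u)` and the equation for `h` bounds `⟪ψ, u⟫` by `8 q √Γ`, where
`q` is the `H¹` norm of `ψ`. Coercivity gives `q² ≤ 2 ⟪ψ, u⟫`, hence `q ≤ 16 √Γ` and the constant
`128`. -/
theorem inner_ψ_le_Γ : ⟪f.ψ, f.u⟫_ℝ ≤ 128 * f.Γ := by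
  have hm := f.one_le
  set q := √(m ^ 2 * ‖f.ψ‖ ^ 2 + ‖f.ψ₁‖ ^ 2) with hq
  have hq2 : q ^ 2 = m ^ 2 * ‖f.ψ‖ ^ 2 + ‖f.ψ₁‖ ^ 2 := Real.sq_sqrt (by positivity)
  have hq0 : 0 ≤ q := Real.sqrt_nonneg _
  have q1 : m * ‖f.ψ‖ ≤ q := Real.le_sqrt_of_sq_le (by rw [mul_pow]; nlinarith [sq_nonneg ‖f.ψ₁‖])
  have q2 : ‖f.ψ₁‖ ≤ q := Real.le_sqrt_of_sq_le (by nlinarith [sq_nonneg (m * ‖f.ψ‖)])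
  have q3 : ‖f.ψ‖ ≤ q := by nlinarith [norm_nonneg f.ψ]
  set G := √f.Γ with hG
  have hG0 : 0 ≤ G := Real.sqrt_nonneg _
  have hG2 : G ^ 2 = f.Γ := Real.sq_sqrt f.Γ_nonneg
  have e1 : ⟪f.ψ, f.u⟫_ℝ = ⟪T.c f.ψ, T.c f.u⟫_ℝ + m ^ 2 * ⟪T.s f.ψ, f.h⟫_ℝ
      + ⟪T.c f.ψ, f.h₁⟫_ℝ + ⟪T.s f.ψ₁, f.h₁⟫_ℝ := by
    have e2 := T.D_skew (T.D_s f.Dψ) f.Dh₁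
    rw [inner_add_left, f.h₂_eq, inner_sub_right, inner_smul_right] at e2
    have e3 : ⟪f.ψ, f.u⟫_ℝ = ⟪T.s f.ψ, T.s f.u⟫_ℝ + ⟪T.c f.ψ, T.c f.u⟫_ℝ := by
      rw [T.s_symm, T.c_symm, ← inner_add_right, T.sq_add_sq]
    linarith
  have b1 : ⟪T.c f.ψ, T.c f.u⟫_ℝ ≤ q * (3 * G) := (real_inner_le_norm _ _).trans
    (mul_le_mul ((T.norm_c_le _).trans q3) f.norm_c_u_le (norm_nonneg _) hq0)
  have b2 : m ^ 2 * ⟪T.s f.ψ, f.h⟫_ℝ ≤ q * G := by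
    have h1 : ⟪T.s f.ψ, f.h⟫_ℝ ≤ ‖f.ψ‖ * ‖f.h‖ := (real_inner_le_norm _ _).trans
      (mul_le_mul_of_nonneg_right (T.norm_s_le _) (norm_nonneg _))
    have h2 : (m * ‖f.ψ‖) * (m * ‖f.h‖) ≤ q * G := mul_le_mul q1 f.mh_le (by positivity) hq0
    nlinarith [mul_le_mul_of_nonneg_left h1 (sq_nonneg m)]
  have b3 : ⟪T.c f.ψ, f.h₁⟫_ℝ ≤ q * (2 * G) := (real_inner_le_norm _ _).trans
    (mul_le_mul ((T.norm_c_le _).trans q3) f.norm_h₁_le (norm_nonneg _) hq0)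
  have b4 : ⟪T.s f.ψ₁, f.h₁⟫_ℝ ≤ q * (2 * G) := (real_inner_le_norm _ _).trans
    (mul_le_mul ((T.norm_s_le _).trans q2) f.norm_h₁_le (norm_nonneg _) hq0)
  have hc := f.coercive
  have b5 : ⟪f.ψ, f.u⟫_ℝ ≤ 8 * (q * G) := by linarith
  have b6 : q ≤ 16 * G := by
    by_contra hcon
    push Not at hcon
    nlinarith
  nlinarith [mul_le_mul_of_nonneg_right b6 hG0]

theorem F_le : f.F ≤ 150 * f.Γ := by
  have h1 := f.inner_ψ_le_Γ
  have h2 := f.inner_h_s_u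
  have hG2 := Real.sq_sqrt f.Γ_nonneg
  have hG0 := Real.sqrt_nonneg f.Γ
  have h3 : ‖T.c f.u‖ ^ 2 ≤ 9 * f.Γ := by
    nlinarith [f.norm_c_u_le, norm_nonneg (T.c f.u)]
  have h4 : ‖f.h₁‖ ^ 2 ≤ 4 * f.Γ := by
    nlinarith [f.norm_h₁_le, norm_nonneg f.h₁]
  have h5 : m ^ 2 * ‖f.h‖ ^ 2 ≤ f.Γ := by rw [Γ]; nlinarith [sq_nonneg ‖f.g‖]
  rw [F]
  linarith [f.Γ_nonneg]

theorem inner_ψ_mul_le : (m ^ 2 - 1) * ⟪f.ψ, f.u⟫_ℝ ≤ ‖f.u‖ ^ 2 := by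
  have e1 := T.D_skew f.Dψ₁ f.Dψ
  have e2 : ⟪f.ψ₂, f.u⟫_ℝ = -(m ^ 2 - 1) * ‖f.ψ₁‖ ^ 2 - ‖f.ψ₂‖ ^ 2 := by
    conv_lhs => rw [← f.eq_ψ]
    rw [inner_sub_right, inner_sub_right, inner_smul_right, e1, real_inner_self_eq_norm_sq,
      real_inner_self_eq_norm_sq]
    ring
  have e3 : ‖f.u‖ ^ 2 = (m ^ 2 - 1) * ⟪f.ψ, f.u⟫_ℝ - ⟪f.ψ₂, f.u⟫_ℝ := by
    rw [← real_inner_self_eq_norm_sq]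
    nth_rewrite 1 [← f.eq_ψ]
    rw [inner_sub_left, inner_sub_left, inner_smul_left]
    simp only [conj_trivial]
    ring
  nlinarith [f.one_le, sq_nonneg ‖f.ψ₁‖, sq_nonneg ‖f.ψ₂‖,
    mul_nonneg (by nlinarith [f.one_le] : 0 ≤ m ^ 2 - 1) (sq_nonneg ‖f.ψ₁‖)]

/-- Turns the dissipation of `E` into exponential decay of `E` at rate `2 m²`, with no loss from the
nonlocal term. -/
theorem mul_E_le : m ^ 2 * f.E ≤ f.Δ + f.E := by
  have h := f.inner_ψ_mul_le
  rw [E, Δ]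
  nlinarith [sq_nonneg ‖f.u₁‖]

end ModeFrame

end

section

/-! ### The trigonometric calculus on Fourier coefficients in `y` -/

/-- Square-summable sequences of Fourier coefficients in `y`. -/
abbrev Mode : Type := lp (fun _ : ℤ => ℂ) 2

theorem memℓp_shift (k : ℤ) (x : Mode) : Memℓp (fun j => x (j + k)) 2 := by
  rw [memℓp_gen_iff (by norm_num)]
  have h := (lp_summable_sq x).comp_injective (add_left_injective k)
  simpa [Function.comp_def] using h

/-- The shift `x ↦ (j ↦ x (j + k))`. -/
def modeShift (k : ℤ) : Mode →L[ℂ] Mode :=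
  LinearMap.mkContinuous
    { toFun := fun x => ⟨fun j => x (j + k), memℓp_shift k x⟩
      map_add' := fun _ _ => rfl
      map_smul' := fun _ _ => rfl } 1 fun x => by
    refine le_of_eq ((pow_left_inj₀ (norm_nonneg _) (by positivity) two_ne_zero).1 ?_)
    rw [one_mul, lp_norm_sq, lp_norm_sq]
    exact (Equiv.addRight k).tsum_eq fun j => ‖x j‖ ^ 2

theorem modeShift_apply (k : ℤ) (x : Mode) (j : ℤ) : modeShift k x j = x (j + k) := rfl

theorem inner_mode (x y : Mode) : ⟪x, y⟫_ℝ = ∑' j, ⟪x j, y j⟫_ℝ := lp.inner_eq_tsum x y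

theorem inner_modeShift (k : ℤ) (x y : Mode) : ⟪modeShift k x, y⟫_ℝ = ⟪x, modeShift (-k) y⟫_ℝ := by
  rw [inner_mode, inner_mode, ← (Equiv.addRight k).tsum_eq fun j => ⟪x j, modeShift (-k) y j⟫_ℝ]
  refine tsum_congr fun j => ?_
  simp [modeShift_apply]

/-- Multiplication by `sin y`. -/
def modeSin : Mode →L[ℂ] Mode := (Complex.I / 2) • (modeShift 1 - modeShift (-1))

/-- Multiplication by `cos y`. -/
def modeCos : Mode →L[ℂ] Mode := (1 / 2 : ℂ) • (modeShift 1 + modeShift (-1))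

theorem modeSin_apply (x : Mode) (j : ℤ) :
    modeSin x j = Complex.I / 2 * (x (j + 1) - x (j + -1)) := rfl

theorem modeCos_apply (x : Mode) (j : ℤ) :
    modeCos x j = 1 / 2 * (x (j + 1) + x (j + -1)) := rfl

theorem inner_I_smul (x y : Mode) : ⟪Complex.I • x, y⟫_ℝ = -⟪x, Complex.I • y⟫_ℝ := by
  rw [inner_mode, inner_mode, ← tsum_neg]
  refine tsum_congr fun j => ?_
  simp [Complex.inner]
  ring

theorem half_smul_mode (x : Mode) : (1 / 2 : ℂ) • x = (1 / 2 : ℝ) • x := by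
  ext j
  simp

theorem modeSin_eq (x : Mode) :
    modeSin x = (1 / 2 : ℝ) • (Complex.I • (modeShift 1 x - modeShift (-1) x)) := by
  rw [← half_smul_mode, smul_smul, modeSin]
  simp only [smul_apply, sub_apply]
  congr 1
  ring

theorem modeCos_eq (x : Mode) :
    modeCos x = (1 / 2 : ℝ) • (modeShift 1 x + modeShift (-1) x) := by
  rw [← half_smul_mode, modeCos]
  rfl

/-- The trigonometric calculus on Fourier coefficients. -/
def modeTrig : TrigCalculus Mode where
  s := modeSin.restrictScalars ℝ
  c := modeCos.restrictScalars ℝ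
  J := ((Complex.I • ContinuousLinearMap.id ℂ Mode)).restrictScalars ℝ
  D x x' := ∀ j : ℤ, x' j = Complex.I * j * x j
  s_symm x y := by
    simp only [ContinuousLinearMap.coe_restrictScalars', modeSin_eq, inner_smul_left,
      inner_smul_right, inner_I_smul]
    simp only [inner_sub_left, smul_sub, inner_sub_right, inner_modeShift, map_smul, neg_neg]
    simp only [conj_trivial]
    ring
  c_symm x y := by
    simp only [ContinuousLinearMap.coe_restrictScalars', modeCos_eq, inner_smul_left,
      inner_smul_right]
    simp only [inner_add_left, inner_add_right, inner_modeShift, neg_neg]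
    simp only [conj_trivial]
    ring
  J_skew := inner_I_smul
  J_J x := by
    ext j
    simp [← mul_assoc]
  c_s x := by
    ext j
    simp only [ContinuousLinearMap.coe_restrictScalars', modeSin_apply, modeCos_apply,
      neg_add_cancel_right, add_neg_cancel_right]
    ring
  s_J x := map_smul modeSin Complex.I x
  c_J x := map_smul modeCos Complex.I x
  sq_add_sq x := by
    ext j
    simp only [ContinuousLinearMap.coe_restrictScalars', lp.coeFn_add, Pi.add_apply, modeSin_apply,
      modeCos_apply, neg_add_cancel_right, add_neg_cancel_right]
    linear_combination (1 / 4) * (x (j + 1 + 1) + x (j + -1 + -1) - 2 * x j) * Complex.I_sq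
  D_skew {x x' y y'} hx hy := by
    rw [inner_mode, inner_mode, ← tsum_neg]
    refine tsum_congr fun j => ?_
    rw [hx, hy]
    simp [Complex.inner]
    ring
  D_s {x x'} hx j := by
    simp only [ContinuousLinearMap.coe_restrictScalars', lp.coeFn_add, Pi.add_apply, modeSin_apply,
      modeCos_apply, hx]
    push_cast
    linear_combination (1 / 2) * (x (j + 1) + x (j + -1)) * Complex.I_sq
  D_c {x x'} hx j := by
    simp only [ContinuousLinearMap.coe_restrictScalars', lp.coeFn_sub, Pi.sub_apply, modeSin_apply,
      modeCos_apply, hx]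
    push_cast
    ring
  D_J {x x'} hx j := by
    change Complex.I * x' j = Complex.I * j * (Complex.I * x j)
    rw [hx]
    ring

/-! ### The frame of a mode -/

/-- The symbol of `l² - ∂²`. -/
def modeLam (l j : ℤ) : ℝ := (l : ℝ) ^ 2 + (j : ℝ) ^ 2

variable {l : ℤ}

theorem one_le_modeLam (hl : l ≠ 0) (j : ℤ) : 1 ≤ modeLam l j := by
  rw [modeLam]
  nlinarith [one_le_cast_sq hl, sq_nonneg (j : ℝ)]

/-- The spectral gap: the symbol is an integer, equal to `1` only on the kernel of `u ↔ w` and at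
least `2` elsewhere. Every comparison between `u`, `ψ` and `w` rests on it. -/
theorem modeLam_eq_one_or (hl : l ≠ 0) (j : ℤ) :
    (l ^ 2 = 1 ∧ j = 0 ∧ modeLam l j = 1) ∨ 2 ≤ modeLam l j := by
  have hl1 : 1 ≤ l ^ 2 := by have := sq_pos_of_ne_zero hl; omega
  by_cases h : l ^ 2 = 1 ∧ j = 0
  · left
    refine ⟨h.1, h.2, ?_⟩
    have : (l : ℝ) ^ 2 = 1 := by exact_mod_cast h.1
    rw [modeLam, h.2, this]
    simp
  · right
    have h2 : 2 ≤ l ^ 2 + j ^ 2 := by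
      by_cases hj : j = 0
      · subst hj
        have : l ^ 2 ≠ 1 := fun e => h ⟨e, rfl⟩
        have h0 : (0 : ℤ) ^ 2 = 0 := by norm_num
        omega
      · have := sq_pos_of_ne_zero hj
        omega
    rw [modeLam]
    exact_mod_cast h2

theorem norm_div_modeLam_le (hl : l ≠ 0) {z : ℂ} {j : ℤ} (hz : ‖z‖ ≤ modeLam l j) :
    ‖z / modeLam l j‖ ≤ 1 := by
  have h := one_le_modeLam hl j
  rw [norm_div, Complex.norm_real, Real.norm_of_nonneg (by linarith)]
  exact div_le_one_of_le₀ hz (by linarith)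

theorem norm_div_modeLam_sub_one_le (hl : l ≠ 0) {z : ℂ} {j : ℤ} (hz : ‖z‖ ≤ max 1 ((j : ℝ) ^ 2)) :
    ‖z / ((modeLam l j - 1 : ℝ) : ℂ)‖ ≤ 1 := by
  rcases modeLam_eq_one_or hl j with ⟨-, -, h⟩ | h
  -- The denominator is zero here, and division by zero returns zero; this is how the inverse
  -- discards the kernel.
  · rw [h]; simp
  · rw [norm_div, Complex.norm_real, Real.norm_of_nonneg (by linarith)]
    refine div_le_one_of_le₀ (hz.trans (max_le (by linarith) ?_)) (by linarith)
    have := one_le_cast_sq hl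
    rw [modeLam]; linarith

theorem abs_cast_le_sq (j : ℤ) : |(j : ℝ)| ≤ (j : ℝ) ^ 2 := by
  have h : |j| ≤ j ^ 2 := by
    rw [← sq_abs]
    rcases eq_or_ne j 0 with rfl | hj
    · simp
    · nlinarith [Int.one_le_abs hj]
  exact_mod_cast h

theorem norm_I_mul_cast (j : ℤ) : ‖Complex.I * (j : ℂ)‖ = |(j : ℝ)| := by
  simp

theorem norm_I_mul_cast_sq (j : ℤ) : ‖(Complex.I * (j : ℂ)) ^ 2‖ = (j : ℝ) ^ 2 := by
  rw [norm_pow, norm_I_mul_cast, sq_abs]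

theorem norm_I_mul_cast_pow_le (hl : l ≠ 0) {k : ℕ} (hk : k ≤ 2) (j : ℤ) :
    ‖(Complex.I * (j : ℂ)) ^ k‖ ≤ modeLam l j ∧
      ‖(Complex.I * (j : ℂ)) ^ k‖ ≤ max 1 ((j : ℝ) ^ 2) := by
  have h1 := one_le_cast_sq hl
  have h2 := abs_cast_le_sq j
  rw [modeLam]
  interval_cases k
  · simp only [pow_zero, norm_one]
    exact ⟨by nlinarith, le_max_left _ _⟩
  · rw [pow_one, norm_I_mul_cast]
    exact ⟨by linarith, h2.trans (le_max_right _ _)⟩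
  · rw [norm_I_mul_cast_sq]
    exact ⟨by linarith, le_max_right _ _⟩

/-- `∂ᵏ (l² - ∂²)⁻¹` for `k ≤ 2`. -/
def modeInv (hl : l ≠ 0) (k : Fin 3) : Mode →L[ℂ] Mode :=
  lpDiag (fun j => (Complex.I * (j : ℂ)) ^ (k : ℕ) / modeLam l j) 1 fun j =>
    norm_div_modeLam_le hl (norm_I_mul_cast_pow_le hl (by omega) j).1

/-- `∂ᵏ (l² - 1 - ∂²)⁻¹` for `k ≤ 2`, with the kernel mapped to zero. -/
def modeInvSub (hl : l ≠ 0) (k : Fin 3) : Mode →L[ℂ] Mode :=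
  lpDiag (fun j => (Complex.I * (j : ℂ)) ^ (k : ℕ) / ((modeLam l j - 1 : ℝ) : ℂ)) 1 fun j =>
    norm_div_modeLam_sub_one_le hl (norm_I_mul_cast_pow_le hl (by omega) j).2

theorem modeInv_apply (hl : l ≠ 0) (k : Fin 3) (x : Mode) (j : ℤ) :
    modeInv hl k x j = (Complex.I * (j : ℂ)) ^ (k : ℕ) / modeLam l j * x j := rfl

theorem modeInvSub_apply (hl : l ≠ 0) (k : Fin 3) (x : Mode) (j : ℤ) :
    modeInvSub hl k x j =
      (Complex.I * (j : ℂ)) ^ (k : ℕ) / ((modeLam l j - 1 : ℝ) : ℂ) * x j := rfl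

theorem I_mul_cast_sq (j : ℤ) : (Complex.I * (j : ℂ)) ^ 2 = -(j : ℂ) ^ 2 := by
  rw [mul_pow, Complex.I_sq]; ring

theorem modeInv_equation (hl : l ≠ 0) (x : Mode) :
    |(l : ℝ)| ^ 2 • modeInv hl 0 x - modeInv hl 2 x = x := by
  ext j
  have h := one_le_modeLam hl j
  have h0 : ((l : ℂ) ^ 2 + (j : ℂ) ^ 2) ≠ 0 := by
    have : (modeLam l j : ℂ) ≠ 0 := Complex.ofReal_ne_zero.2 (by linarith)
    simpa [modeLam] using this
  simp only [lp.coeFn_sub, Pi.sub_apply, lp.coeFn_smul, Pi.smul_apply, modeInv_apply, sq_abs]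
  have e2 : (Complex.I * (j : ℂ)) ^ ((2 : Fin 3) : ℕ) = -(j : ℂ) ^ 2 := I_mul_cast_sq j
  rw [e2]
  simp [modeLam]
  field_simp
  ring

theorem modeInvSub_equation (hl : l ≠ 0) {x : Mode} (hx : l ^ 2 = 1 → x 0 = 0) :
    |(l : ℝ)| ^ 2 • modeInvSub hl 0 x - modeInvSub hl 2 x - modeInvSub hl 0 x = x := by
  ext j
  simp only [lp.coeFn_sub, Pi.sub_apply, lp.coeFn_smul, Pi.smul_apply, modeInvSub_apply, sq_abs]
  have e2 : (Complex.I * (j : ℂ)) ^ ((2 : Fin 3) : ℕ) = -(j : ℂ) ^ 2 := I_mul_cast_sq j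
  rw [e2]
  rcases modeLam_eq_one_or hl j with ⟨h1, rfl, h⟩ | h
  · rw [hx h1]; simp
  · have h0 : ((l : ℂ) ^ 2 + (j : ℂ) ^ 2 - 1) ≠ 0 := by
      have : ((modeLam l j - 1 : ℝ) : ℂ) ≠ 0 := Complex.ofReal_ne_zero.2 (by linarith)
      simpa [modeLam] using this
    simp [modeLam]
    field_simp
    ring

theorem summable_inner_mode (x y : Mode) : Summable fun j => ⟪x j, y j⟫_ℝ := lp.summable_inner x y

theorem inner_modeInvSub (hl : l ≠ 0) (x : Mode) : ⟪modeInvSub hl 0 x, x⟫_ℝ =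
    ∑' j, ‖x j‖ ^ 2 / (modeLam l j - 1) ∧ Summable fun j => ‖x j‖ ^ 2 / (modeLam l j - 1) := by
  have h : ∀ j, ⟪modeInvSub hl 0 x j, x j⟫_ℝ = ‖x j‖ ^ 2 / (modeLam l j - 1) := by
    intro j
    rw [modeInvSub_apply]
    have : (Complex.I * (j : ℂ)) ^ ((0 : Fin 3) : ℕ) / ((modeLam l j - 1 : ℝ) : ℂ) * x j
        = (modeLam l j - 1)⁻¹ • x j := by
      simp
    rw [this, inner_smul_left, real_inner_self_eq_norm_sq]
    simp only [conj_trivial]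
    ring
  exact ⟨by rw [inner_mode]; exact tsum_congr h, (summable_inner_mode _ _).congr h⟩

/-- The frame of the mode with `(l² - ∂²) u = y`. -/
def modeFrame (hl : l ≠ 0) (y : Mode) (hy : l ^ 2 = 1 → y 0 = 0) :
    ModeFrame modeTrig |(l : ℝ)| where
  u := modeInv hl 0 y
  u₁ := modeInv hl 1 y
  u₂ := modeInv hl 2 y
  h := modeInv hl 0 (modeSin (modeInv hl 0 y))
  h₁ := modeInv hl 1 (modeSin (modeInv hl 0 y))
  h₂ := modeInv hl 2 (modeSin (modeInv hl 0 y))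
  ψ := modeInvSub hl 0 (modeInv hl 0 y)
  ψ₁ := modeInvSub hl 1 (modeInv hl 0 y)
  ψ₂ := modeInvSub hl 2 (modeInv hl 0 y)
  Du j := by simp [modeInv_apply]; ring
  Du₁ j := by
    simp only [modeInv_apply]
    change (Complex.I * (j : ℂ)) ^ 2 / _ * _ = Complex.I * j * ((Complex.I * (j : ℂ)) ^ 1 / _ * _)
    ring
  Dh j := by simp only [modeInv_apply]; simp; ring
  Dh₁ j := by
    simp only [modeInv_apply hl 1, modeInv_apply hl 2]
    change (Complex.I * (j : ℂ)) ^ 2 / _ * _ = Complex.I * j * ((Complex.I * (j : ℂ)) ^ 1 / _ * _)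
    ring
  Dψ j := by simp only [modeInvSub_apply]; simp; ring
  Dψ₁ j := by
    simp only [modeInvSub_apply hl 1, modeInvSub_apply hl 2]
    change (Complex.I * (j : ℂ)) ^ 2 / _ * _ = Complex.I * j * ((Complex.I * (j : ℂ)) ^ 1 / _ * _)
    ring
  eq_h := modeInv_equation hl _
  eq_ψ := modeInvSub_equation hl fun h => by rw [modeInv_apply, hy h, mul_zero]
  one_le := by
    have h : (1 : ℤ) ≤ |l| := Int.one_le_abs hl
    exact_mod_cast h
  coercive := by
    set x := modeInv hl 0 y
    obtain ⟨e, hs⟩ := inner_modeInvSub hl x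
    rw [e, lp_norm_sq, lp_norm_sq, ← tsum_mul_left, ← tsum_mul_left,
      ← ((lp_summable_sq _).mul_left _).tsum_add (lp_summable_sq _)]
    refine (((lp_summable_sq _).mul_left _).add (lp_summable_sq _)).tsum_le_tsum (fun j => ?_)
      (hs.mul_left 2)
    rcases modeLam_eq_one_or hl j with ⟨-, -, h⟩ | h
    · simp [modeInvSub_apply, h]
    · simp only [modeInvSub_apply, norm_mul, norm_div, norm_pow, Complex.norm_real]
      rw [Real.norm_of_nonneg (by linarith : 0 ≤ modeLam l j - 1)]
      have h3 : (0 : ℝ) < modeLam l j - 1 := by linarith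
      have e0 : ((0 : Fin 3) : ℕ) = 0 := rfl
      have e1 : ((1 : Fin 3) : ℕ) = 1 := rfl
      have e2 : modeLam l j = |(l : ℝ)| ^ 2 + |(j : ℝ)| ^ 2 := by rw [sq_abs, sq_abs]; rfl
      have e3 : ‖Complex.I‖ * ‖(j : ℂ)‖ = |(j : ℝ)| := by simp
      rw [e0, e1, pow_zero, pow_one, e3]
      have e4 : |(l : ℝ)| ^ 2 * (1 / (modeLam l j - 1) * ‖x j‖) ^ 2
          + (|(j : ℝ)| / (modeLam l j - 1) * ‖x j‖) ^ 2
          = modeLam l j * (‖x j‖ ^ 2 / (modeLam l j - 1) ^ 2) := by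
        nth_rewrite 3 [e2]
        field_simp
      -- What remains is `λ ≤ 2 (λ - 1)`, that is, the gap `λ ≥ 2`.
      rw [e4, mul_div_assoc', mul_div_assoc', div_le_div_iff₀ (by positivity) h3]
      nlinarith [mul_nonneg (mul_nonneg (sq_nonneg ‖x j‖) h3.le) (by linarith : 0 ≤ modeLam l j - 2)]
  inner_ψ_le := by
    set x := modeInv hl 0 y
    obtain ⟨e, hs⟩ := inner_modeInvSub hl x
    rw [e, lp_norm_sq]
    refine hs.tsum_le_tsum (fun j => ?_) (lp_summable_sq _)
    rcases modeLam_eq_one_or hl j with ⟨-, -, h⟩ | h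
    · simp [h]
    · exact div_le_self (sq_nonneg _) (by linarith)

end

section

/-! ### Decay of solutions of the evolution equation on one mode -/

/-- For quadratic forms `⟪u, B u⟫` with `B` unbounded and symmetric: `z = B u` is merely continuous
in time, but symmetry rewrites the increment as `⟪u s - u t, z s + z t⟫`, so only `u` is
differentiated. -/
theorem hasDerivWithinAt_inner_of_symm {V : Type*} [NormedAddCommGroup V] [InnerProductSpace ℝ V]
    {u z : ℝ → V} {v : V} {t : ℝ} (hu : HasDerivWithinAt u v (Set.Ici t) t)
    (hz : ContinuousWithinAt z (Set.Ici t) t)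
    (hsymm : ∀ s, ⟪u s, z t⟫_ℝ = ⟪u t, z s⟫_ℝ) :
    HasDerivWithinAt (fun s => ⟪u s, z s⟫_ℝ) (2 * ⟪v, z t⟫_ℝ) (Set.Ici t) t := by
  rw [← hasDerivWithinAt_Ioi_iff_Ici, hasDerivWithinAt_iff_tendsto_slope' (by simp)] at hu ⊢
  have hz' : Tendsto z (𝓝[>] t) (𝓝 (z t)) := hz.mono Set.Ioi_subset_Ici_self
  have h := hu.inner (𝕜 := ℝ) (hz'.add_const (z t))
  have e : ⟪v, z t + z t⟫_ℝ = 2 * ⟪v, z t⟫_ℝ := by rw [inner_add_right]; ring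
  rw [e] at h
  refine h.congr fun s => ?_
  rw [slope_def_module, slope_def_field, inner_smul_left, inner_add_right, inner_sub_left,
    inner_sub_left, hsymm s]
  simp only [conj_trivial]
  rw [div_eq_inv_mul]
  ring

theorem le_exp_of_hasDerivWithinAt_le {q q' : ℝ → ℝ} {a k : ℝ}
    (hq : ContinuousOn q (Set.Ici a))
    (hq' : ∀ t, a ≤ t → HasDerivWithinAt q (q' t) (Set.Ici t) t)
    (hle : ∀ t, a ≤ t → q' t ≤ -k * q t) {t : ℝ} (ht : a ≤ t) :
    q t ≤ Real.exp (-k * (t - a)) * q a := by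
  have hd : ∀ x, a ≤ x → HasDerivWithinAt (fun s => Real.exp (k * (s - a)) * q s)
      (Real.exp (k * (x - a)) * k * q x + Real.exp (k * (x - a)) * q' x) (Set.Ici x) x := by
    intro x hx
    have h1 : HasDerivAt (fun s : ℝ => Real.exp (k * (s - a))) (Real.exp (k * (x - a)) * k) x := by
      have h2 : HasDerivAt (fun s : ℝ => k * (s - a)) k x := by
        simpa using ((hasDerivAt_id x).sub_const a).const_mul k
      exact h2.exp
    exact h1.hasDerivWithinAt.mul (hq' x hx)
  have h := image_le_of_deriv_right_le_deriv_boundary (a := a) (b := t)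
    (f := fun s => Real.exp (k * (s - a)) * q s) (B := fun _ => q a) (B' := fun _ => 0)
    (((by fun_prop : Continuous fun s : ℝ => Real.exp (k * (s - a))).continuousOn).mul
      (hq.mono Set.Icc_subset_Ici_self)) (fun x hx => hd x hx.1) (by simp) continuousOn_const
    (fun x _ => hasDerivWithinAt_const _ _ _) (fun x hx => by
      have := hle x hx.1
      have h0 := Real.exp_pos (k * (x - a))
      nlinarith [mul_le_mul_of_nonneg_left this h0.le]) (Set.right_mem_Icc.2 ht)
  have h1 := mul_le_mul_of_nonneg_left h (Real.exp_pos (-k * (t - a))).le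
  rw [← mul_assoc, ← Real.exp_add] at h1
  simpa using h1

/-- A solution of `∂ₜ u = -(m² - ∂²) u - i β (sin y · u - h)`. -/
structure ModeFlow {V : Type*} [NormedAddCommGroup V] [InnerProductSpace ℝ V]
    (T : TrigCalculus V) (m β : ℝ) where
  frame : ℝ → ModeFrame T m
  continuousOn_u : ContinuousOn (fun t => (frame t).u) (Set.Ici 0)
  continuousOn_u₁ : ContinuousOn (fun t => (frame t).u₁) (Set.Ici 0)
  continuousOn_y : ContinuousOn (fun t => (frame t).y) (Set.Ici 0)
  continuousOn_h : ContinuousOn (fun t => (frame t).h) (Set.Ici 0)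
  continuousOn_ψ : ContinuousOn (fun t => (frame t).ψ) (Set.Ici 0)
  hasDeriv : ∀ t, 0 ≤ t →
    HasDerivWithinAt (fun s => (frame s).u) ((frame t).rhs β) (Set.Ici t) t

/-! ### Symmetry of the quadratic forms and the hypocoercivity functional -/

namespace ModeFrame

variable {V : Type*} [NormedAddCommGroup V] [InnerProductSpace ℝ V] {T : TrigCalculus V} {m : ℝ}
  (f g : ModeFrame T m)

theorem inner_y_symm : ⟪f.u, g.y⟫_ℝ = ⟪g.u, f.y⟫_ℝ := by
  have h1 := T.D_skew f.Du₁ g.Du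
  have h2 := T.D_skew f.Du g.Du₁
  rw [y, y, inner_sub_right, inner_sub_right, inner_smul_right, inner_smul_right,
    real_inner_comm f.u g.u, real_inner_comm f.u₂ g.u]
  linarith

theorem inner_ψ_symm : ⟪f.u, g.ψ⟫_ℝ = ⟪g.u, f.ψ⟫_ℝ := by
  have h1 := T.D_skew f.Dψ₁ g.Dψ
  have h2 := T.D_skew f.Dψ g.Dψ₁
  rw [← f.eq_ψ, ← g.eq_ψ, inner_sub_left, inner_sub_left, inner_sub_left, inner_sub_left,
    inner_smul_left, inner_smul_left, real_inner_comm f.ψ g.ψ, real_inner_comm f.ψ g.ψ₂]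
  simp only [conj_trivial]
  linarith

theorem inner_h_symm : ⟪T.s f.u, g.h⟫_ℝ = ⟪T.s g.u, f.h⟫_ℝ := by
  have h1 := T.D_skew f.Dh₁ g.Dh
  have h2 := T.D_skew f.Dh g.Dh₁
  rw [← f.eq_h, ← g.eq_h, inner_sub_left, inner_sub_left,
    inner_smul_left, inner_smul_left, real_inner_comm f.h g.h, real_inner_comm f.h g.h₂]
  linarith

theorem inner_X_symm : ⟪f.u, T.J (T.s g.u - (2 : ℝ) • T.c g.u₁)⟫_ℝ =
    ⟪g.u, T.J (T.s f.u - (2 : ℝ) • T.c f.u₁)⟫_ℝ := by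
  have h1 := T.D_skew f.Du (T.D_J (T.D_c g.Du))
  have h2 : ⟪f.u₁, T.J (T.c g.u)⟫_ℝ = -⟪g.u, T.J (T.c f.u₁)⟫_ℝ := by
    rw [real_inner_comm, T.J_skew, T.c_symm, T.c_J]
  have h3 : ⟪f.u, T.J (T.s g.u)⟫_ℝ = -⟪g.u, T.J (T.s f.u)⟫_ℝ := by
    rw [real_inner_comm, T.J_skew, T.s_symm, T.s_J]
  rw [map_sub, inner_sub_right] at h1
  rw [map_sub, map_sub, inner_sub_right, inner_sub_right, map_smul, map_smul, inner_smul_right,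
    inner_smul_right]
  linarith

theorem inner_J_X : ⟪f.u, T.J (T.s f.u - (2 : ℝ) • T.c f.u₁)⟫_ℝ = 2 * f.X := by
  have h0 := T.inner_J_s_self f.u
  have h2 : f.X = -⟪f.u, T.J (T.c f.u₁)⟫_ℝ := by
    rw [X, T.J_skew, T.c_symm, T.c_J]
  rw [map_sub, inner_sub_right, map_smul, inner_smul_right, real_inner_comm, h0, h2]
  ring

theorem inner_F : ⟪f.u, f.u + f.ψ - T.s (T.s f.u - f.h)⟫_ℝ = f.F := by
  have h := T.norm_sq_eq f.u
  rw [F, inner_sub_right, inner_add_right, ← T.s_symm, inner_sub_right, real_inner_self_eq_norm_sq,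
    real_inner_self_eq_norm_sq, real_inner_comm f.u f.ψ, real_inner_comm (T.s f.u) f.h]
  linarith

theorem inner_F_symm : ⟪f.u, g.u + g.ψ - T.s (T.s g.u - g.h)⟫_ℝ =
    ⟪g.u, f.u + f.ψ - T.s (T.s f.u - f.h)⟫_ℝ := by
  rw [inner_sub_right, inner_add_right, ← T.s_symm f.u, inner_sub_right (T.s f.u),
    inner_sub_right g.u, inner_add_right g.u, ← T.s_symm g.u, inner_sub_right (T.s g.u),
    f.inner_ψ_symm g, f.inner_h_symm g, real_inner_comm f.u g.u,
    real_inner_comm (T.s f.u) (T.s g.u)]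

theorem E_nonneg : 0 ≤ f.E := by
  have := f.norm_sq_le_E
  nlinarith [sq_nonneg ‖f.u‖]

/-- The hypocoercivity functional at time scale `τ`. -/
def Φ (β τ : ℝ) : ℝ :=
  f.E + 1 / 2500 * τ * f.Δ + 1 / 1250000 * β * τ ^ 2 * f.X + 1 / 1250000000 * β ^ 2 * τ ^ 3 * f.F

/-- The sum of the time derivatives of the four terms of `Φ`, for `τ' = σ`. -/
def dΦ (β τ σ : ℝ) : ℝ :=
  2 * (-f.Δ - f.E) + 1 / 2500 * (σ * f.Δ + τ * (2 * (-‖f.y‖ ^ 2 - β * f.X)))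
    + 1 / 1250000 * β * (σ * (2 * τ) * f.X
      + τ ^ 2 * (-f.X + 2 * ⟪f.y, T.J (T.c f.u₁)⟫_ℝ - β * f.Γ))
    + 1 / 1250000000 * β ^ 2 * (σ * (3 * τ ^ 2) * f.F
      + τ ^ 3 * (2 * ⟪f.rhs β, f.u + f.ψ - T.s (T.s f.u - f.h)⟫_ℝ))

/-- With `|X| ≤ √Γ √Δ` and `Γ ≤ 2 F`, the three added terms dominate `τ / 2500` times the square of
`√Δ - |β| τ √Γ / 1000`. The coefficients of `Φ` are tuned to make this square exact. -/
theorem E_le_Φ (β : ℝ) {τ : ℝ} (hτ : 0 ≤ τ) : f.E ≤ f.Φ β τ := by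
  have hX := f.abs_X_le
  have hz := Real.sq_sqrt f.Δ_nonneg
  have hG := Real.sq_sqrt f.Γ_nonneg
  have hF := f.Γ_le
  set z := √f.Δ
  set G := √f.Γ
  have h1 : -(|β| * τ * (G * z)) ≤ β * τ * f.X := by
    have : |β * τ * f.X| ≤ |β| * τ * (G * z) := by
      rw [abs_mul, abs_mul, abs_of_nonneg hτ]
      exact mul_le_mul_of_nonneg_left hX (by positivity)
    exact (abs_le.1 this).1
  have h2 : (|β| * τ) ^ 2 * G ^ 2 ≤ 2 * (β ^ 2 * τ ^ 2 * f.F) := by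
    rw [hG, mul_pow, sq_abs]
    nlinarith [mul_le_mul_of_nonneg_left hF (by positivity : 0 ≤ β ^ 2 * τ ^ 2)]
  have h3 : 0 ≤ 1 / 2500 * z ^ 2 + 1 / 1250000 * (β * τ * f.X)
      + 1 / 1250000000 * (β ^ 2 * τ ^ 2 * f.F) := by
    nlinarith [sq_nonneg (z - 1 / 1000 * (|β| * τ * G))]
  have h4 := mul_nonneg hτ h3
  rw [Φ, ← hz]
  nlinarith

/-- Each term of `Φ` contributes its own dissipation: `Δ` from `E`, `τ ‖y‖²` from `Δ`, `β² τ² Γ`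
from `β X`, and `τ (|β| τ ‖c u₁‖)²` from `F`. The cross terms are absorbed by these. The case `σ =
1` serves the growing weight `τ = t`, and `σ = 0` the frozen one. -/
theorem dΦ_le {β τ σ : ℝ} (hτ : 0 ≤ τ) (hτ1 : τ ≤ 1) (hσ : 0 ≤ σ) (hσ1 : σ ≤ 1) :
    f.dΦ β τ σ ≤ -(1 / 2) * f.Δ - 1 / 5000000 * (β ^ 2 * τ ^ 2 * f.Γ) := by
  have hX := f.abs_X_le
  have hΔ := f.Δ_nonneg
  have hΓ := f.Γ_nonneg
  have hE := f.E_nonneg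
  have hz := Real.sq_sqrt f.Δ_nonneg
  have hG := Real.sq_sqrt f.Γ_nonneg
  have hz0 := Real.sqrt_nonneg f.Δ
  have hG0 := Real.sqrt_nonneg f.Γ
  have hF := f.F_le
  have hdF := f.inner_rhs_F_le β
  have hyc : |⟪f.y, T.J (T.c f.u₁)⟫_ℝ| ≤ ‖f.y‖ * ‖T.c f.u₁‖ := by
    rw [← T.norm_J (T.c f.u₁)]; exact abs_real_inner_le_norm _ _
  set z := √f.Δ
  set G := √f.Γ
  set I := ⟪f.rhs β, f.u + f.ψ - T.s (T.s f.u - f.h)⟫_ℝ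
  set K := ⟪f.y, T.J (T.c f.u₁)⟫_ℝ
  set P := ‖f.y‖
  set R := ‖T.c f.u₁‖
  set W := |β| * τ * (G * z) with hW
  have hW0 : 0 ≤ W := by positivity
  have hβX : |β * τ * f.X| ≤ W := by
    rw [abs_mul, abs_mul, abs_of_nonneg hτ]
    exact mul_le_mul_of_nonneg_left hX (by positivity)
  obtain ⟨x1, x2⟩ := abs_le.1 hβX
  have h1 : σ * f.Δ ≤ f.Δ := mul_le_of_le_one_left hΔ hσ1
  have h2 : σ * (β * τ * f.X) ≤ W := by nlinarith
  have h3 : -(τ * (β * τ * f.X)) ≤ W := by nlinarith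
  have h4 : β * τ ^ 2 * K ≤ τ * (P * (|β| * τ * R)) := by
    have : |β * τ ^ 2 * K| ≤ |β| * τ ^ 2 * (P * R) := by
      rw [abs_mul, abs_mul, abs_of_nonneg (sq_nonneg τ)]
      exact mul_le_mul_of_nonneg_left hyc (by positivity)
    refine (le_abs_self _).trans (this.trans_eq ?_)
    ring
  -- The comparison constant `150` is why the last coefficient of `Φ` is a thousandth of the
  -- previous one: `3 · 150 / 1000 < 1`.
  have h5 : σ * (β ^ 2 * τ ^ 2 * f.F) ≤ 150 * (β ^ 2 * τ ^ 2 * f.Γ) := by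
    have a1 : β ^ 2 * τ ^ 2 * f.F ≤ 150 * (β ^ 2 * τ ^ 2 * f.Γ) := by
      nlinarith [mul_le_mul_of_nonneg_left hF (by positivity : 0 ≤ β ^ 2 * τ ^ 2)]
    have a2 : 0 ≤ β ^ 2 * τ ^ 2 * f.F := mul_nonneg (by positivity) f.F_nonneg
    exact (mul_le_of_le_one_left a2 hσ1).trans a1
  have h6 : β ^ 2 * τ ^ 3 * (2 * I) ≤ -(τ * (|β| * τ * R) ^ 2) + 4 * (β ^ 2 * τ ^ 2 * f.Γ) := by
    have a1 := mul_le_mul_of_nonneg_left hdF (by positivity : 0 ≤ β ^ 2 * τ ^ 3)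
    have a2 : τ * (|β| * τ * R) ^ 2 = β ^ 2 * τ ^ 3 * R ^ 2 := by
      rw [mul_pow, mul_pow, sq_abs]; ring
    have a3 : τ * (β ^ 2 * τ ^ 2 * f.Γ) ≤ β ^ 2 * τ ^ 2 * f.Γ :=
      mul_le_of_le_one_left (by positivity) hτ1
    rw [a2]
    nlinarith
  have h7 : 0 ≤ τ * (P - 1 / 1000 * (|β| * τ * R)) ^ 2 := by positivity
  have h8 : β ^ 2 * τ ^ 2 * f.Γ = (|β| * τ * G) ^ 2 := by
    rw [mul_pow, mul_pow, sq_abs, hG]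
  have h9 : W = (|β| * τ * G) * z := by rw [hW]; ring
  have h10 : (2 / 2500 + 3 / 1250000) * W ≤ f.Δ + 1 / 5000000 * (β ^ 2 * τ ^ 2 * f.Γ) := by
    rw [h8, h9, ← hz]
    nlinarith [sq_nonneg (z - 2006 / 5000000 * (|β| * τ * G)), sq_nonneg (|β| * τ * G)]
  have e : f.dΦ β τ σ = -2 * f.Δ - 2 * f.E + 1 / 2500 * (σ * f.Δ) - 2 / 2500 * (τ * P ^ 2)
      - 2 / 2500 * (β * τ * f.X) + 2 / 1250000 * (σ * (β * τ * f.X))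
      - 1 / 1250000 * (τ * (β * τ * f.X)) + 2 / 1250000 * (β * τ ^ 2 * K)
      - 1 / 1250000 * (β ^ 2 * τ ^ 2 * f.Γ) + 3 / 1250000000 * (σ * (β ^ 2 * τ ^ 2 * f.F))
      + 1 / 1250000000 * (β ^ 2 * τ ^ 3 * (2 * I)) := by
    rw [dΦ]; ring
  have h11 : 0 ≤ β ^ 2 * τ ^ 2 * f.Γ := by positivity
  have e7 : τ * (P - 1 / 1000 * (|β| * τ * R)) ^ 2 = τ * P ^ 2
      - 2 / 1000 * (τ * (P * (|β| * τ * R))) + 1 / 1000000 * (τ * (|β| * τ * R) ^ 2) := by ring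
  rw [e7] at h7
  rw [e]
  linarith

/-- The only term without a factor `τ` is `E ≤ 16 √Γ √Δ`. The relation `|β| τ² = 1` rewrites it as
`16 τ` times `|β| τ √Γ √Δ`, so `Φ` is at most `τ` times its dissipation. -/
theorem Φ_le {β τ : ℝ} (hτ : 0 ≤ τ) (hβ : |β| * τ ^ 2 = 1) :
    f.Φ β τ ≤ τ * (9 * (f.Δ + β ^ 2 * τ ^ 2 * f.Γ)) := by
  have hX := f.abs_X_le
  have hE := f.E_le
  have hu := f.norm_sq_le
  have hz := Real.sq_sqrt f.Δ_nonneg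
  have hG := Real.sq_sqrt f.Γ_nonneg
  have hz0 := Real.sqrt_nonneg f.Δ
  have hG0 := Real.sqrt_nonneg f.Γ
  have hF := f.F_le
  set z := √f.Δ
  set G := √f.Γ
  set W := |β| * τ * (G * z) with hW
  have hβX : β * τ * f.X ≤ W := by
    refine (le_abs_self _).trans ?_
    rw [abs_mul, abs_mul, abs_of_nonneg hτ]
    exact mul_le_mul_of_nonneg_left hX (by positivity)
  have h1 : τ * W = G * z := by
    have : τ * W = (|β| * τ ^ 2) * (G * z) := by rw [hW]; ring
    rw [this, hβ, one_mul]
  have h8 : β ^ 2 * τ ^ 2 * f.Γ = (|β| * τ * G) ^ 2 := by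
    rw [mul_pow, mul_pow, sq_abs, hG]
  have h9 : W = (|β| * τ * G) * z := by rw [hW]; ring
  have h5 : β ^ 2 * τ ^ 2 * f.F ≤ 150 * (β ^ 2 * τ ^ 2 * f.Γ) := by
    nlinarith [mul_le_mul_of_nonneg_left hF (by positivity : 0 ≤ β ^ 2 * τ ^ 2)]
  have h10 : 16 * W + 1 / 2500 * f.Δ + 1 / 1250000 * (β * τ * f.X)
      + 1 / 1250000000 * (β ^ 2 * τ ^ 2 * f.F) ≤ 9 * (f.Δ + β ^ 2 * τ ^ 2 * f.Γ) := by
    rw [h8] at h5 ⊢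
    rw [h9] at hβX ⊢
    nlinarith [sq_nonneg (z - |β| * τ * G), sq_nonneg z, sq_nonneg (|β| * τ * G)]
  have h11 := mul_le_mul_of_nonneg_left h10 hτ
  rw [Φ]
  nlinarith

end ModeFrame

/-! ### Time derivatives along the flow and the two decay rates of `E` -/

namespace ModeFlow

variable {V : Type*} [NormedAddCommGroup V] [InnerProductSpace ℝ V] {T : TrigCalculus V}
  {m β : ℝ} (F : ModeFlow T m β)

theorem continuousWithinAt_of_continuousOn {W : Type*} [TopologicalSpace W] {z : ℝ → W}
    (hz : ContinuousOn z (Set.Ici 0)) {t : ℝ} (ht : 0 ≤ t) :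
    ContinuousWithinAt z (Set.Ici t) t :=
  (hz t ht).mono (Set.Ici_subset_Ici.2 ht)

theorem inner_u_add_ψ (f : ModeFrame T m) : ⟪f.u, f.u + f.ψ⟫_ℝ = f.E := by
  rw [inner_add_right, real_inner_self_eq_norm_sq, ModeFrame.E, real_inner_comm]

theorem hasDeriv_E {t : ℝ} (ht : 0 ≤ t) : HasDerivWithinAt (fun s => (F.frame s).E)
    (2 * (-(F.frame t).Δ - (F.frame t).E)) (Set.Ici t) t := by
  have h := hasDerivWithinAt_inner_of_symm (F.hasDeriv t ht)
    (z := fun s => (F.frame s).u + (F.frame s).ψ)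
    (continuousWithinAt_of_continuousOn (F.continuousOn_u.add F.continuousOn_ψ) ht)
    (fun s => by
      rw [inner_add_right, inner_add_right, (F.frame s).inner_ψ_symm, real_inner_comm])
  rw [(F.frame t).inner_rhs_E] at h
  simpa only [inner_u_add_ψ] using h

theorem hasDeriv_Δ {t : ℝ} (ht : 0 ≤ t) : HasDerivWithinAt (fun s => (F.frame s).Δ)
    (2 * (-‖(F.frame t).y‖ ^ 2 - β * (F.frame t).X)) (Set.Ici t) t := by
  have h := hasDerivWithinAt_inner_of_symm (F.hasDeriv t ht) (z := fun s => (F.frame s).y)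
    (continuousWithinAt_of_continuousOn F.continuousOn_y ht)
    (fun s => (F.frame s).inner_y_symm _)
  rw [(F.frame t).inner_rhs_y] at h
  have e : ∀ f : ModeFrame T m, ⟪f.u, f.y⟫_ℝ = f.Δ := fun f => by
    rw [real_inner_comm, f.inner_y_u]
  simpa only [e] using h

theorem continuousOn_J_s_sub :
    ContinuousOn (fun t => T.J (T.s (F.frame t).u - (2 : ℝ) • T.c (F.frame t).u₁)) (Set.Ici 0) :=
  T.J.continuous.comp_continuousOn ((T.s.continuous.comp_continuousOn F.continuousOn_u).sub
    ((T.c.continuous.comp_continuousOn F.continuousOn_u₁).const_smul (2 : ℝ)))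

theorem hasDeriv_X {t : ℝ} (ht : 0 ≤ t) : HasDerivWithinAt (fun s => (F.frame s).X)
    (-(F.frame t).X + 2 * ⟪(F.frame t).y, T.J (T.c (F.frame t).u₁)⟫_ℝ - β * (F.frame t).Γ)
    (Set.Ici t) t := by
  have h := hasDerivWithinAt_inner_of_symm (F.hasDeriv t ht)
    (z := fun s => T.J (T.s (F.frame s).u - (2 : ℝ) • T.c (F.frame s).u₁))
    (continuousWithinAt_of_continuousOn F.continuousOn_J_s_sub ht)
    (fun s => (F.frame s).inner_X_symm _)
  rw [(F.frame t).inner_rhs_X] at h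
  simp only [ModeFrame.inner_J_X] at h
  have h' := h.const_mul (1 / 2 : ℝ)
  simp only [← mul_assoc] at h'
  norm_num at h'
  exact h'

theorem hasDeriv_F {t : ℝ} (ht : 0 ≤ t) : HasDerivWithinAt (fun s => (F.frame s).F)
    (2 * ⟪(F.frame t).rhs β, (F.frame t).u + (F.frame t).ψ
      - T.s (T.s (F.frame t).u - (F.frame t).h)⟫_ℝ) (Set.Ici t) t := by
  have h := hasDerivWithinAt_inner_of_symm (F.hasDeriv t ht)
    (z := fun s => (F.frame s).u + (F.frame s).ψ - T.s (T.s (F.frame s).u - (F.frame s).h))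
    (continuousWithinAt_of_continuousOn ((F.continuousOn_u.add F.continuousOn_ψ).sub
      (T.s.continuous.comp_continuousOn
        ((T.s.continuous.comp_continuousOn F.continuousOn_u).sub F.continuousOn_h))) ht)
    (fun s => (F.frame s).inner_F_symm _)
  simpa only [ModeFrame.inner_F] using h

theorem continuousOn_E : ContinuousOn (fun t => (F.frame t).E) (Set.Ici 0) := by
  have h := F.continuousOn_u.inner (𝕜 := ℝ) (F.continuousOn_u.add F.continuousOn_ψ)
  refine h.congr fun t _ => ?_
  exact (inner_u_add_ψ _).symm

theorem continuousOn_Δ : ContinuousOn (fun t => (F.frame t).Δ) (Set.Ici 0) := by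
  have h := F.continuousOn_y.inner (𝕜 := ℝ) F.continuousOn_u
  refine h.congr fun t _ => ?_
  exact (F.frame t).inner_y_u.symm

theorem continuousOn_X : ContinuousOn (fun t => (F.frame t).X) (Set.Ici 0) :=
  (T.J.continuous.comp_continuousOn (T.c.continuous.comp_continuousOn F.continuousOn_u)).inner
    (𝕜 := ℝ) F.continuousOn_u₁

theorem continuousOn_F : ContinuousOn (fun t => (F.frame t).F) (Set.Ici 0) :=
  (((T.c.continuous.comp_continuousOn F.continuousOn_u).norm.pow 2).add
    (F.continuousOn_ψ.inner (𝕜 := ℝ) F.continuousOn_u)).add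
    (F.continuousOn_h.inner (𝕜 := ℝ) (T.s.continuous.comp_continuousOn F.continuousOn_u))

theorem E_le_exp {t : ℝ} (ht : 0 ≤ t) :
    (F.frame t).E ≤ Real.exp (-(2 * m ^ 2) * t) * (F.frame 0).E := by
  have h := le_exp_of_hasDerivWithinAt_le (a := 0) (k := 2 * m ^ 2) F.continuousOn_E
    (fun t ht => F.hasDeriv_E ht) (fun t _ => by
      have := (F.frame t).mul_E_le
      linarith) ht
  simpa using h

theorem continuousOn_Φ {τ : ℝ → ℝ} (hτ : ContinuousOn τ (Set.Ici 0)) :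
    ContinuousOn (fun t => (F.frame t).Φ β (τ t)) (Set.Ici 0) :=
  ((F.continuousOn_E.add ((hτ.const_mul _).mul F.continuousOn_Δ)).add
    (((hτ.pow 2).const_mul _).mul F.continuousOn_X)).add
    (((hτ.pow 3).const_mul _).mul F.continuousOn_F)

theorem hasDeriv_Φ {τ : ℝ → ℝ} {σ t : ℝ} (ht : 0 ≤ t)
    (hτ : HasDerivWithinAt τ σ (Set.Ici t) t) :
    HasDerivWithinAt (fun s => (F.frame s).Φ β (τ s)) ((F.frame t).dΦ β (τ t) σ)
      (Set.Ici t) t := by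
  have h := (((F.hasDeriv_E ht).add ((hτ.const_mul (1 / 2500)).mul (F.hasDeriv_Δ ht))).add
    (((hτ.pow 2).const_mul (1 / 1250000 * β)).mul (F.hasDeriv_X ht))).add
    (((hτ.pow 3).const_mul (1 / 1250000000 * β ^ 2)).mul (F.hasDeriv_F ht))
  refine (h.congr_deriv ?_)
  rw [ModeFrame.dΦ, Pi.pow_apply, Pi.pow_apply]
  push_cast
  ring

/-- Up to time `τ` the functional with weight equal to the running time starts at `E` and does not
increase. Afterwards the weight is frozen, and the dissipation rate `1 / 5000000` over the constant
`9` of `Φ_le` gives `1 / 45000000`, in units of `1 / τ`. -/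
theorem E_le_of_hypocoercive {τ : ℝ} (hτ : 0 < τ) (hτ1 : τ ≤ 1) (hβ : |β| * τ ^ 2 = 1) {t : ℝ}
    (ht : τ ≤ t) :
    (F.frame t).E ≤ Real.exp (-(1 / 45000000) / τ * (t - τ)) * (F.frame 0).E := by
  have h1 : (F.frame τ).Φ β τ ≤ (F.frame 0).E := by
    have := image_le_of_deriv_right_le_deriv_boundary (a := 0) (b := τ)
      (f := fun s => (F.frame s).Φ β s) (B := fun _ => (F.frame 0).E) (B' := fun _ => 0)
      ((F.continuousOn_Φ (τ := fun s => s) continuousOn_id).mono Set.Icc_subset_Ici_self)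
      (fun x hx => F.hasDeriv_Φ (τ := fun s => s) hx.1 (hasDerivWithinAt_id x _))
      (by simp [ModeFrame.Φ]) continuousOn_const (fun x _ => hasDerivWithinAt_const _ _ _)
      (fun x hx => by
        have h := (F.frame x).dΦ_le (β := β) (σ := 1) hx.1 (hx.2.le.trans hτ1) zero_le_one le_rfl
        have h2 := (F.frame x).Δ_nonneg
        have h3 := (F.frame x).Γ_nonneg
        have h4 : 0 ≤ β ^ 2 * x ^ 2 * (F.frame x).Γ := by positivity
        linarith) (Set.right_mem_Icc.2 hτ.le)
    exact this
  have h2 := le_exp_of_hasDerivWithinAt_le (a := τ) (k := 1 / 45000000 / τ)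
    (q := fun s => (F.frame s).Φ β τ) (q' := fun s => (F.frame s).dΦ β τ 0)
    ((F.continuousOn_Φ (τ := fun _ => τ) continuousOn_const).mono (Set.Ici_subset_Ici.2 hτ.le))
    (fun s hs => F.hasDeriv_Φ (τ := fun _ => τ) (hτ.le.trans hs) (hasDerivWithinAt_const _ _ _))
    (fun s hs => by
      have a1 := (F.frame s).dΦ_le (β := β) (σ := 0) hτ.le hτ1 le_rfl zero_le_one
      have a2 := (F.frame s).Φ_le hτ.le hβ
      have a3 := (F.frame s).Δ_nonneg
      have a4 : 1 / 45000000 / τ * (F.frame s).Φ β τ ≤ 1 / 45000000 / τ *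
          (τ * (9 * ((F.frame s).Δ + β ^ 2 * τ ^ 2 * (F.frame s).Γ))) :=
        mul_le_mul_of_nonneg_left a2 (by positivity)
      have a5 : 1 / 45000000 / τ * (τ * (9 * ((F.frame s).Δ + β ^ 2 * τ ^ 2 * (F.frame s).Γ)))
          = 1 / 5000000 * ((F.frame s).Δ + β ^ 2 * τ ^ 2 * (F.frame s).Γ) := by
        field_simp
        ring
      rw [a5] at a4
      linarith) ht
  have h3 := (F.frame t).E_le_Φ β hτ.le
  have e : -(1 / 45000000 / τ) * (t - τ) = -(1 / 45000000) / τ * (t - τ) := by ring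
  rw [e] at h2
  exact h3.trans (h2.trans (mul_le_mul_of_nonneg_left h1 (Real.exp_pos _).le))

end ModeFlow

end

section

/-! ### Sections of the semigroup along one mode -/

variable {l : ℤ}

theorem memℓp_crd (hl : l ≠ 0) (ω : L20) : Memℓp (fun j : ℤ => crd ω (⟨l, hl⟩, j)) 2 := by
  rw [memℓp_gen_iff (by norm_num)]
  have h := (lp_summable_sq (freqBasis.repr ω)).comp_injective
    (Prod.mk_right_injective (⟨l, hl⟩ : {l : ℤ // l ≠ 0}))
  simpa [Function.comp_def, crd] using h

/-- The coefficients in `y` of the `l`-th mode in `x`. -/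
def modeSec (hl : l ≠ 0) : L20 →L[ℂ] Mode :=
  LinearMap.mkContinuous
    { toFun := fun ω => ⟨fun j => crd ω (⟨l, hl⟩, j), memℓp_crd hl ω⟩
      map_add' := fun f g => lp.ext (funext fun j => crd_add f g _)
      map_smul' := fun c f => lp.ext (funext fun j => crd_smul c f _) } 1 fun ω => by
    rw [one_mul, ← freqBasis.repr.norm_map ω]
    refine (pow_le_pow_iff_left₀ (norm_nonneg _) (norm_nonneg _) two_ne_zero).1 ?_
    rw [lp_norm_sq, lp_norm_sq]
    exact tsum_comp_le_tsum_of_inj (lp_summable_sq (freqBasis.repr ω)) (fun _ => sq_nonneg _)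
      (Prod.mk_right_injective (⟨l, hl⟩ : {l : ℤ // l ≠ 0}))

theorem modeSec_apply (hl : l ≠ 0) (ω : L20) (j : ℤ) :
    modeSec hl ω j = crd ω (⟨l, hl⟩, j) := rfl

theorem modeSec_sinOp (hl : l ≠ 0) (ω : L20) : modeSec hl (sinOp ω) = modeSin (modeSec hl ω) := by
  ext j
  rw [modeSec_apply, crd_sinOp, modeSin_apply, modeSec_apply, modeSec_apply]
  change (crd ω (⟨l, hl⟩, j + -1) - crd ω (⟨l, hl⟩, j + 1)) / (2 * Complex.I) = _
  rw [div_eq_iff (by simp)]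
  linear_combination (crd ω (⟨l, hl⟩, j + -1) - crd ω (⟨l, hl⟩, j + 1)) * Complex.I_sq

/-- The operator `1 - (l² - ∂²)⁻¹`. -/
def modeWt (hl : l ≠ 0) : Mode →L[ℂ] Mode := ContinuousLinearMap.id ℂ Mode - modeInv hl 0

theorem modeWt_apply (hl : l ≠ 0) (x : Mode) (j : ℤ) :
    modeWt hl x j = (1 - 1 / (modeLam l j : ℂ)) * x j := by
  change x j - 1 / (modeLam l j : ℂ) * x j = _
  ring

theorem modeSec_wtOp (hl : l ≠ 0) (ω : L20) : modeSec hl (wtOp ω) = modeWt hl (modeSec hl ω) := by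
  ext j
  rw [modeSec_apply, crd_wtOp, modeWt_apply, modeSec_apply]
  simp [Freq.wt, Freq.lam, modeLam]

theorem modeSec_of_isLAlpha (hl : l ≠ 0) {α : ℝ} {ω g : L20} (h : IsLAlpha α ω g) (j : ℤ) :
    modeSec hl g j = -(modeLam l j : ℂ) * modeSec hl ω j
      - ((α * l : ℝ) : ℂ) * Complex.I * modeSin (modeWt hl (modeSec hl ω)) j := by
  obtain ⟨a, ha, hg⟩ := (isLAlpha_iff _ _ _).1 h
  rw [← modeSec_wtOp, ← modeSec_sinOp, modeSec_apply, modeSec_apply, modeSec_apply, hg, ha]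
  push_cast
  rw [show modeLam l j = Freq.lam (⟨l, hl⟩, j) from rfl]
  ring

/-- The vorticity source `(l² - ∂²) u` expressed through `u` and its time derivative. -/
def modeSource (hl : l ≠ 0) (β : ℝ) (w v : Mode) : Mode :=
  -modeWt hl v - ((β : ℂ) * Complex.I) • modeWt hl (modeSin (modeWt hl w))

theorem modeSource_apply (hl : l ≠ 0) (β : ℝ) (w v : Mode) (j : ℤ) :
    modeSource hl β w v j = -((1 - 1 / (modeLam l j : ℂ)) * v j)
      - (β : ℂ) * Complex.I * ((1 - 1 / (modeLam l j : ℂ)) * modeSin (modeWt hl w) j) := by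
  rw [← modeWt_apply, ← modeWt_apply]; rfl

theorem modeSource_zero (hl : l ≠ 0) (β : ℝ) (w v : Mode) (h : l ^ 2 = 1) :
    modeSource hl β w v 0 = 0 := by
  have e : modeLam l 0 = 1 := by
    have : (l : ℝ) ^ 2 = 1 := by exact_mod_cast h
    rw [modeLam, this]; simp
  rw [modeSource_apply, e]
  simp

/-- Identifies the source built from `w` and `v` as `(l² - ∂²) u`. Building it from the time
derivative makes its continuity in time immediate for orbits starting in the domain. -/
theorem modeInv_modeSource (hl : l ≠ 0) {β : ℝ} {w v : Mode}
    (h : ∀ j, v j = -(modeLam l j : ℂ) * w j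
      - (β : ℂ) * Complex.I * modeSin (modeWt hl w) j) :
    modeInv hl 0 (modeSource hl β w v) = modeWt hl w := by
  ext j
  have h1 : (modeLam l j : ℂ) ≠ 0 :=
    Complex.ofReal_ne_zero.2 (by linarith [one_le_modeLam hl j])
  have e0 : modeInv hl 0 (modeSource hl β w v) j = 1 / (modeLam l j : ℂ) * modeSource hl β w v j :=
    rfl
  rw [e0, modeSource_apply, h, modeWt_apply]
  field_simp
  ring

theorem modeFrame_y (hl : l ≠ 0) (y : Mode) (hy : l ^ 2 = 1 → y 0 = 0) :
    (modeFrame hl y hy).y = y := modeInv_equation hl y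

/-- The projection of a mode along the kernel of `1 - (l² - ∂²)⁻¹`. -/
def modeQ (l : ℤ) : Mode →L[ℂ] Mode :=
  lpDiag (fun j => if l ^ 2 = 1 ∧ j = 0 then 0 else 1) 1 fun j => by split_ifs <;> simp

theorem modeQ_apply (l : ℤ) (x : Mode) (j : ℤ) :
    modeQ l x j = (if l ^ 2 = 1 ∧ j = 0 then 0 else 1) * x j := rfl

theorem norm_modeWt_apply (hl : l ≠ 0) (x : Mode) (j : ℤ) :
    ‖modeWt hl x j‖ = (1 - 1 / modeLam l j) * ‖x j‖ := by
  have h := one_le_modeLam hl j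
  have e : (1 - 1 / (modeLam l j : ℂ)) = ((1 - 1 / modeLam l j : ℝ) : ℂ) := by push_cast; rfl
  rw [modeWt_apply, norm_mul, e, Complex.norm_real, Real.norm_of_nonneg]
  rw [sub_nonneg]
  exact div_le_one_of_le₀ h (by linarith)

theorem not_and_of_two_le_modeLam {j : ℤ} (h : 2 ≤ modeLam l j) : ¬(l ^ 2 = 1 ∧ j = 0) := by
  rintro ⟨h1, rfl⟩
  have : (l : ℝ) ^ 2 = 1 := by exact_mod_cast h1
  rw [modeLam, this] at h
  norm_num at h

theorem norm_modeWt_le (hl : l ≠ 0) (x : Mode) : ‖modeWt hl x‖ ≤ ‖modeQ l x‖ := by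
  rw [← one_mul ‖modeQ l x‖]
  refine lp_norm_le_of_le zero_le_one fun j => ?_
  rw [norm_modeWt_apply, modeQ_apply, one_mul]
  rcases modeLam_eq_one_or hl j with ⟨h1, h2, h⟩ | h
  · rw [h, if_pos ⟨h1, h2⟩]; simp
  · rw [if_neg (not_and_of_two_le_modeLam h), one_mul]
    refine mul_le_of_le_one_left (norm_nonneg _) ?_
    have : 0 ≤ 1 / modeLam l j := by positivity
    linarith

/-- In coefficients `E = ∑ (1 - 1/λ) |w|²`, and `1 - 1/λ` lies in `[1/2, 1]` off the kernel. -/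
theorem modeFrame_E_bounds (hl : l ≠ 0) {y : Mode} (hy : l ^ 2 = 1 → y 0 = 0) {w : Mode}
    (h : modeInv hl 0 y = modeWt hl w) :
    ‖modeQ l w‖ ^ 2 ≤ 2 * (modeFrame hl y hy).E ∧ (modeFrame hl y hy).E ≤ ‖modeQ l w‖ ^ 2 := by
  obtain ⟨e, hs⟩ := inner_modeInvSub hl (modeWt hl w)
  have hE : (modeFrame hl y hy).E = ∑' j, (‖modeWt hl w j‖ ^ 2
      + ‖modeWt hl w j‖ ^ 2 / (modeLam l j - 1)) := by
    rw [(lp_summable_sq _).tsum_add hs, ← e, ← lp_norm_sq, ← h]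
    rfl
  have hsum := (lp_summable_sq (modeWt hl w)).add hs
  have key : ∀ j, ‖modeQ l w j‖ ^ 2 ≤ 2 * (‖modeWt hl w j‖ ^ 2
      + ‖modeWt hl w j‖ ^ 2 / (modeLam l j - 1)) ∧ (‖modeWt hl w j‖ ^ 2
      + ‖modeWt hl w j‖ ^ 2 / (modeLam l j - 1)) ≤ ‖modeQ l w j‖ ^ 2 := by
    intro j
    rw [norm_modeWt_apply, modeQ_apply]
    rcases modeLam_eq_one_or hl j with ⟨h1, h2, h⟩ | h
    · rw [h, if_pos ⟨h1, h2⟩]; simp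
    · rw [if_neg (not_and_of_two_le_modeLam h), one_mul]
      have h1 : (0 : ℝ) < modeLam l j - 1 := by linarith
      have h2 : (0 : ℝ) < modeLam l j := by linarith
      have e1 : ((1 - 1 / modeLam l j) * ‖w j‖) ^ 2
          + ((1 - 1 / modeLam l j) * ‖w j‖) ^ 2 / (modeLam l j - 1)
          = (1 - 1 / modeLam l j) * ‖w j‖ ^ 2 := by
        field_simp
        ring
      have h3 : 1 / modeLam l j ≤ 1 / 2 := one_div_le_one_div_of_le (by norm_num) h
      have h4 : 0 ≤ 1 / modeLam l j := by positivity
      rw [e1]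
      constructor <;> nlinarith [sq_nonneg ‖w j‖]
  rw [hE, lp_norm_sq, ← tsum_mul_left]
  exact ⟨(lp_summable_sq _).tsum_le_tsum (fun j => (key j).1) (hsum.mul_left 2),
    hsum.tsum_le_tsum (fun j => (key j).2) (lp_summable_sq _)⟩

/-! ### Orbits of the semigroup as mode flows -/

variable {α : ℝ} {S : ℝ → L20 →L[ℂ] L20} {f g : L20}

theorem modeInv_modeSource_orbit (hS : IsSemigroupGeneratedBy S (IsLAlpha α))
    (hfg : IsLAlpha α f g) (hl : l ≠ 0) {t : ℝ} (ht : 0 ≤ t) :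
    modeInv hl 0 (modeSource hl (α * l) (modeSec hl (S t f)) (modeSec hl (S t g)))
      = modeWt hl (modeSec hl (S t f)) :=
  modeInv_modeSource hl (modeSec_of_isLAlpha hl (hS.generator_orbit hfg ht))

theorem hasDerivWithinAt_modeSec (hS : IsSemigroupGeneratedBy S (IsLAlpha α))
    (hfg : IsLAlpha α f g) (hl : l ≠ 0) {t : ℝ} (ht : 0 ≤ t) :
    HasDerivWithinAt (fun s => modeSec hl (S s f)) (modeSec hl (S t g)) (Set.Ici t) t :=
  ((modeSec hl).restrictScalars ℝ).hasFDerivAt.comp_hasDerivWithinAt t (hS.hasDerivWithinAt hfg ht)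

theorem continuousOn_modeSec (hS : IsSemigroupGeneratedBy S (IsLAlpha α)) (hl : l ≠ 0) (f : L20) :
    ContinuousOn (fun t => modeSec hl (S t f)) (Set.Ici 0) :=
  (modeSec hl).continuous.comp_continuousOn (hS.continuousOn f)

theorem continuousOn_modeSource (hS : IsSemigroupGeneratedBy S (IsLAlpha α)) (hl : l ≠ 0)
    (f g : L20) : ContinuousOn
      (fun t => modeSource hl (α * l) (modeSec hl (S t f)) (modeSec hl (S t g))) (Set.Ici 0) := by
  have h1 := (modeWt hl).continuous.comp_continuousOn (continuousOn_modeSec hS hl g)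
  have h2 := (modeWt hl).continuous.comp_continuousOn (modeSin.continuous.comp_continuousOn
    ((modeWt hl).continuous.comp_continuousOn (continuousOn_modeSec hS hl f)))
  exact h1.neg.sub (h2.const_smul (((α * l : ℝ) : ℂ) * Complex.I))

/-- The evolution of the `l`-th mode of an orbit of the semigroup. -/
def modeFlow (hS : IsSemigroupGeneratedBy S (IsLAlpha α)) (hfg : IsLAlpha α f g) (hl : l ≠ 0) :
    ModeFlow modeTrig |(l : ℝ)| (α * l) where
  frame t := modeFrame hl (modeSource hl (α * l) (modeSec hl (S t f)) (modeSec hl (S t g)))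
    (modeSource_zero hl _ _ _)
  continuousOn_u := (modeInv hl 0).continuous.comp_continuousOn (continuousOn_modeSource hS hl f g)
  continuousOn_u₁ := (modeInv hl 1).continuous.comp_continuousOn (continuousOn_modeSource hS hl f g)
  continuousOn_y := by
    simp only [modeFrame_y]
    exact continuousOn_modeSource hS hl f g
  continuousOn_h := (modeInv hl 0).continuous.comp_continuousOn
    (modeSin.continuous.comp_continuousOn
      ((modeInv hl 0).continuous.comp_continuousOn (continuousOn_modeSource hS hl f g)))
  continuousOn_ψ := (modeInvSub hl 0).continuous.comp_continuousOn
    ((modeInv hl 0).continuous.comp_continuousOn (continuousOn_modeSource hS hl f g))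
  hasDeriv t ht := by
    have h1 : HasDerivWithinAt (fun s => modeWt hl (modeSec hl (S s f)))
        (modeWt hl (modeSec hl (S t g))) (Set.Ici t) t :=
      ((modeWt hl).restrictScalars ℝ).hasFDerivAt.comp_hasDerivWithinAt t
        (hasDerivWithinAt_modeSec hS hfg hl ht)
    have h2 : modeWt hl (modeSec hl (S t g)) = (modeFrame hl (modeSource hl (α * l)
        (modeSec hl (S t f)) (modeSec hl (S t g))) (modeSource_zero hl _ _ _)).rhs (α * l) := by
      rw [ModeFrame.rhs, modeFrame_y]
      ext j
      change _ = -modeSource hl (α * l) (modeSec hl (S t f)) (modeSec hl (S t g)) j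
        - ((α * l : ℝ) : ℂ) * (Complex.I * (modeSin (modeInv hl 0 (modeSource hl (α * l)
        (modeSec hl (S t f)) (modeSec hl (S t g)))) j - 1 / (modeLam l j : ℂ) * modeSin
        (modeInv hl 0 (modeSource hl (α * l) (modeSec hl (S t f)) (modeSec hl (S t g)))) j))
      rw [modeInv_modeSource_orbit hS hfg hl ht, modeSource_apply, modeWt_apply]
      ring
    rw [h2] at h1
    refine h1.congr (fun s hs => ?_) ?_
    · exact modeInv_modeSource_orbit hS hfg hl (ht.trans (Set.mem_Ici.1 hs))
    · exact modeInv_modeSource_orbit hS hfg hl ht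

theorem norm_modeQ_le_of_E_le (hS : IsSemigroupGeneratedBy S (IsLAlpha α))
    (hfg : IsLAlpha α f g) (hl : l ≠ 0) {t x : ℝ} (ht : 0 ≤ t)
    (h : ((modeFlow hS hfg hl).frame t).E ≤ Real.exp (2 * x) * ((modeFlow hS hfg hl).frame 0).E) :
    ‖modeQ l (modeSec hl (S t f))‖ ≤ 2 * Real.exp x * ‖modeQ l (modeSec hl f)‖ := by
  have h1 := (modeFrame_E_bounds hl (modeSource_zero hl _ _ _)
    (modeInv_modeSource_orbit hS hfg hl ht)).1
  have h2 := (modeFrame_E_bounds hl (modeSource_zero hl _ _ _)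
    (modeInv_modeSource_orbit hS hfg hl le_rfl)).2
  rw [hS.zero] at h2
  have h3 : Real.exp (2 * x) = Real.exp x ^ 2 := by rw [two_mul, Real.exp_add, sq]
  have h4 : ‖modeQ l (modeSec hl (S t f))‖ ^ 2 ≤ 2 * (Real.exp x ^ 2 *
      ‖modeQ l (modeSec hl f)‖ ^ 2) := by
    refine h1.trans (mul_le_mul_of_nonneg_left (h.trans ?_) zero_le_two)
    rw [h3]
    refine mul_le_mul_of_nonneg_left ?_ (by positivity)
    have e : (modeFlow hS hfg hl).frame 0 = modeFrame hl (modeSource hl (α * l)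
      (modeSec hl (S 0 f)) (modeSec hl (S 0 g))) (modeSource_zero hl _ _ _) := rfl
    rw [e, hS.zero]
    exact h2
  refine (pow_le_pow_iff_left₀ (norm_nonneg _) (by positivity) two_ne_zero).1 ?_
  rw [mul_pow, mul_pow]
  nlinarith [sq_nonneg (Real.exp x * ‖modeQ l (modeSec hl f)‖)]

theorem norm_modeQ_le (hS : IsSemigroupGeneratedBy S (IsLAlpha α))
    (hfg : IsLAlpha α f g) (hl : l ≠ 0) {t : ℝ} (ht : 0 ≤ t) :
    ‖modeQ l (modeSec hl (S t f))‖ ≤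
      2 * Real.exp (-(l : ℝ) ^ 2 * t) * ‖modeQ l (modeSec hl f)‖ := by
  refine norm_modeQ_le_of_E_le hS hfg hl ht ?_
  have h := (modeFlow hS hfg hl).E_le_exp ht
  rw [sq_abs] at h
  have e : 2 * (-(l : ℝ) ^ 2 * t) = -(2 * (l : ℝ) ^ 2) * t := by ring
  rwa [e]

/-- Passing from `E` to norms halves the exponent. The waiting time `|β|^{-1/2}` costs a factor
`e^{1/90000000} ≤ 2`; before that time the basic decay already suffices, so the bound holds for all
`t ≥ 0`. -/
theorem norm_modeQ_le_enhanced (hS : IsSemigroupGeneratedBy S (IsLAlpha α))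
    (hfg : IsLAlpha α f g) (hl : l ≠ 0) (hβ : 1 ≤ |α * l|) {t : ℝ} (ht : 0 ≤ t) :
    ‖modeQ l (modeSec hl (S t f))‖ ≤
      4 * Real.exp (-(1 / 90000000) * √|α * l| * t) * ‖modeQ l (modeSec hl f)‖ := by
  set r := √|α * l| with hr
  have hr1 : 1 ≤ r := Real.one_le_sqrt.2 hβ
  have hr2 : r ^ 2 = |α * l| := Real.sq_sqrt (abs_nonneg _)
  have hexp : Real.exp (1 / 90000000 : ℝ) ≤ 2 := by
    have h1 : (1 / 90000000 : ℝ) ≤ Real.log 2 := by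
      have := Real.log_two_gt_d9
      linarith
    calc Real.exp (1 / 90000000 : ℝ) ≤ Real.exp (Real.log 2) := Real.exp_le_exp.2 h1
      _ = 2 := Real.exp_log two_pos
  have key : ∀ x : ℝ, x ≤ 1 / 90000000 - 1 / 90000000 * r * t →
      2 * Real.exp x ≤ 4 * Real.exp (-(1 / 90000000) * r * t) := by
    intro x hx
    have h1 : Real.exp x ≤ Real.exp (1 / 90000000) * Real.exp (-(1 / 90000000) * r * t) := by
      rw [← Real.exp_add]
      exact Real.exp_le_exp.2 (by linarith)
    nlinarith [Real.exp_pos (-(1 / 90000000) * r * t)]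
  rcases le_total (1 / r) t with h | h
  · have h0 := (modeFlow hS hfg hl).E_le_of_hypocoercive (τ := 1 / r) (by positivity)
      (div_le_one_of_le₀ hr1 (by positivity)) (by rw [← hr2]; field_simp) h
    have e : -(1 / 45000000) / (1 / r) * (t - 1 / r)
        = 2 * (1 / 90000000 - 1 / 90000000 * r * t) := by
      field_simp
      ring
    rw [e] at h0
    exact (norm_modeQ_le_of_E_le hS hfg hl ht h0).trans
      (mul_le_mul_of_nonneg_right (key _ le_rfl) (norm_nonneg _))
  · refine (norm_modeQ_le hS hfg hl ht).trans (mul_le_mul_of_nonneg_right (key _ ?_)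
      (norm_nonneg _))
    have h1 : r * t ≤ 1 := by
      rw [le_div_iff₀ (by positivity)] at h
      linarith
    have h2 : 0 ≤ (l : ℝ) ^ 2 * t := by positivity
    linarith

end

section

/-! ### The mean of the modes `l = ±1` -/

/-- After multiplication by `e^t` the forcing is at most `R e^{-(k-1)t}`, and `k ≥ 2` bounds this by
`R e^{-kt/2}`, whose total integral is `2 R / k`. -/
theorem norm_le_of_forced_decay {v v' : ℝ → ℂ} {k R : ℝ} (hk : 2 ≤ k)
    (hR : 0 ≤ R) (hv : ContinuousOn v (Set.Ici 0))
    (hd : ∀ t, 0 ≤ t → HasDerivWithinAt v (v' t) (Set.Ici t) t)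
    (hle : ∀ t, 0 ≤ t → ‖v t + v' t‖ ≤ R * Real.exp (-k * t)) {t : ℝ} (ht : 0 ≤ t) :
    ‖v t‖ ≤ Real.exp (-t) * (‖v 0‖ + 2 * R / k) := by
  have hk0 : 0 < k := by linarith
  have hB : ∀ x : ℝ, HasDerivAt (fun s => ‖v 0‖ + 2 * R / k * (1 - Real.exp (-(k / 2) * s)))
      (R * Real.exp (-(k / 2) * x)) x := by
    intro x
    have h1 : HasDerivAt (fun s : ℝ => -(k / 2) * s) (-(k / 2)) x := by
      simpa using (hasDerivAt_id x).const_mul (-(k / 2))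
    refine (((h1.exp.const_sub 1).const_mul (2 * R / k)).const_add ‖v 0‖).congr_deriv ?_
    field_simp
  have h := image_norm_le_of_norm_deriv_right_le_deriv_boundary (a := 0) (b := t)
    (f := fun s : ℝ => Real.exp s • v s) (f' := fun s => Real.exp s • v' s + Real.exp s • v s)
    ((Real.continuous_exp.continuousOn).smul (hv.mono Set.Icc_subset_Ici_self))
    (fun x hx => (Real.hasDerivAt_exp x).hasDerivWithinAt.smul (hd x hx.1)) (by simp) hB
    (fun x hx => by
      rw [← smul_add, norm_smul, Real.norm_of_nonneg (Real.exp_pos _).le, add_comm]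
      calc Real.exp x * ‖v x + v' x‖ ≤ Real.exp x * (R * Real.exp (-k * x)) :=
            mul_le_mul_of_nonneg_left (hle x hx.1) (Real.exp_pos _).le
        _ = R * Real.exp (x + -k * x) := by rw [Real.exp_add]; ring
        _ ≤ R * Real.exp (-(k / 2) * x) := by
            refine mul_le_mul_of_nonneg_left (Real.exp_le_exp.2 ?_) hR
            nlinarith [hx.1]) (Set.right_mem_Icc.2 ht)
  rw [norm_smul, Real.norm_of_nonneg (Real.exp_pos _).le] at h
  have h1 : ‖v 0‖ + 2 * R / k * (1 - Real.exp (-(k / 2) * t)) ≤ ‖v 0‖ + 2 * R / k := by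
    have : 0 ≤ 2 * R / k * Real.exp (-(k / 2) * t) := by positivity
    linarith
  have h2 := mul_le_mul_of_nonneg_left (h.trans h1) (Real.exp_pos (-t)).le
  rw [← mul_assoc, ← Real.exp_add, neg_add_cancel, Real.exp_zero, one_mul] at h2
  exact h2

theorem norm_sum_mul_le (s : Finset ℤ) (a : ℤ → ℂ) {M : ℝ} (hM : ∀ k ∈ s, ‖a k‖ ≤ M)
    (x : Mode) : ‖∑ k ∈ s, a k * x k‖ ≤ M * √s.card * ‖x‖ := by
  rcases s.eq_empty_or_nonempty with rfl | ⟨k₀, hk₀⟩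
  · simp
  have hM0 : 0 ≤ M := (norm_nonneg _).trans (hM k₀ hk₀)
  have h1 : ‖∑ k ∈ s, a k * x k‖ ≤ M * ∑ k ∈ s, ‖x k‖ := by
    rw [Finset.mul_sum]
    refine (norm_sum_le _ _).trans (Finset.sum_le_sum fun k hk => ?_)
    rw [norm_mul]
    exact mul_le_mul_of_nonneg_right (hM k hk) (norm_nonneg _)
  have h2 : ∑ k ∈ s, ‖x k‖ ≤ √s.card * ‖x‖ := by
    rw [← Real.sqrt_sq (norm_nonneg x), ← Real.sqrt_mul (Nat.cast_nonneg _)]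
    refine Real.le_sqrt_of_sq_le (sq_sum_le_card_mul_sum_sq.trans ?_)
    refine mul_le_mul_of_nonneg_left ?_ (Nat.cast_nonneg _)
    rw [lp_norm_sq]
    exact (lp_summable_sq x).sum_le_tsum s fun _ _ => sq_nonneg _
  rw [mul_assoc]
  exact h1.trans (mul_le_mul_of_nonneg_left h2 hM0)

/-! ### The corrector for the mean -/

/-- The hat function of width `N`. -/
def hat (N : ℕ) (k : ℤ) : ℝ := max (1 - |(k : ℝ)| / N) 0

variable {N : ℕ}

theorem hat_zero (N : ℕ) : hat N 0 = 1 := by simp [hat]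

theorem hat_nonneg (N : ℕ) (k : ℤ) : 0 ≤ hat N k := le_max_right _ _

theorem hat_le_one (N : ℕ) (k : ℤ) : hat N k ≤ 1 :=
  max_le (by have : 0 ≤ |(k : ℝ)| / N := by positivity
             linarith) zero_le_one

theorem hat_eq_zero (hN : 1 ≤ N) {k : ℤ} (hk : (N : ℤ) ≤ |k|) : hat N k = 0 := by
  have h0 : (0 : ℝ) < N := by exact_mod_cast hN
  have h1 : (N : ℝ) ≤ |(k : ℝ)| := by exact_mod_cast hk
  refine max_eq_right ?_
  rw [sub_nonpos, le_div_iff₀ h0, one_mul]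
  exact h1

theorem abs_hat_sub_hat_le (hN : 1 ≤ N) (k : ℤ) : |hat N (k + -1) - hat N (k + 1)| ≤ 2 / N := by
  have h0 : (0 : ℝ) < N := by exact_mod_cast hN
  refine (abs_max_sub_max_le_abs _ _ _).trans ?_
  push_cast
  have h1 : |(|(k : ℝ) + 1| - |(k : ℝ) + -1|)| ≤ 2 := by
    refine (abs_abs_sub_abs_le _ _).trans ?_
    have : (k : ℝ) + 1 - (k + -1) = 2 := by ring
    rw [this]
    norm_num
  have e : 1 - |(k : ℝ) + -1| / N - (1 - |(k : ℝ) + 1| / N)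
      = (|(k : ℝ) + 1| - |(k : ℝ) + -1|) / N := by ring
  rw [e, abs_div, abs_of_pos h0]
  exact div_le_div_of_nonneg_right h1 h0.le

/-- The hat vanishes already at `|k| = N`, so a shift by one moves nothing across the ends of the
window. -/
theorem sum_hat_mul_shift (hN : 1 ≤ N) (x : ℤ → ℂ) {e : ℤ} (he : |e| ≤ 1) :
    ∑ k ∈ Finset.Icc (-(N : ℤ)) N, (hat N k : ℂ) * x (k + e)
      = ∑ k ∈ Finset.Icc (-(N : ℤ)) N, (hat N (k + -e) : ℂ) * x k := by
  have h1 : ∀ k ∉ Finset.Icc (-(N : ℤ)) N, (hat N k : ℂ) * x (k + e) = 0 := by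
    intro k hk
    rw [Finset.mem_Icc, ← abs_le, not_le] at hk
    rw [hat_eq_zero hN hk.le, Complex.ofReal_zero, zero_mul]
  have h2 : ∀ k ∉ Finset.Icc (-(N : ℤ)) N, (hat N (k + -e) : ℂ) * x k = 0 := by
    intro k hk
    rw [Finset.mem_Icc, ← abs_le, not_le] at hk
    have h3 : |k| ≤ |k + -e| + |e| := by
      have := abs_add_le (k + -e) e
      rwa [neg_add_cancel_right] at this
    rw [hat_eq_zero hN (by omega), Complex.ofReal_zero, zero_mul]
  rw [← tsum_eq_sum (L := .unconditional ℤ) h1, ← tsum_eq_sum (L := .unconditional ℤ) h2,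
    ← (Equiv.addRight e).tsum_eq fun k => (hat N (k + -e) : ℂ) * x k]
  refine tsum_congr fun k => ?_
  simp

/-- Summation by parts: `sin y` becomes a symmetric difference of the hat, of size `1 / N`. This is
the gain from the vanishing of `sin y` at `y = 0`. -/
theorem sum_hat_mul_modeSin (hN : 1 ≤ N) (x : Mode) :
    ∑ k ∈ Finset.Icc (-(N : ℤ)) N, (hat N k : ℂ) * modeSin x k
      = ∑ k ∈ Finset.Icc (-(N : ℤ)) N,
        (Complex.I / 2 * ((hat N (k + -1) - hat N (k + 1) : ℝ) : ℂ)) * x k := by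
  have h1 := sum_hat_mul_shift hN x (e := 1) (by norm_num)
  have h2 := sum_hat_mul_shift hN x (e := -1) (by norm_num)
  rw [neg_neg] at h2
  have e1 : ∑ k ∈ Finset.Icc (-(N : ℤ)) N, (hat N k : ℂ) * modeSin x k
      = Complex.I / 2 * (∑ k ∈ Finset.Icc (-(N : ℤ)) N, (hat N k : ℂ) * x (k + 1)
        - ∑ k ∈ Finset.Icc (-(N : ℤ)) N, (hat N k : ℂ) * x (k + -1)) := by
    rw [← Finset.sum_sub_distrib, Finset.mul_sum]
    refine Finset.sum_congr rfl fun k _ => ?_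
    rw [modeSin_apply]
    ring
  rw [e1, h1, h2, ← Finset.sum_sub_distrib, Finset.mul_sum]
  refine Finset.sum_congr rfl fun k _ => ?_
  push_cast
  ring

/-- The coefficients of the corrector; they vanish at `k = 0`. -/
def corr (N : ℕ) (k : ℤ) : ℝ := -(hat N k * (1 + (k : ℝ) ^ 2) / (k : ℝ) ^ 2)

theorem abs_corr_le (N : ℕ) (k : ℤ) : |corr N k| ≤ 2 := by
  rcases eq_or_ne k 0 with rfl | hk
  · simp [corr]
  have h1 := one_le_cast_sq hk
  rw [corr, abs_neg, abs_of_nonneg (div_nonneg (mul_nonneg (hat_nonneg _ _) (by positivity))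
    (by positivity)), div_le_iff₀ (by linarith)]
  have := mul_le_mul_of_nonneg_right (hat_le_one N k) (by positivity : 0 ≤ 1 + (k : ℝ) ^ 2)
  linarith

theorem corr_zero (N : ℕ) : corr N 0 = 0 := by simp [corr]

/-- The corrector as a functional. -/
def corrSum (N : ℕ) (x : Mode) : ℂ := ∑ k ∈ Finset.Icc (-(N : ℤ)) N, (corr N k : ℂ) * x k

/-- The coefficients of the remainder. -/
def remCoeff (N : ℕ) (β : ℝ) (k : ℤ) : ℝ :=
  corr N k * (k : ℝ) ^ 2 + β / 2 * (hat N (k + -1) - hat N (k + 1))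

/-- Diffusion acting on the corrector costs `N²`, and the mollified transport costs `|β| / N`; the
two balance when `N³` is of order `|β|`. -/
theorem abs_remCoeff_le (hN : 1 ≤ N) (β : ℝ) {k : ℤ} (hk : |k| ≤ N) :
    |remCoeff N β k| ≤ 2 * (N : ℝ) ^ 2 + |β| / N := by
  have h0 : (1 : ℝ) ≤ N := by exact_mod_cast hN
  have h1 : |corr N k * (k : ℝ) ^ 2| ≤ 2 * (N : ℝ) ^ 2 := by
    rw [abs_mul, abs_of_nonneg (sq_nonneg (k : ℝ))]
    have h2 : |(k : ℝ)| ≤ N := by exact_mod_cast hk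
    have h3 : (k : ℝ) ^ 2 ≤ (N : ℝ) ^ 2 := by
      rw [← sq_abs]; exact pow_le_pow_left₀ (abs_nonneg _) h2 2
    exact mul_le_mul (abs_corr_le _ _) h3 (sq_nonneg _) zero_le_two
  have h2 : |β / 2 * (hat N (k + -1) - hat N (k + 1))| ≤ |β| / N := by
    rw [abs_mul, abs_div, abs_two]
    calc |β| / 2 * |hat N (k + -1) - hat N (k + 1)| ≤ |β| / 2 * (2 / N) :=
          mul_le_mul_of_nonneg_left (abs_hat_sub_hat_le hN k) (by positivity)
      _ = |β| / N := by field_simp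
  exact (abs_add_le _ _).trans (add_le_add h1 h2)

/-- The equation satisfied by the corrected mean. -/
theorem corrected_mean_equation {l : ℤ} (hl : l ≠ 0) (h1 : l ^ 2 = 1) (hN : 1 ≤ N) {β : ℝ}
    {w v : Mode} (h : ∀ j, v j = -(modeLam l j : ℂ) * w j
      - (β : ℂ) * Complex.I * modeSin (modeWt hl w) j) :
    (w 0 - corrSum N (modeWt hl w)) + (v 0 - corrSum N (modeWt hl v))
      = ∑ k ∈ Finset.Icc (-(N : ℤ)) N, (remCoeff N β k : ℂ) * modeWt hl w k := by
  have hlam : ∀ k, (modeLam l k : ℂ) = 1 + (k : ℂ) ^ 2 := by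
    intro k
    have : (l : ℂ) ^ 2 = 1 := by exact_mod_cast h1
    simp [modeLam, this]
  have hlam0 : ∀ k : ℤ, (1 + (k : ℂ) ^ 2) ≠ 0 := by
    intro k
    rw [← hlam]
    exact Complex.ofReal_ne_zero.2 (by linarith [one_le_modeLam hl k])
  -- For `k ≠ 0` the factor `(1 + k²) / k²` in `corr` undoes the multiplier `1 - 1 / (1 + k²)`,
  -- leaving `-hat N k * v k`. The transport contribution at `k = 0` is absent here. It is supplied
  -- by the equation for the mean itself, and since `hat N 0 = 1` the two complete the full hat sum.
  have key : ∀ k : ℤ, (corr N k : ℂ) * modeWt hl v k = -(corr N k : ℂ) * (1 + (k : ℂ) ^ 2)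
      * modeWt hl w k + (β : ℂ) * Complex.I * ((hat N k : ℂ) * modeSin (modeWt hl w) k)
      - if k = 0 then (β : ℂ) * Complex.I * modeSin (modeWt hl w) 0 else 0 := by
    intro k
    split_ifs with hk
    · subst hk
      simp [corr_zero, hat_zero]
    · have hk' : (k : ℂ) ≠ 0 := Int.cast_ne_zero.2 hk
      have hh := hlam0 k
      rw [modeWt_apply hl v, h, modeWt_apply hl w k, hlam]
      simp only [corr]
      push_cast
      field_simp
      ring
  have h0 : (0 : ℤ) ∈ Finset.Icc (-(N : ℤ)) N := by simp
  have e1 : corrSum N (modeWt hl v) = ∑ k ∈ Finset.Icc (-(N : ℤ)) N,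
      (-(corr N k : ℂ) * (1 + (k : ℂ) ^ 2) * modeWt hl w k)
      + (β : ℂ) * Complex.I * ∑ k ∈ Finset.Icc (-(N : ℤ)) N,
        (Complex.I / 2 * ((hat N (k + -1) - hat N (k + 1) : ℝ) : ℂ)) * modeWt hl w k
      - (β : ℂ) * Complex.I * modeSin (modeWt hl w) 0 := by
    rw [corrSum, Finset.sum_congr rfl fun k _ => key k, Finset.sum_sub_distrib,
      Finset.sum_add_distrib, ← Finset.mul_sum, sum_hat_mul_modeSin hN, Finset.sum_ite_eq' _ 0,
      if_pos h0]
  have e2 : ∑ k ∈ Finset.Icc (-(N : ℤ)) N, (remCoeff N β k : ℂ) * modeWt hl w k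
      = -corrSum N (modeWt hl w) - ∑ k ∈ Finset.Icc (-(N : ℤ)) N,
        (-(corr N k : ℂ) * (1 + (k : ℂ) ^ 2) * modeWt hl w k)
      - (β : ℂ) * Complex.I * ∑ k ∈ Finset.Icc (-(N : ℤ)) N,
        (Complex.I / 2 * ((hat N (k + -1) - hat N (k + 1) : ℝ) : ℂ)) * modeWt hl w k := by
    rw [corrSum, ← Finset.sum_neg_distrib, Finset.mul_sum, ← Finset.sum_sub_distrib,
      ← Finset.sum_sub_distrib]
    refine Finset.sum_congr rfl fun k _ => ?_
    rw [remCoeff]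
    push_cast
    linear_combination (1 / 2 : ℂ) * (β : ℂ) * (((hat N (k + -1) : ℝ) : ℂ)
      - ((hat N (k + 1) : ℝ) : ℂ)) * modeWt hl w k * Complex.I_sq
  rw [e1, e2, h 0, hlam]
  push_cast
  ring

theorem corrSum_add (N : ℕ) (x y : Mode) : corrSum N (x + y) = corrSum N x + corrSum N y := by
  simp [corrSum, mul_add, Finset.sum_add_distrib]

theorem corrSum_smul (N : ℕ) (c : ℂ) (x : Mode) : corrSum N (c • x) = c * corrSum N x := by
  simp only [corrSum, Finset.mul_sum]
  refine Finset.sum_congr rfl fun k _ => ?_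
  simp only [lp.coeFn_smul, Pi.smul_apply, smul_eq_mul]
  ring

theorem card_Icc_neg (N : ℕ) : ((Finset.Icc (-(N : ℤ)) N).card : ℝ) = 2 * N + 1 := by
  rw [Int.card_Icc]
  have : ((N : ℤ) + 1 - -N).toNat = 2 * N + 1 := by omega
  rw [this]
  push_cast
  ring

theorem norm_corrSum_le (N : ℕ) (x : Mode) : ‖corrSum N x‖ ≤ 2 * √(2 * N + 1) * ‖x‖ := by
  have h := norm_sum_mul_le (Finset.Icc (-(N : ℤ)) N) (fun k => (corr N k : ℂ)) (M := 2)
    (fun k _ => by rw [Complex.norm_real]; exact abs_corr_le N k) x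
  rwa [card_Icc_neg] at h

/-- The corrected mean `w ↦ w₀ - Z(u)` as a continuous functional. -/
def correctedMean {l : ℤ} (hl : l ≠ 0) (N : ℕ) : Mode →L[ℂ] ℂ :=
  LinearMap.mkContinuous
    { toFun := fun w => w 0 - corrSum N (modeWt hl w)
      map_add' := fun x y => by
        rw [map_add, corrSum_add, lp.coeFn_add, Pi.add_apply]
        ring
      map_smul' := fun c x => by
        rw [map_smul, corrSum_smul, lp.coeFn_smul, Pi.smul_apply, smul_eq_mul, RingHom.id_apply,
          smul_eq_mul]
        ring } (1 + 2 * √(2 * N + 1) * ‖modeWt hl‖) fun x => by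
    refine (norm_sub_le _ _).trans ?_
    have h1 : ‖x 0‖ ≤ ‖x‖ := lp.norm_apply_le_norm two_ne_zero x 0
    have h2 := norm_corrSum_le N (modeWt hl x)
    have h3 := mul_le_mul_of_nonneg_left ((modeWt hl).le_opNorm x)
      (by positivity : 0 ≤ 2 * √(2 * (N : ℝ) + 1))
    linarith

theorem correctedMean_apply {l : ℤ} (hl : l ≠ 0) (N : ℕ) (w : Mode) :
    correctedMean hl N w = w 0 - corrSum N (modeWt hl w) := rfl

theorem exists_width {b : ℝ} (hb : 1 ≤ b) : ∃ N : ℕ, 1 ≤ N ∧ b ≤ N ∧ (N : ℝ) ≤ 2 * b := by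
  refine ⟨⌈b⌉₊, Nat.one_le_ceil_iff.2 (by linarith), Nat.le_ceil b, ?_⟩
  have := Nat.ceil_lt_add_one (by linarith : 0 ≤ b)
  linarith

/-- With `N` of order `b = |β|^{1/3}`, the remainder has coefficients of order `b²` on about `b`
frequencies, hence forcing of order `b^{5/2} ‖u‖`. Time integration against the enhanced decay gains
`b^{-3/2}`, which leaves `b`. The corrector itself has norm of order at most `b`. -/
theorem norm_mean_le {α : ℝ} {S : ℝ → L20 →L[ℂ] L20} {f g : L20} {l : ℤ}
    (hS : IsSemigroupGeneratedBy S (IsLAlpha α)) (hfg : IsLAlpha α f g) (hl : l ≠ 0)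
    (h1 : l ^ 2 = 1) {b : ℝ} (hb : 1 ≤ b) (hb3 : b ^ 3 = |α * l|)
    (hβ : 180000000 ≤ √|α * l|) {t : ℝ} (ht : 0 ≤ t) :
    ‖modeSec hl (S t f) 0‖ ≤ 20000000000 * b * Real.exp (-t) * ‖modeQ l (modeSec hl f)‖
      + Real.exp (-t) * ‖modeSec hl f 0‖ := by
  obtain ⟨N, hN, hbN, hNb⟩ := exists_width hb
  set r := √|α * l| with hr
  set q := ‖modeQ l (modeSec hl f)‖ with hq
  set k := 1 / 90000000 * r with hk
  have hk2 : 2 ≤ k := by rw [hk]; linarith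
  have hr2 : r ^ 2 = |α * l| := Real.sq_sqrt (abs_nonneg _)
  have hβ1 : 1 ≤ |α * l| := by rw [← hr2]; nlinarith
  have hr0 : 0 < r := by linarith
  have hq0 : 0 ≤ q := norm_nonneg _
  have hu : ∀ s, 0 ≤ s → ‖modeWt hl (modeSec hl (S s f))‖ ≤ 4 * Real.exp (-k * s) * q := by
    intro s hs
    have h := (norm_modeWt_le hl _).trans (norm_modeQ_le_enhanced hS hfg hl hβ1 hs)
    have e : -(1 / 90000000) * √|α * l| * s = -k * s := by rw [hk]; ring
    rwa [e] at h
  set D := √(2 * (N : ℝ) + 1) with hD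
  -- Both `√N · b` and `r = |β|^{1/2}` are of order `b^{3/2}`, because `b³ = r²`.
  have hDb : D * b ≤ 3 * r := by
    have hD2 : D ^ 2 = 2 * N + 1 := Real.sq_sqrt (by positivity)
    refine (pow_le_pow_iff_left₀ (by positivity) (by positivity) two_ne_zero).1 ?_
    rw [mul_pow, mul_pow, hr2, ← hb3, hD2]
    have : (2 * (N : ℝ) + 1) ≤ 9 * b := by linarith
    nlinarith [mul_le_mul_of_nonneg_right this (sq_nonneg b)]
  have hD3 : D ≤ 3 * b := by
    have hD2 : D ^ 2 = 2 * N + 1 := Real.sq_sqrt (by positivity)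
    refine (pow_le_pow_iff_left₀ (by positivity) (by positivity) two_ne_zero).1 ?_
    rw [hD2]
    nlinarith
  have hM : 2 * (N : ℝ) ^ 2 + |α * l| / N ≤ 9 * b ^ 2 := by
    have a1 : (N : ℝ) ^ 2 ≤ (2 * b) ^ 2 := pow_le_pow_left₀ (Nat.cast_nonneg _) hNb 2
    have a2 : |α * l| / N ≤ b ^ 2 := by
      rw [div_le_iff₀ (by linarith), ← hb3]
      nlinarith [mul_le_mul_of_nonneg_left hbN (sq_nonneg b)]
    nlinarith
  have hZ : ∀ s, 0 ≤ s → ‖corrSum N (modeWt hl (modeSec hl (S s f)))‖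
      ≤ 24 * b * Real.exp (-k * s) * q := by
    intro s hs
    refine (norm_corrSum_le N _).trans ?_
    calc 2 * √(2 * N + 1) * ‖modeWt hl (modeSec hl (S s f))‖
        ≤ 2 * (3 * b) * (4 * Real.exp (-k * s) * q) :=
          mul_le_mul (mul_le_mul_of_nonneg_left hD3 zero_le_two) (hu s hs) (norm_nonneg _)
            (by positivity)
      _ = 24 * b * Real.exp (-k * s) * q := by ring
  have hR : ∀ s, 0 ≤ s → ‖correctedMean hl N (modeSec hl (S s f))
      + correctedMean hl N (modeSec hl (S s g))‖ ≤ (108 * b * r * q) * Real.exp (-k * s) := by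
    intro s hs
    rw [correctedMean_apply, correctedMean_apply, corrected_mean_equation hl h1 hN
      (modeSec_of_isLAlpha hl (hS.generator_orbit hfg hs))]
    refine (norm_sum_mul_le _ _ (M := 9 * b ^ 2) (fun j hj => ?_) _).trans ?_
    · rw [Complex.norm_real]
      rw [Finset.mem_Icc, ← abs_le] at hj
      exact (abs_remCoeff_le hN _ hj).trans hM
    · rw [card_Icc_neg]
      calc 9 * b ^ 2 * D * ‖modeWt hl (modeSec hl (S s f))‖
          ≤ (9 * b * (3 * r)) * (4 * Real.exp (-k * s) * q) := by
            refine mul_le_mul ?_ (hu s hs) (norm_nonneg _) (by positivity)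
            have := mul_le_mul_of_nonneg_left hDb (by positivity : 0 ≤ 9 * b)
            nlinarith
        _ = (108 * b * r * q) * Real.exp (-k * s) := by ring
  have hmain := norm_le_of_forced_decay hk2 (by positivity : 0 ≤ 108 * b * r * q)
    (v := fun s => correctedMean hl N (modeSec hl (S s f)))
    (v' := fun s => correctedMean hl N (modeSec hl (S s g)))
    ((correctedMean hl N).continuous.comp_continuousOn (continuousOn_modeSec hS hl f))
    (fun s hs => ((correctedMean hl N).restrictScalars ℝ).hasFDerivAt.comp_hasDerivWithinAt s
      (hasDerivWithinAt_modeSec hS hfg hl hs)) hR ht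
  have e1 : 2 * (108 * b * r * q) / k = 19440000000 * b * q := by
    rw [hk]
    field_simp
    ring
  have hS0 : S 0 f = f := by rw [hS.zero]; rfl
  have hZ0 := hZ 0 le_rfl
  simp only [hS0, e1, correctedMean_apply] at hmain
  rw [hS0, mul_zero, Real.exp_zero, mul_one] at hZ0
  have hZt := hZ t ht
  have a1 : ‖modeSec hl (S t f) 0‖ ≤ ‖modeSec hl (S t f) 0 - corrSum N (modeWt hl (modeSec hl (S t f)))‖
      + ‖corrSum N (modeWt hl (modeSec hl (S t f)))‖ := by
    simpa using norm_add_le (modeSec hl (S t f) 0 - corrSum N (modeWt hl (modeSec hl (S t f))))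
      (corrSum N (modeWt hl (modeSec hl (S t f))))
  have a2 := norm_sub_le (modeSec hl f 0) (corrSum N (modeWt hl (modeSec hl f)))
  have a3 : Real.exp (-k * t) ≤ Real.exp (-t) := Real.exp_le_exp.2 (by nlinarith)
  have a4 : 24 * b * Real.exp (-k * t) * q ≤ 24 * b * Real.exp (-t) * q := by gcongr
  have a5 := mul_le_mul_of_nonneg_left
    (by linarith : ‖modeSec hl f 0 - corrSum N (modeWt hl (modeSec hl f))‖ + 19440000000 * b * q
      ≤ ‖modeSec hl f 0‖ + 24 * b * q + 19440000000 * b * q) (Real.exp_pos (-t)).le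
  have a6 : 0 ≤ b * Real.exp (-t) * q := by positivity
  nlinarith

end

section

/-! ### The projections in Fourier coordinates -/

theorem crd_zero (i : Freq) : crd 0 i = 0 := by simp [crd]

theorem coeff_modeFun (l : ℤ) (ω : L2) (n : ℤ × ℤ) :
    coeff (modeFun l ω) n = if n.1 = l then coeff ω n else 0 := by
  obtain ⟨k, j⟩ := n
  have e1 : ∫ p : Torus, modeFun l ω p * torusChar (-(k, j)) p =
      (∫ x : Circ, fourier (l + -k) x) * ∫ y : Circ, modeCoeff l ω y * fourier (-j) y := by
    have h := integral_prod_mul (μ := (volume : Measure Circ)) (ν := (volume : Measure Circ))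
      (fun x : Circ => (fourier (l + -k) x : ℂ)) (fun y : Circ => modeCoeff l ω y * fourier (-j) y)
    rw [← h, ← Measure.volume_eq_prod]
    refine integral_congr_ae (ae_of_all _ fun p => ?_)
    simp only [modeFun, torusChar_apply, fourier_add, Prod.neg_mk]
    ring
  simp only [coeff]
  rw [e1, integral_fourier]
  by_cases h : k = l
  · subst h
    rw [if_pos (by ring), if_pos rfl]
    congr 1
    have e2 : ∫ p : Circ × Circ, (ω : Torus → ℂ) p * torusChar (-(k, j)) p =
        ∫ y : Circ, ∫ x : Circ, (ω : Torus → ℂ) (x, y) * torusChar (-(k, j)) (x, y) :=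
      integral_prod_symm _ (integrable_mul_torusChar ω _)
    refine Eq.trans ?_ e2.symm
    rw [← integral_const_mul]
    refine integral_congr_ae (ae_of_all _ fun y => ?_)
    simp only [modeCoeff, torusChar_apply, Prod.neg_mk]
    simp only [← mul_assoc]
    rw [mul_inv_cancel₀ two_pi_ne_zero', one_mul, integral_mul_const]
  · rw [if_neg (by omega), if_neg h]
    simp

theorem crd_modeProj (l : ℤ) (ω : L20) (i : Freq) :
    crd (modeProj l ω) i = if i.1.1 = l then crd ω i else 0 := by
  rw [crd_eq_coeff, crd_eq_coeff]
  exact (coeff_congr (memLp_modeFun l (ω : L2)).coeFn_toLp i.pair).trans (coeff_modeFun l ω i.pair)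

theorem mem_Y_iff (ω : L20) : ω ∈ Y ↔ ∀ i : Freq, i.1.1 ^ 2 = 1 ∧ i.2 = 0 → crd ω i = 0 := by
  have key : ∀ l : ℤ, ⟪charFun l, (ω : L2)⟫_ℂ = 0 ↔ coeff (ω : L2) (l, 0) = 0 := by
    intro l
    rw [inner_charFun, coeff, mul_eq_zero, or_iff_right (inv_ne_zero two_pi_ne_zero')]
    have e : (fun p : Torus => fourier (-l) p.1 * ((ω : L2) : Torus → ℂ) p)
        = fun p : Torus => ((ω : L2) : Torus → ℂ) p * torusChar (-(l, 0)) p := by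
      funext p
      simp [torusChar_apply, mul_comm]
    rw [e]
  have hY : ω ∈ Y ↔ ∀ l : ℤ, |l| = 1 → ⟪charFun l, (ω : L2)⟫_ℂ = 0 :=
    forall₂_congr fun l _ => integral_modeFun_eq_zero_iff l (ω : L2)
  rw [hY]
  constructor
  · rintro h ⟨⟨l, hl⟩, j⟩ ⟨h1, h2⟩
    simp only at h1 h2
    subst h2
    rw [crd_eq_coeff]
    exact (key l).1 (h l (by rwa [← sq_eq_sq₀ (abs_nonneg l) zero_le_one, sq_abs, one_pow]))
  · intro h l hl1
    have hl : l ≠ 0 := by rintro rfl; simp at hl1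
    rw [key]
    have := h (⟨l, hl⟩, 0) ⟨by rw [← sq_abs, hl1, one_pow], rfl⟩
    rwa [crd_eq_coeff] at this

theorem crd_Q (ω : L20) (i : Freq) :
    crd (Q ω) i = (if i.1.1 ^ 2 = 1 ∧ i.2 = 0 then 0 else 1) * crd ω i := by
  set q : L20 := freqDiag (fun i => if i.1.1 ^ 2 = 1 ∧ i.2 = 0 then 0 else 1) 1
    (fun i => by split_ifs <;> simp) ω with hq
  have hcq : ∀ i, crd q i = (if i.1.1 ^ 2 = 1 ∧ i.2 = 0 then 0 else 1) * crd ω i := fun i =>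
    crd_freqDiag _ _ _ _ _
  have h1 : q ∈ Y := (mem_Y_iff q).2 fun i hi => by rw [hcq, if_pos hi, zero_mul]
  have h2 : ∀ y ∈ Y, ⟪ω - q, y⟫_ℂ = 0 := by
    intro y hy
    have h3 : ⟪ω - q, y⟫_ℂ = ⟪ω - q, (0 : L20)⟫_ℂ := inner_eq_of_crd fun i => by
      rw [crd_sub, hcq, crd_zero]
      by_cases hi : i.1.1 ^ 2 = 1 ∧ i.2 = 0
      · rw [(mem_Y_iff y).1 hy i hi]
      · rw [if_neg hi]; simp
    rw [h3]
    exact inner_zero_right _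
  have h4 : Q ω = q := Submodule.eq_starProjection_of_mem_of_inner_eq_zero h1 h2
  rw [h4, hcq]

variable {l : ℤ}

theorem norm_eq_norm_modeSec (hl : l ≠ 0) {ω : L20} (h : ∀ i : Freq, i.1.1 ≠ l → crd ω i = 0) :
    ‖ω‖ = ‖modeSec hl ω‖ := by
  rw [← freqBasis.repr.norm_map ω]
  refine (pow_left_inj₀ (norm_nonneg _) (norm_nonneg _) two_ne_zero).1 ?_
  rw [lp_norm_sq, lp_norm_sq]
  refine ((Prod.mk_right_injective (⟨l, hl⟩ : {l : ℤ // l ≠ 0})).tsum_eq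
    (f := fun i => ‖freqBasis.repr ω i‖ ^ 2) ?_).symm
  intro i hi
  by_contra hcon
  refine hi ?_
  have : crd ω i = 0 := h i fun e => hcon ⟨i.2, by
    obtain ⟨⟨k, hk⟩, j⟩ := i
    simp only at e
    subst e
    rfl⟩
  rw [crd] at this
  simp [this]

theorem norm_Q_modeProj (hl : l ≠ 0) (ω : L20) :
    ‖Q (modeProj l ω)‖ = ‖modeQ l (modeSec hl ω)‖ := by
  rw [norm_eq_norm_modeSec hl fun i hi => by rw [crd_Q, crd_modeProj, if_neg hi, mul_zero]]
  congr 1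
  ext j
  rw [modeSec_apply, crd_Q, crd_modeProj, if_pos rfl, modeQ_apply, modeSec_apply]

theorem norm_modeProj_sub_Q (hl : l ≠ 0) (h1 : l ^ 2 = 1) (ω : L20) :
    ‖modeProj l ω - Q (modeProj l ω)‖ = ‖modeSec hl ω 0‖ := by
  rw [norm_eq_norm_modeSec hl fun i hi => by
    rw [crd_sub, crd_Q, crd_modeProj, if_neg hi, mul_zero, sub_zero]]
  refine (pow_left_inj₀ (norm_nonneg _) (norm_nonneg _) two_ne_zero).1 ?_
  have e : ∀ j, modeSec hl (modeProj l ω - Q (modeProj l ω)) j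
      = if j = 0 then modeSec hl ω 0 else 0 := by
    intro j
    rw [modeSec_apply, crd_sub, crd_Q, crd_modeProj, if_pos rfl]
    by_cases hj : j = 0
    · subst hj
      rw [if_pos ⟨h1, rfl⟩, if_pos rfl, zero_mul, sub_zero, modeSec_apply]
    · rw [if_neg fun hh => hj hh.2, if_neg hj, one_mul, sub_self]
  rw [lp_norm_sq, tsum_eq_single 0 fun j hj => by rw [e, if_neg hj]; simp, e, if_pos rfl]

/-- Orbits are differentiable only for data in the domain; the final inequalities are continuous in
the datum, so density removes the restriction. -/
theorem forall_of_domain {α : ℝ} {p q : L20 → ℝ} (hp : Continuous p) (hq : Continuous q)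
    (h : ∀ f g, IsLAlpha α f g → p f ≤ q f) (f : L20) : p f ≤ q f := by
  have hsub : {ω : L20 | ∃ g, IsLAlpha α ω g} ⊆ {f | p f ≤ q f} := fun f ⟨g, hg⟩ => h f g hg
  exact closure_minimal hsub (isClosed_le hp hq) (dense_domain α f)

theorem continuous_modeSec_zero (hl : l ≠ 0) : Continuous fun ω : L20 => modeSec hl ω 0 := by
  have h : LipschitzWith 1 fun x : Mode => x 0 := LipschitzWith.of_dist_le_mul fun x y => by
    rw [NNReal.coe_one, one_mul, dist_eq_norm, dist_eq_norm, ← Pi.sub_apply, ← lp.coeFn_sub]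
    exact lp.norm_apply_le_norm two_ne_zero (x - y) 0
  exact h.continuous.comp (modeSec hl).continuous

end

end Kolmogorov

end

/-! ### The three estimates -/

theorem mainTheorem2 :
    ∃ C > (0 : ℝ), ∃ c > (0 : ℝ), ∃ α₀ > (0 : ℝ), ∀ α : ℝ, α₀ ≤ |α| →
      (∃ S : ℝ → Kolmogorov.L20 →L[ℂ] Kolmogorov.L20,
        Kolmogorov.IsSemigroupGeneratedBy S (Kolmogorov.IsLAlpha α)) ∧
      ∀ S : ℝ → Kolmogorov.L20 →L[ℂ] Kolmogorov.L20,
        Kolmogorov.IsSemigroupGeneratedBy S (Kolmogorov.IsLAlpha α) →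
        ∀ (l : ℤ) (f : Kolmogorov.L20), l ≠ 0 →
          (∀ t : ℝ, 0 < t →
            ‖Kolmogorov.Q (Kolmogorov.modeProj l (S t f))‖ ≤
              2 * Real.exp (-(1 / 2) * (2 * (l : ℝ) ^ 2 - 1) * t) *
                ‖Kolmogorov.Q (Kolmogorov.modeProj l f)‖) ∧
          (∀ t : ℝ, |α * l| ^ (-(1 / 2) : ℝ) ≤ t →
            ‖Kolmogorov.Q (Kolmogorov.modeProj l (S t f))‖ ≤
              C * Real.exp (-c * |α * l| ^ (1 / 2 : ℝ) * t) *
                ‖Kolmogorov.Q (Kolmogorov.modeProj l f)‖) ∧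
          (|l| = 1 → ∀ t : ℝ, 0 < t →
            ‖Kolmogorov.modeProj l (S t f) - Kolmogorov.Q (Kolmogorov.modeProj l (S t f))‖ ≤
              C * |α| ^ (1 / 3 : ℝ) * |Real.log (abs α)| * Real.exp (-t / 2) *
                  ‖Kolmogorov.Q (Kolmogorov.modeProj l f)‖ +
                Real.exp (-t) *
                  ‖Kolmogorov.modeProj l f - Kolmogorov.Q (Kolmogorov.modeProj l f)‖) := by
  open Kolmogorov in
  -- The first two constants come from `norm_mean_le` and `norm_modeQ_le_enhanced`. The threshold
  -- for `|α|` exceeds `180000000²`, which makes the enhanced rate at least `2`, as the estimate of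
  -- the mean requires.
  refine ⟨20000000000, by norm_num, 1 / 90000000, by norm_num, 40000000000000000, by norm_num,
    fun α hα => ⟨exists_semigroup α, fun S hS l f hl => ?_⟩⟩
  have hl1 : (1 : ℝ) ≤ |(l : ℝ)| := by exact_mod_cast Int.one_le_abs hl
  have hβ : |α| ≤ |α * l| := by rw [abs_mul]; exact le_mul_of_one_le_right (abs_nonneg _) hl1
  have hcont : ∀ t, Continuous fun f => ‖modeQ l (modeSec hl (S t f))‖ := fun t =>
    ((modeQ l).continuous.comp ((modeSec hl).continuous.comp (S t).continuous)).norm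
  have hcont0 : Continuous fun f => ‖modeQ l (modeSec hl f)‖ :=
    ((modeQ l).continuous.comp (modeSec hl).continuous).norm
  simp only [norm_Q_modeProj hl]
  refine ⟨fun t ht => ?_, fun t ht => ?_, fun h t ht => ?_⟩
  · refine forall_of_domain (α := α) (hcont t) (hcont0.const_mul _) (fun f g hfg => ?_) f
    -- The rate `l²` proved for the basic decay is better than the required `l² - 1/2`.
    refine (norm_modeQ_le hS hfg hl ht.le).trans (mul_le_mul_of_nonneg_right
      (mul_le_mul_of_nonneg_left (Real.exp_le_exp.2 ?_) zero_le_two) (norm_nonneg _))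
    linarith
  · have ht0 : 0 ≤ t := (Real.rpow_nonneg (abs_nonneg _) _).trans ht
    refine forall_of_domain (α := α) (hcont t) (hcont0.const_mul _) (fun f g hfg => ?_) f
    have h := norm_modeQ_le_enhanced hS hfg hl (by linarith) ht0
    rw [Real.sqrt_eq_rpow] at h
    exact h.trans (mul_le_mul_of_nonneg_right
      (mul_le_mul_of_nonneg_right (by norm_num) (Real.exp_pos _).le) (norm_nonneg _))
  · have h1 : l ^ 2 = 1 := by rw [← sq_abs, h, one_pow]
    simp only [norm_modeProj_sub_Q hl h1]
    have hβ' : |α * l| = |α| := by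
      have : |(l : ℝ)| = 1 := by exact_mod_cast h
      rw [abs_mul, this, mul_one]
    have hb1 : 1 ≤ |α| ^ (1 / 3 : ℝ) := Real.one_le_rpow (by linarith) (by norm_num)
    have hb3 : (|α| ^ (1 / 3 : ℝ)) ^ 3 = |α * l| := by
      rw [hβ', ← Real.rpow_natCast, ← Real.rpow_mul (abs_nonneg _)]
      norm_num
    have hlog : 1 ≤ |Real.log (abs α)| := by
      refine le_trans ?_ (le_abs_self _)
      rw [Real.le_log_iff_exp_le (by linarith)]
      have := Real.exp_one_lt_d9
      linarith
    refine forall_of_domain (α := α) (((continuous_modeSec_zero hl).comp (S t).continuous).norm)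
      ((hcont0.const_mul _).add ((continuous_modeSec_zero hl).norm.const_mul _))
      (fun f g hfg => ?_) f
    refine (norm_mean_le hS hfg hl h1 hb1 hb3 ?_ ht.le).trans ?_
    · rw [hβ']
      exact Real.le_sqrt_of_sq_le (by linarith)
    · refine add_le_add (mul_le_mul_of_nonneg_right ?_ (norm_nonneg _)) le_rfl
      -- The bound for the mean carries no logarithm and decays like `e^{-t}`; the weaker stated
      -- form follows since the logarithm is at least `1`.
      have e : Real.exp (-t) ≤ |Real.log (abs α)| * Real.exp (-t / 2) :=
        (Real.exp_le_exp.2 (by linarith : -t ≤ -t / 2)).trans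
          (le_mul_of_one_le_left (Real.exp_pos _).le hlog)
      rw [mul_assoc _ |Real.log (abs α)|]
      exact mul_le_mul_of_nonneg_left e (by positivity)
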